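/- For $d\ge 1$ let $\mathcal P_d(\mathbb R)$ be the set of monic real polynomials of degree $d$ all of whose roots are real. For $p\in\mathcal P_d(\mathbb R)$ write $p(x)=\sum_{k=0}^d x^{d-k}(-1)^k\binom dk e_k(p)$, let $\mu_p$ be the probability measure with mass $1/d$ at each root of $p$ (with multiplicity), and for $1\le n\le d$ let $$\kappa_n(p)=\frac{(-d)^{n-1}}{(n-1)!}\sum_{\pi}(-1)^{|\pi|-1}(|\pi|-1)!\prod_{V\in\pi}e_{|V|}(p)$$ be its finite free cumulants, the sum being over all set partitions $\pi$ of $\{1,\dots,n\}$. The finite free additive convolution is $[p\boxplus_d q](x)=\sum_{k=0}^d x^{d-k}(-1)^k\binom dk\sum_{i=0}^k\binom ki e_i(p)e_{k-i}(q)$. Let $m_n(\mu)=\int t^n\,d\mu(t)$. The free cumulants $(r_n(\mu))_{n\ge1}$ of a probability measure $\mu$ on $\mathbb R$ with finite moments of all orders are defined recursively by $m_n(\mu)=\sum_{\pi\in NC(n)}\prod_{V\in\pi}r_{|V|}(\mu)$, $n\ge 1$, where $NC(n)$ is the set of non-crossing partitions of $\{1,\dots,n\}$; a free additive convolution $\mu\boxplus\nu$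 is a probability measure with finite moments of all orders and $r_n(\mu\boxplus\nu)=r_n(\mu)+r_n(\nu)$ for all $n\ge1$. A sequence $\mathfrak p=(p_d)_{d\ge1}$ with $p_d\in\mathcal P_d(\mathbb R)$ has infinitesimal distribution $(\mu,\mu')$, where $\mu$ is a probability measure on $\mathbb R$ with finite moments of all orders and $\mu':\mathbb R[x]\to\mathbb R$ is linear, if for every $n\ge0$, $m_n(\mu_{p_d})\to m_n(\mu)$ and $d\,(m_n(\mu_{p_d})-m_n(\mu))\to\mu'(x^n)$ as $d\to\infty$. Numbers $(\widehat r_n(\mathfrak p))_{n\ge1}$ are the cumulant fluctuations of $\mathfrak p$ if $d\,(\kappa_n(p_d)-r_n(\mu))\to\widehat r_n(\mathfrak p)$ for every $n\ge1$; put $\widehat R_{\mathfrak p}(z)=\sum_{n\ge1}\widehat r_n(\mathfrak p)z^{n-1}$. As formal power series put $G_\mu(z)=\sum_{n\ge0}m_n(\mu)z^{-n-1}$, $G_{\mu'}(z)=\sum_{n\ge0}\mu'(x^n)z^{-n-1}$ and $$H_\mu(z)=\sum_{n\ge2}h_n(\mu)z^{-n-1},\qquad h_n(\mu)=\frac n2\sum_{\substack{t+s=n\\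 t,s\ge1}}\ \sum_{\sigma\in S_{NC}(t,s)}\frac{r_\sigma(\mu)}{ts},$$ where $r_\sigma(\mu)$ is the product of $r_{|c|}(\mu)$ over all cycles $c$ of $\sigma$ (fixed points included), and $S_{NC}(t,s)$ is the set of permutations $\sigma$ of $\{1,\dots,t+s\}$ such that, with $\gamma=(1,\dots,t)(t+1,\dots,t+s)$, the group generated by $\sigma$ and $\gamma$ acts transitively and the numbers of cycles of $\sigma$ and of $\sigma^{-1}\gamma$ (fixed points included) add up to $t+s$. **Theorem.** Suppose that $\mathfrak p=(p_d)_{d\ge1}$ and $\mathfrak q=(q_d)_{d\ge1}$ have infinitesimal distributions $(\mu,\mu')$ and $(\nu,\nu')$, respectively. Then a free additive convolution of $\mu$ and $\nu$ exists, the cumulant fluctuations of $\mathfrak p$ and of $\mathfrak q$ exist, and for $\rho=\mu\boxplus\nu$ (any free additive convolution of $\mu$ and $\nu$) the sequence $\mathfrak p\boxplus\mathfrak q=(p_d\boxplus_d q_d)_{d\ge1}$ (in particular $p_d\boxplus_d q_d\in\mathcal P_d(\mathbb R)$) has infinitesimal distribution $(\rho,\rho')$ for some linear functional $\rho'$. Moreover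 the cumulant fluctuations of $\mathfrak p\boxplus\mathfrak q$ exist, $\widehat R_{\mathfrak p\boxplus\mathfrak q}=\widehat R_{\mathfrak p}+\widehat R_{\mathfrak q}$, and, as formal power series, $$G_{\rho'}=-(\widehat R_{\mathfrak p}\circ G_{\mu\boxplus\nu})\,G'_{\mu\boxplus\nu}-(\widehat R_{\mathfrak q}\circ G_{\mu\boxplus\nu})\,G'_{\mu\boxplus\nu}-H_{\mu\boxplus\nu}.$$ -/

import Mathlib

open MeasureTheory Filter Topology Polynomial

noncomputable section

namespace FiniteFree

/-! ### Polynomials, root distributions, finite free convolution and cumulants -/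

/-- The set of monic real-rooted polynomials of degree `d` (all `d` roots are real). -/
def realRooted (d : ℕ) : Set ℝ[X] :=
  {p | p.Monic ∧ p.natDegree = d ∧ p.Splits}

/-- The root distribution of a polynomial of degree `d`: mass `1/d` at each root, counted with
multiplicity. -/
def rootDistribution (d : ℕ) (p : ℝ[X]) : Measure ℝ :=
  (d : ENNReal)⁻¹ • (p.roots.map (fun x : ℝ => Measure.dirac x)).sum

/-- The `n`-th moment of a measure on the real line. -/
def moment (μ : Measure ℝ) (n : ℕ) : ℝ := ∫ t, t ^ n ∂μ

/-- The coefficient `e_k` in `p = ∑ k ≤ d, x ^ (d - k) (-1) ^ k (d choose k) e_k`, for `k ≤ d`. -/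
def coef (d k : ℕ) (p : ℝ[X]) : ℝ := (-1) ^ k * p.coeff (d - k) / (d.choose k : ℝ)

/-- The finite free additive convolution of two polynomials of degree `d`. -/
def finiteFreeAdd (d : ℕ) (p q : ℝ[X]) : ℝ[X] :=
  ∑ k ∈ Finset.range (d + 1),
    C ((-1) ^ k * (d.choose k : ℝ) *
      ∑ i ∈ Finset.range (k + 1), (k.choose i : ℝ) * coef d i p * coef d (k - i) q) * X ^ (d - k)

/-- Set partitions of `{0, …, n - 1}`. -/
abbrev SetPartition (n : ℕ) : Type := Finpartition (Finset.univ : Finset (Fin n))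

/-- The finite free cumulant `κ_n` of a polynomial of degree `d` (meaningful for `1 ≤ n ≤ d`). -/
def finiteCumulant (d n : ℕ) (p : ℝ[X]) : ℝ :=
  (-(d : ℝ)) ^ (n - 1) / ((n - 1).factorial : ℝ) *
    ∑ π : SetPartition n, (-1) ^ (π.parts.card - 1) * ((π.parts.card - 1).factorial : ℝ) *
      ∏ V ∈ π.parts, coef d V.card p

/-! ### Non-crossing partitions, free cumulants, free additive convolution -/

/-- A set partition is non-crossing if `a < b < c < d`, `a, c ∈ V`, `b, d ∈ W` force `V = W`. -/
def IsNonCrossing {n : ℕ} (π : SetPartition n) : Prop :=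
  ∀ V ∈ π.parts, ∀ W ∈ π.parts, ∀ a ∈ V, ∀ b ∈ W, ∀ c ∈ V, ∀ d ∈ W,
    a < b → b < c → c < d → V = W

instance {n : ℕ} : DecidablePred (IsNonCrossing (n := n)) := fun π => by
  unfold IsNonCrossing; infer_instance

/-- The set `NC(n)` of non-crossing partitions. -/
def NC (n : ℕ) : Finset (SetPartition n) := Finset.univ.filter IsNonCrossing

/-- The free cumulants of a moment sequence `m`, defined recursively by solving the
moment-cumulant formula `m_n = ∑ π ∈ NC(n), ∏ V ∈ π, r_|V|` for `r_n`: all terms but the one of the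
one-block partition are subtracted. In those terms every block has fewer than `n` elements, so the
test `V.card < n` always succeeds and only serves the recursion;
see `moment_eq_sum_freeCumulantSeq`. -/
def freeCumulantSeq (m : ℕ → ℝ) (n : ℕ) : ℝ :=
  m n - ∑ π ∈ (NC n).filter (fun π => π.parts ≠ {Finset.univ}),
    ∏ V ∈ π.parts, if _h : V.card < n then freeCumulantSeq m V.card else 0
termination_by n

/-- The moment-cumulant formula. -/
theorem moment_eq_sum_freeCumulantSeq (m : ℕ → ℝ) {n : ℕ} (hn : 1 ≤ n) :
    m n = ∑ π ∈ NC n, ∏ V ∈ π.parts, freeCumulantSeq m V.card := by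
  classical
  have hne : (Finset.univ : Finset (Fin n)) ≠ ∅ := by
    have : Nonempty (Fin n) := ⟨⟨0, hn⟩⟩
    exact Finset.univ_nonempty.ne_empty
  have hone : (Finpartition.indiscrete hne).parts = {Finset.univ} := rfl
  have hmem : Finpartition.indiscrete hne ∈ NC n := by
    refine Finset.mem_filter.2 ⟨Finset.mem_univ _, ?_⟩
    intro V hV W hW
    rw [hone, Finset.mem_singleton] at hV hW
    intros
    rw [hV, hW]
  have hfil : (NC n).filter (fun π => ¬ π.parts ≠ {Finset.univ}) =
      {Finpartition.indiscrete hne} := by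
    ext π
    simp only [Finset.mem_filter, Finset.mem_singleton, not_not]
    constructor
    · rintro ⟨-, h⟩
      exact Finpartition.ext h
    · rintro rfl
      exact ⟨hmem, hone⟩
  have hrec : ∑ π ∈ (NC n).filter (fun π => π.parts ≠ {Finset.univ}),
        ∏ V ∈ π.parts, (if _h : V.card < n then freeCumulantSeq m V.card else 0) =
      ∑ π ∈ (NC n).filter (fun π => π.parts ≠ {Finset.univ}),
        ∏ V ∈ π.parts, freeCumulantSeq m V.card := by
    refine Finset.sum_congr rfl fun π hπ => Finset.prod_congr rfl fun V hV => ?_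
    have hlt : V.card < n := by
      by_contra hcon
      have hVu : V = Finset.univ := by
        rw [← Finset.card_eq_iff_eq_univ, Fintype.card_fin]
        have := Finset.card_le_univ V
        rw [Fintype.card_fin] at this
        omega
      apply (Finset.mem_filter.1 hπ).2
      refine Finset.eq_singleton_iff_unique_mem.2 ⟨hVu ▸ hV, fun W hW => ?_⟩
      obtain ⟨x, hx⟩ := π.nonempty_of_mem_parts hW
      rw [← hVu]
      exact π.eq_of_mem_parts hW hV hx (hVu ▸ Finset.mem_univ x)
    rw [dif_pos hlt]
  rw [← Finset.sum_filter_add_sum_filter_not (NC n) (fun π => π.parts ≠ {Finset.univ}), hfil,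
    Finset.sum_singleton, hone, Finset.prod_singleton, Finset.card_univ, Fintype.card_fin, ← hrec]
  conv_rhs => rw [freeCumulantSeq]
  ring

/-- The free cumulants of a measure on the real line. -/
def freeCumulant (μ : Measure ℝ) (n : ℕ) : ℝ := freeCumulantSeq (moment μ) n

/-- `ρ` is a free additive convolution of `μ` and `ν` (measures with moments of all orders): a
probability measure with moments of all orders whose free cumulants are the sums of theirs. -/
structure IsFreeAddConvolution (μ ν ρ : Measure ℝ) : Prop where
  isProbability : IsProbabilityMeasure ρ
  integrable_pow : ∀ n : ℕ, Integrable (fun t : ℝ => t ^ n) ρ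
  freeCumulant_eq : ∀ n : ℕ, 1 ≤ n → freeCumulant ρ n = freeCumulant μ n + freeCumulant ν n

/-! ### Infinitesimal distributions and cumulant fluctuations of sequences of polynomials -/

/-- The sequence `(p_d)`, `d ≥ 1`, of monic real-rooted polynomials with `deg p_d = d` has limiting
root distribution `μ`: convergence of all moments to those of the probability measure `μ`. -/
structure HasLimitingDistribution (p : ℕ → ℝ[X]) (μ : Measure ℝ) : Prop where
  mem_realRooted : ∀ d : ℕ, 1 ≤ d → p d ∈ realRooted d
  isProbability : IsProbabilityMeasure μ
  integrable_pow : ∀ n : ℕ, Integrable (fun t : ℝ => t ^ n) μ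
  tendsto_moment : ∀ n : ℕ,
    Tendsto (fun d : ℕ => moment (rootDistribution d (p d)) n) atTop (𝓝 (moment μ n))

/-- The sequence `(p_d)` has infinitesimal distribution `(μ, μ')`. -/
structure HasInfinitesimalDistribution (p : ℕ → ℝ[X]) (μ : Measure ℝ) (μ' : ℝ[X] →ₗ[ℝ] ℝ) :
    Prop extends HasLimitingDistribution p μ where
  tendsto_infinitesimal : ∀ n : ℕ,
    Tendsto (fun d : ℕ => (d : ℝ) * (moment (rootDistribution d (p d)) n - moment μ n))
      atTop (𝓝 (μ' (X ^ n)))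

/-- `(r̂_n)`, `n ≥ 1`, are the cumulant fluctuations of the sequence `(p_d)` with limiting
distribution `μ`: `κ_n(p_d) = r_n(μ) + r̂_n / d + o(1/d)` as `d → ∞`. The value at `0` plays no
role. -/
def HasCumulantFluctuations (p : ℕ → ℝ[X]) (μ : Measure ℝ) (rhat : ℕ → ℝ) : Prop :=
  ∀ n : ℕ, 1 ≤ n →
    Tendsto (fun d : ℕ => (d : ℝ) * (finiteCumulant d n (p d) - freeCumulant μ n))
      atTop (𝓝 (rhat n))

/-! ### Annular non-crossing permutations -/

/-- The number of cycles of a permutation, fixed points included. -/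
def numCycles {α : Type} [Fintype α] [DecidableEq α] (σ : Equiv.Perm α) : ℕ :=
  σ.partition.parts.card

/-- The permutation `(1, …, t)(t + 1, …, t + s)`, with `Fin t ⊕ Fin s` in place of `[t + s]`. -/
def annularGamma (t s : ℕ) : Equiv.Perm (Fin t ⊕ Fin s) :=
  Equiv.sumCongr (finRotate t) (finRotate s)

/-- `σ` is a non-crossing permutation of the `(t, s)`-annulus. -/
def IsAnnularNC (t s : ℕ) (σ : Equiv.Perm (Fin t ⊕ Fin s)) : Prop :=
  MulAction.IsPretransitive (Subgroup.closure {σ, annularGamma t s}) (Fin t ⊕ Fin s) ∧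
    numCycles σ + numCycles (σ⁻¹ * annularGamma t s) = t + s

open Classical in
/-- The set `S_NC(t, s)`. -/
def annularNC (t s : ℕ) : Finset (Equiv.Perm (Fin t ⊕ Fin s)) :=
  Finset.univ.filter (IsAnnularNC t s)

/-- `h_n(μ) = (n / 2) ∑_{t + s = n; t, s ≥ 1} ∑_{σ ∈ S_NC(t, s)} r_σ(μ) / (t s)`, where `r_σ(μ)` is
the product of `r_|c|(μ)` over all cycles `c` of `σ`, fixed points included. -/
def hCoeff (μ : Measure ℝ) (n : ℕ) : ℝ :=
  (n : ℝ) / 2 *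
    ∑ ts ∈ (Finset.HasAntidiagonal.antidiagonal n).filter (fun ts => 1 ≤ ts.1 ∧ 1 ≤ ts.2),
      ∑ σ ∈ annularNC ts.1 ts.2,
        (σ.partition.parts.map (freeCumulant μ)).prod / ((ts.1 : ℝ) * (ts.2 : ℝ))

/-! ### Formal power series

Formal series `∑ a_n z ^ (-n)`, `n ≥ 0`, in the inverse of the variable `z` are represented as
elements of `ℝ⟦X⟧` with `X = z⁻¹`. -/

/-- The Cauchy transform `G_μ(z) = ∑_{n ≥ 0} m_n(μ) z ^ (-n - 1)`, as a series in `z⁻¹`. -/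
def cauchySeries (μ : Measure ℝ) : PowerSeries ℝ :=
  PowerSeries.X * PowerSeries.mk fun n => moment μ n

/-- The Cauchy transform `∑_{n ≥ 0} μ'(x ^ n) z ^ (-n - 1)` of a linear functional, as a series
in `z⁻¹`. -/
def infCauchySeries (μ' : ℝ[X] →ₗ[ℝ] ℝ) : PowerSeries ℝ :=
  PowerSeries.X * PowerSeries.mk fun n => μ' (X ^ n)

/-- The `H`-transform `H_μ(z) = ∑_{n ≥ 2} h_n(μ) z ^ (-n - 1)`, as a series in `z⁻¹`
(`h_0 = h_1 = 0`, as empty sums). -/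
def hSeries (μ : Measure ℝ) : PowerSeries ℝ :=
  PowerSeries.X * PowerSeries.mk fun n => hCoeff μ n

/-- The series `R̂(z) = ∑_{n ≥ 1} r̂_n z ^ (n - 1)`, an ordinary power series in `z`. -/
def fluctuationSeries (rhat : ℕ → ℝ) : PowerSeries ℝ :=
  PowerSeries.mk fun n => rhat (n + 1)

/-- The formal derivative `d/dz` of a series in `X = z⁻¹`; as `dX/dz = -z⁻²`, it is
`-X² · d/dX`. -/
def zDeriv (F : PowerSeries ℝ) : PowerSeries ℝ :=
  -(PowerSeries.X ^ 2 * PowerSeries.derivative ℝ F)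

/-- `zDeriv` sends `z ^ (-n)` to `-n z ^ (-n - 1)`. -/
theorem zDeriv_X_pow (n : ℕ) :
    zDeriv (PowerSeries.X ^ n) = -((n : PowerSeries ℝ) * PowerSeries.X ^ (n + 1)) := by
  rcases n with _ | n
  · simp [zDeriv]
  · simp [zDeriv, Derivation.leibniz_pow]
    ring

/-- `G_μ` has no constant term as a series in `z⁻¹`, so it may be substituted into any power
series. -/
theorem hasSubst_cauchySeries (μ : Measure ℝ) : PowerSeries.HasSubst (cauchySeries μ) :=
  PowerSeries.HasSubst.of_constantCoeff_zero' (by simp [cauchySeries])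

/-- The composition `R̂ ∘ G_μ`, a series in `z⁻¹`. -/
def compCauchy (R : PowerSeries ℝ) (μ : Measure ℝ) : PowerSeries ℝ :=
  PowerSeries.subst (cauchySeries μ) R

end FiniteFree

end

open FiniteFree

set_option linter.unusedSectionVars false

/-! For `p` of degree `d` let `A = ∏ (1 - r X)` over the roots, with `X = z⁻¹`, so that `A = z⁻ᵈ
p(z)`. The operator `T F = X F + d⁻¹ F'`, with the derivative taken in `z`, satisfies `T A = G A`,
where `G = p' / (d p)` is the Cauchy transform of the root distribution. Up to normalization the
finite free cumulants are the coefficients of the logarithm of the exponential generating function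
of the `e_k`. The resulting recursion for the `e_k` says that `∑ κ_n Tⁿ A = (M - 1) A` up to order
`d`, where `M` is the moment series. Dividing by `A` gives `M - 1 = ∑ κ_n Q_n` with `Q_0 = 1` and
`Q_{n+1} = G Q_n + d⁻¹ Q_n'` (`moment_rootDistribution_eq_sum`). The system is triangular, so
first-order expansions in `1/d` of the moments and of the cumulants imply each other.

Now `Q_n = Gⁿ + d⁻¹ (n choose 2) Gⁿ⁻² G' + o(1/d)`. Put `S(w) = ∑ r_n wⁿ`, and let `y` be the limit
of `G` and `g` its correction of order `1/d`. Order zero reads `y = X (1 + S(y))`, the functional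
equation that characterizes free cumulants. Order one reads `g = X (R̂(y) y + S'(y) g + ½ S''(y)
y')`. Differentiating the functional equation gives `(1 - X S'(y)) y' = -X y`, hence `g = -R̂(y) y'
+ ½ X S''(y) y' / (1 - X S'(y))`. What remains is to identify the last term with `-H`, which is
`annulusSeries_zero`.

That identity is combinatorial. With `γ` the product of the two rotations, annular non-crossing
permutations are those of defect two that cross between the two cycles of `γ`. Removing a root point
from `σ` amounts to multiplying both `σ` and `γ` by a transposition. This cuts a cycle of `γ` or
merges two, and yields recursions for the weighted sums (`sum_disc_aux`, `sum_annulus_aux`) whose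
generating series can be solved in closed form. Non-crossing partitions obey the same disc recursion
(`sum_NC_eq_rootedDisc`), which ties the free cumulants to the functional equation.

Three facts complete the proof. The convolution multiplies exponential generating functions, so
cumulants add (`finiteCumulant_finiteFreeAdd`). It preserves real-rootedness by Grace's theorem,
since its value at `z` is an apolar pairing of `p(· + z)` with `q` (`apolar_ne_zero`). A limit of
moment sequences of probability measures is again a moment sequence
(`exists_measure_of_tendsto_moment`), which provides the free convolution. -/

namespace FiniteFree

open Equiv Equiv.Perm

/-! ### Cycles of a permutation and multiplication by a transposition -/

section CycleCounting

variable {Ω : Type*} [Fintype Ω] [DecidableEq Ω]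

open Classical in
/-- The cycle of `σ` through `x`, as a finset. -/
noncomputable def cycleClass (σ : Perm Ω) (x : Ω) : Finset Ω :=
  Finset.univ.filter fun y => σ.SameCycle x y

theorem mem_cycleClass {σ : Perm Ω} {x y : Ω} : y ∈ cycleClass σ x ↔ σ.SameCycle x y := by
  simp [cycleClass]

theorem cycleClass_eq_iff {σ : Perm Ω} {x y : Ω} :
    cycleClass σ x = cycleClass σ y ↔ σ.SameCycle x y := by
  constructor
  · intro h
    have : y ∈ cycleClass σ x := h ▸ mem_cycleClass.2 (SameCycle.refl _ _)
    exact mem_cycleClass.1 this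
  · intro h
    ext z
    simp only [mem_cycleClass]
    exact ⟨fun h' => h.symm.trans h', fun h' => h.trans h'⟩

/-- The number of cycles of `σ` meeting `S`. -/
noncomputable def cycleCountOn (σ : Perm Ω) (S : Finset Ω) : ℕ := (S.image (cycleClass σ)).card

/-- The number of cycles of `σ`, fixed points included. -/
noncomputable def cycleCount (σ : Perm Ω) : ℕ := cycleCountOn σ Finset.univ

theorem cycleClass_of_fixed {σ : Perm Ω} {x : Ω} (h : σ x = x) : cycleClass σ x = {x} := by
  ext y
  rw [mem_cycleClass, Finset.mem_singleton]
  constructor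
  · intro hs
    exact (hs.eq_of_left h).symm
  · rintro rfl
    exact SameCycle.refl _ _

theorem cycleClass_eq_support_cycleOf {σ : Perm Ω} {x : Ω} (h : σ x ≠ x) :
    cycleClass σ x = (σ.cycleOf x).support := by
  ext y
  rw [mem_cycleClass, mem_support_cycleOf_iff' h]

/-- Translates between cycles as subsets, used in all the counting, and the cycle type: classes with
at least two elements are supports of cycle factors, the others are fixed points. -/
theorem image_cycleClass_val_map_card (σ : Perm Ω) :
    ((Finset.univ.image (cycleClass σ)).val.map Finset.card) = σ.partition.parts := by
  have hsplit : Finset.univ.image (cycleClass σ) =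
      (σ.cycleFactorsFinset.image Perm.support).disjUnion
        (σ.supportᶜ.image fun x => ({x} : Finset Ω)) (by
          rw [Finset.disjoint_left]
          intro B hB hB'
          obtain ⟨c, hc, rfl⟩ := Finset.mem_image.1 hB
          obtain ⟨x, hx, h⟩ := Finset.mem_image.1 hB'
          have := (mem_cycleFactorsFinset_iff.1 hc).1.two_le_card_support
          rw [← h] at this
          simp at this) := by
    ext B
    simp only [Finset.mem_image, Finset.mem_univ, true_and, Finset.mem_disjUnion,
      Finset.mem_compl, Perm.mem_support, not_not]
    constructor
    · rintro ⟨x, rfl⟩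
      by_cases hx : σ x = x
      · exact Or.inr ⟨x, hx, (cycleClass_of_fixed hx).symm⟩
      · exact Or.inl ⟨σ.cycleOf x, cycleOf_mem_cycleFactorsFinset_iff.2 (Perm.mem_support.2 hx),
          (cycleClass_eq_support_cycleOf hx).symm⟩
    · rintro (⟨c, hc, rfl⟩ | ⟨x, hx, rfl⟩)
      · obtain ⟨x, hx⟩ := (mem_cycleFactorsFinset_iff.1 hc).1.nonempty_support
        refine ⟨x, ?_⟩
        have hc' := cycle_is_cycleOf hx hc
        have hx' : x ∈ σ.support := mem_cycleFactorsFinset_support_le hc hx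
        rw [cycleClass_eq_support_cycleOf (Perm.mem_support.1 hx'), ← hc']
      · exact ⟨x, cycleClass_of_fixed hx⟩
  have hinj : Set.InjOn Perm.support (σ.cycleFactorsFinset : Set (Perm Ω)) := by
    intro c hc d hd h
    obtain ⟨x, hx⟩ := (mem_cycleFactorsFinset_iff.1 hc).1.nonempty_support
    have hx' : x ∈ d.support := by
      have h' : c.support = d.support := h
      rwa [← h']
    rw [cycle_is_cycleOf hx hc, cycle_is_cycleOf hx' hd]
  rw [hsplit, Finset.disjUnion_val, Multiset.map_add, Finset.image_val_of_injOn hinj,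
    Finset.image_val_of_injOn (Finset.singleton_injective.injOn), parts_partition,
    Multiset.map_map, Multiset.map_map, cycleType_def]
  congr 1
  rw [Multiset.eq_replicate]
  refine ⟨?_, ?_⟩
  · rw [Multiset.card_map, Finset.card_val, Finset.card_compl]
  · intro b hb
    obtain ⟨x, -, rfl⟩ := Multiset.mem_map.1 hb
    simp

theorem cycleCount_eq_card_parts (σ : Perm Ω) : cycleCount σ = σ.partition.parts.card := by
  rw [← image_cycleClass_val_map_card, Multiset.card_map]
  rfl

theorem sign_eq_cycleCount (σ : Perm Ω) :
    sign σ = (-1 : ℤˣ) ^ (Fintype.card Ω + cycleCount σ) := by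
  rw [sign_of_cycleType, cycleCount_eq_card_parts, parts_partition, Multiset.card_add,
    Multiset.card_replicate, sum_cycleType]
  have h := Finset.card_le_univ σ.support
  have : Fintype.card Ω + (Multiset.card σ.cycleType + (Fintype.card Ω - σ.support.card)) =
      (σ.support.card + Multiset.card σ.cycleType) + 2 * (Fintype.card Ω - σ.support.card) := by
    omega
  rw [this, pow_add _ (_ + _), pow_mul]
  simp

/-- The classes of the partition obtained from the cycles of `σ` by joining those of
`a` and `b`. -/
noncomputable def joinClass (σ : Perm Ω) (a b x : Ω) : Finset Ω :=
  if σ.SameCycle a x ∨ σ.SameCycle b x then cycleClass σ a ∪ cycleClass σ b else cycleClass σ x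

theorem joinClass_of_sameCycle {σ : Perm Ω} {a b : Ω} (hab : σ.SameCycle a b) :
    joinClass σ a b = cycleClass σ := by
  funext x
  unfold joinClass
  split_ifs with h
  · have hax : σ.SameCycle a x := h.elim id fun h' => hab.trans h'
    rw [cycleClass_eq_iff.2 hab.symm, Finset.union_idempotent, cycleClass_eq_iff.2 hax]
  · rfl

theorem card_image_joinClass (σ : Perm Ω) (a b : Ω) :
    (Finset.univ.image (joinClass σ a b)).card + (if σ.SameCycle a b then 0 else 1) =
      cycleCount σ := by
  classical
  by_cases hab : σ.SameCycle a b
  · rw [if_pos hab, add_zero, cycleCount, cycleCountOn, joinClass_of_sameCycle hab]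
  · rw [if_neg hab, cycleCount, cycleCountOn]
    have hb : cycleClass σ b ∈ Finset.univ.image (cycleClass σ) :=
      Finset.mem_image_of_mem _ (Finset.mem_univ _)
    rw [← Finset.card_erase_add_one hb]
    congr 1
    -- Once the class of `b` is erased, enlarging the class of `a` by it is injective and produces
    -- exactly the joined classes.
    let φ : Finset Ω → Finset Ω := fun B => if B = cycleClass σ a then
      cycleClass σ a ∪ cycleClass σ b else B
    have himg : Finset.univ.image (joinClass σ a b) =
        ((Finset.univ.image (cycleClass σ)).erase (cycleClass σ b)).image φ := by
      ext B
      simp only [Finset.mem_image, Finset.mem_univ, true_and, Finset.mem_erase]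
      constructor
      · rintro ⟨x, rfl⟩
        by_cases h : σ.SameCycle a x ∨ σ.SameCycle b x
        · refine ⟨cycleClass σ a, ⟨fun h' => hab (cycleClass_eq_iff.1 h'), a, rfl⟩, ?_⟩
          simp [φ, joinClass, h]
        · refine ⟨cycleClass σ x, ⟨fun h' => h (Or.inr (cycleClass_eq_iff.1 h'.symm)), x, rfl⟩, ?_⟩
          have : ¬ cycleClass σ x = cycleClass σ a := fun h' =>
            h (Or.inl (cycleClass_eq_iff.1 h'.symm))
          simp [φ, joinClass, h, this]
      · rintro ⟨C, ⟨hC, x, rfl⟩, rfl⟩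
        refine ⟨x, ?_⟩
        have hbx : ¬ σ.SameCycle b x := fun h => hC (cycleClass_eq_iff.2 h).symm
        by_cases hax : σ.SameCycle a x
        · simp [φ, joinClass, hax, cycleClass_eq_iff.2 hax.symm]
        · have : ¬ cycleClass σ x = cycleClass σ a := fun h' =>
            hax (cycleClass_eq_iff.1 h'.symm)
          simp [φ, joinClass, hax, hbx, this]
    rw [himg, Finset.card_image_of_injOn]
    intro B hB C hC h
    simp only [Finset.coe_erase, Finset.coe_image, Set.mem_sdiff, Set.mem_image,
      Set.mem_singleton_iff] at hB hC
    obtain ⟨⟨x, -, rfl⟩, hxb⟩ := hB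
    obtain ⟨⟨y, -, rfl⟩, hyb⟩ := hC
    have key : ∀ z, cycleClass σ z ≠ cycleClass σ b →
        cycleClass σ z ≠ cycleClass σ a ∪ cycleClass σ b := by
      intro z hz h'
      have : b ∈ cycleClass σ z := by
        rw [h']
        exact Finset.mem_union_right _ (mem_cycleClass.2 (SameCycle.refl _ _))
      exact hz (cycleClass_eq_iff.2 (mem_cycleClass.1 this))
    simp only [φ] at h
    split_ifs at h with h1 h2 h2
    · rw [h1, h2]
    · exact absurd h.symm (key y hyb)
    · exact absurd h (key x hxb)
    · exact h

theorem sameCycle_swap_mul_left {σ : Perm Ω} {a b x : Ω} (h : σ.SameCycle a x) :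
    (swap a b * σ).SameCycle a x ∨ (swap a b * σ).SameCycle b x := by
  obtain ⟨i, -, -, rfl⟩ := h.exists_pow_eq
  clear h
  induction i with
  | zero => exact Or.inl (by simpa using SameCycle.refl _ _)
  | succ i ih =>
    set y := (σ ^ i) a with hy
    have e : (σ ^ (i + 1)) a = σ y := by rw [pow_succ', Perm.mul_apply]
    rw [e]
    by_cases h1 : σ y = a
    · rw [h1]; exact Or.inl (SameCycle.refl _ _)
    by_cases h2 : σ y = b
    · rw [h2]; exact Or.inr (SameCycle.refl _ _)
    have : σ y = (swap a b * σ) y := by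
      rw [Perm.mul_apply, swap_apply_of_ne_of_ne h1 h2]
    rw [this, sameCycle_apply_right, sameCycle_apply_right]
    exact ih

theorem sameCycle_or_swap_mul {σ : Perm Ω} {a b x : Ω}
    (h : σ.SameCycle a x ∨ σ.SameCycle b x) :
    (swap a b * σ).SameCycle a x ∨ (swap a b * σ).SameCycle b x := by
  rcases h with h | h
  · exact sameCycle_swap_mul_left h
  · rw [swap_comm]
    exact (sameCycle_swap_mul_left h).symm

theorem sameCycle_or_swap_mul_iff {σ : Perm Ω} {a b x : Ω} :
    (swap a b * σ).SameCycle a x ∨ (swap a b * σ).SameCycle b x ↔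
      σ.SameCycle a x ∨ σ.SameCycle b x := by
  refine ⟨fun h => ?_, sameCycle_or_swap_mul⟩
  have := sameCycle_or_swap_mul h
  rwa [swap_mul_self_mul] at this

theorem sameCycle_swap_mul_of_not {σ : Perm Ω} {a b x y : Ω} (h : σ.SameCycle x y)
    (hx : ¬ (σ.SameCycle a x ∨ σ.SameCycle b x)) : (swap a b * σ).SameCycle x y := by
  obtain ⟨i, -, -, rfl⟩ := h.exists_pow_eq
  clear h
  induction i with
  | zero => exact SameCycle.refl _ _
  | succ i ih =>
    set y := (σ ^ i) x with hy
    have e : (σ ^ (i + 1)) x = σ y := by rw [pow_succ', Perm.mul_apply]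
    have hs : σ.SameCycle x (σ y) := ⟨(i + 1 : ℕ), by rw [zpow_natCast, e]⟩
    rw [e]
    have : σ y = (swap a b * σ) y := by
      rw [Perm.mul_apply, swap_apply_of_ne_of_ne]
      · intro h; exact hx (Or.inl (h ▸ hs).symm)
      · intro h; exact hx (Or.inr (h ▸ hs).symm)
    rw [this, sameCycle_apply_right]
    exact ih

/-- The transposition only rearranges the union of the cycles of `a` and `b`; every other cycle is
untouched. -/
theorem joinClass_swap_mul (σ : Perm Ω) (a b : Ω) :
    joinClass (swap a b * σ) a b = joinClass σ a b := by
  funext x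
  unfold joinClass
  simp only [sameCycle_or_swap_mul_iff]
  split_ifs with h
  · ext y
    simp only [Finset.mem_union, mem_cycleClass, sameCycle_or_swap_mul_iff]
  · ext y
    simp only [mem_cycleClass]
    constructor
    · intro h'
      have := sameCycle_swap_mul_of_not (a := a) (b := b) h' (by rwa [sameCycle_or_swap_mul_iff])
      rwa [swap_mul_self_mul] at this
    · exact fun h' => sameCycle_swap_mul_of_not h' h

/-- A parity argument instead of a chase along orbits: both permutations have the same joined
classes, so if `a` and `b` were joined in both or separated in both, the cycle counts would agree,
whereas the transposition changes the sign. -/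
theorem not_sameCycle_iff_swap_mul {σ : Perm Ω} {a b : Ω} (hab : a ≠ b) :
    (swap a b * σ).SameCycle a b ↔ ¬ σ.SameCycle a b := by
  have h1 := card_image_joinClass σ a b
  have h2 := card_image_joinClass (swap a b * σ) a b
  rw [joinClass_swap_mul] at h2
  have hs : sign (swap a b * σ) = - sign σ := by
    rw [Perm.sign_mul, sign_swap hab, neg_one_mul]
  rw [sign_eq_cycleCount, sign_eq_cycleCount] at hs
  constructor
  · intro h h'
    rw [if_pos h] at h2
    rw [if_pos h'] at h1
    rw [← h1, ← h2] at hs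
    exact units_ne_neg_self _ hs
  · intro h
    by_contra h'
    rw [if_neg h'] at h2
    rw [if_neg h] at h1
    rw [← h1, ← h2] at hs
    exact units_ne_neg_self _ hs

theorem cycleCount_swap_mul_of_not_sameCycle {σ : Perm Ω} {a b : Ω} (hab : ¬ σ.SameCycle a b) :
    cycleCount (swap a b * σ) + 1 = cycleCount σ := by
  have hne : a ≠ b := by rintro rfl; exact hab (SameCycle.refl _ _)
  have h1 := card_image_joinClass σ a b
  have h2 := card_image_joinClass (swap a b * σ) a b
  rw [joinClass_swap_mul, if_pos ((not_sameCycle_iff_swap_mul hne).2 hab)] at h2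
  rw [if_neg hab] at h1
  omega

theorem cycleCount_swap_mul_of_sameCycle {σ : Perm Ω} {a b : Ω} (hne : a ≠ b)
    (hab : σ.SameCycle a b) : cycleCount (swap a b * σ) = cycleCount σ + 1 := by
  have h := cycleCount_swap_mul_of_not_sameCycle (σ := swap a b * σ) (a := a) (b := b)
    (fun h => (not_sameCycle_iff_swap_mul hne).1 h hab)
  rw [swap_mul_self_mul] at h
  exact h.symm

end CycleCounting

/-! ### The defect of a permutation relative to `γ` -/

section Defect

variable {Ω : Type*} [Fintype Ω] [DecidableEq Ω]

/-- The defect `|σ| + |σ⁻¹ γ| - |γ|` in the triangle inequality for the lengths of permutations. -/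
noncomputable def defect (γ σ : Perm Ω) : ℤ :=
  Fintype.card Ω - cycleCount σ - cycleCount (σ⁻¹ * γ) + cycleCount γ

theorem cycleCountOn_one (S : Finset Ω) : cycleCountOn (1 : Perm Ω) S = S.card := by
  rw [cycleCountOn, Finset.card_image_of_injective]
  intro x y h
  simpa using cycleClass_eq_iff.1 h

@[simp]
theorem defect_one (γ : Perm Ω) : defect γ 1 = 0 := by
  simp [defect, cycleCount, cycleCountOn_one]

theorem cycleCount_swap_mul_of_fixed {σ : Perm Ω} {a b : Ω} (hab : a ≠ b) (ha : σ a = a) :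
    cycleCount (swap a b * σ) + 1 = cycleCount σ :=
  cycleCount_swap_mul_of_not_sameCycle fun h => hab (h.eq_of_left ha)

theorem swap_mul_inv_mul (a b : Ω) (σ γ : Perm Ω) :
    (swap a b * σ)⁻¹ * γ = σ⁻¹ * (swap a b * γ) := by
  rw [mul_inv_rev, swap_inv, mul_assoc]

theorem defect_swap_mul_of_sameCycle {γ σ : Perm Ω} {a b : Ω} (hab : a ≠ b) (ha : σ a = a)
    (hγ : γ.SameCycle a b) : defect γ (swap a b * σ) = defect (swap a b * γ) σ := by
  have h1 := cycleCount_swap_mul_of_fixed hab ha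
  have h2 := cycleCount_swap_mul_of_sameCycle hab hγ
  unfold defect
  rw [swap_mul_inv_mul]
  omega

/-- The transposition can be moved from `σ` to `γ` without changing `σ⁻¹ γ`. On the `σ` side one
cycle is lost. If `a` and `b` share a cycle of `γ`, that cycle is cut and the changes cancel; if
not, two cycles of `γ` merge and the defect drops by two. -/
theorem defect_swap_mul_of_not_sameCycle {γ σ : Perm Ω} {a b : Ω} (ha : σ a = a)
    (hγ : ¬ γ.SameCycle a b) : defect γ (swap a b * σ) = defect (swap a b * γ) σ + 2 := by
  have hab : a ≠ b := by rintro rfl; exact hγ (SameCycle.refl _ _)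
  have h1 := cycleCount_swap_mul_of_fixed hab ha
  have h2 := cycleCount_swap_mul_of_not_sameCycle hγ
  unfold defect
  rw [swap_mul_inv_mul]
  omega

theorem swap_apply_mul_apply_self (σ : Perm Ω) (a : Ω) : (swap a (σ a) * σ) a = a := by
  rw [Perm.mul_apply, swap_apply_right]

/-- Induction on the support: making a moved point `a` fixed by `swap a (σ a)` shrinks the support,
and transferring this transposition to `γ` preserves the defect or lowers it by two. -/
theorem defect_nonneg (γ σ : Perm Ω) : 0 ≤ defect γ σ := by
  induction h : σ.support.card using Nat.strong_induction_on generalizing γ σ with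
  | _ n ih =>
    by_cases hσ : σ = 1
    · simp [hσ]
    · obtain ⟨a, ha⟩ : ∃ a, σ a ≠ a := by
        by_contra! hcon
        exact hσ (Perm.ext hcon)
      have hlt : (swap a (σ a) * σ).support.card < n := by
        rw [← h]
        exact card_support_swap_mul ha
      have hd := ih _ hlt (swap a (σ a) * γ) (swap a (σ a) * σ) rfl
      have hσ' : σ = swap a (σ a) * (swap a (σ a) * σ) := by rw [swap_mul_self_mul]
      have hfix := swap_apply_mul_apply_self σ a
      by_cases hs : γ.SameCycle a (σ a)
      · have := defect_swap_mul_of_sameCycle (Ne.symm ha) hfix hs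
        rw [← hσ'] at this
        omega
      · have := defect_swap_mul_of_not_sameCycle hfix hs
        rw [← hσ'] at this
        omega

/-- A permutation crossing between cycles of `γ` has defect at least two. -/
theorem two_le_defect_of_not_sameCycle {γ σ : Perm Ω} {a : Ω} (h : ¬ γ.SameCycle a (σ a)) :
    2 ≤ defect γ σ := by
  have hfix := swap_apply_mul_apply_self σ a
  have := defect_swap_mul_of_not_sameCycle hfix h
  rw [swap_mul_self_mul] at this
  have := defect_nonneg (swap a (σ a) * γ) (swap a (σ a) * σ)
  omega

theorem sameCycle_apply_of_defect_eq_zero {γ σ : Perm Ω} (h : defect γ σ = 0) (x : Ω) :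
    γ.SameCycle x (σ x) := by
  by_contra hcon
  have := two_le_defect_of_not_sameCycle hcon
  omega

/-- If a permutation of defect two crosses from the cycle of `a` to that of `σ a`, then it crosses
nowhere else. -/
theorem sameCycle_apply_of_defect_eq_two {γ σ : Perm Ω} (h : defect γ σ = 2) {a : Ω}
    (ha : ¬ γ.SameCycle a (σ a)) (x : Ω) :
    γ.SameCycle x (σ x) ∨ ((γ.SameCycle a x ∨ γ.SameCycle (σ a) x) ∧
      (γ.SameCycle a (σ x) ∨ γ.SameCycle (σ a) (σ x))) := by
  have hfix := swap_apply_mul_apply_self σ a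
  have hd := defect_swap_mul_of_not_sameCycle hfix ha
  rw [swap_mul_self_mul, h] at hd
  -- The crossing at `a` uses up the whole defect. What is left has defect zero for the permutation
  -- with the two cycles merged, hence preserves each of its cycles.
  have h0 : defect (swap a (σ a) * γ) (swap a (σ a) * σ) = 0 := by omega
  have hx := sameCycle_apply_of_defect_eq_zero h0 x
  have hj : ∀ y, (swap a (σ a) * γ).SameCycle a y ↔ γ.SameCycle a y ∨ γ.SameCycle (σ a) y := by
    intro y
    rw [← sameCycle_or_swap_mul_iff]
    have hne : a ≠ σ a := by
      intro h'; rw [← h'] at ha; exact ha (SameCycle.refl _ _)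
    have := (not_sameCycle_iff_swap_mul hne).2 ha
    exact ⟨Or.inl, fun h' => h'.elim id fun h'' => this.trans h''⟩
  have hx' : (swap a (σ a) * γ).SameCycle x (σ x) := by
    by_cases h1 : σ x = a
    · rw [Perm.mul_apply, h1, swap_apply_left] at hx
      rw [h1]
      refine hx.trans ?_
      exact ((hj (σ a)).2 (Or.inr (SameCycle.refl _ _))).symm
    by_cases h2 : σ x = σ a
    · rw [Perm.mul_apply, h2, swap_apply_right] at hx
      rw [h2]
      exact hx.trans ((hj (σ a)).2 (Or.inr (SameCycle.refl _ _)))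
    rwa [Perm.mul_apply, swap_apply_of_ne_of_ne h1 h2] at hx
  by_cases hax : γ.SameCycle a x ∨ γ.SameCycle (σ a) x
  · refine Or.inr ⟨hax, ?_⟩
    rw [← hj] at hax ⊢
    exact hax.trans hx'
  · left
    have := sameCycle_swap_mul_of_not (a := a) (b := σ a) hx' (by rwa [sameCycle_or_swap_mul_iff])
    rwa [swap_mul_self_mul] at this

/-! ### Permutations preserving a set -/

theorem apply_mem_iff_of_sameCycle {σ : Perm Ω} {U : Finset Ω} (hU : ∀ x, σ x ∈ U ↔ x ∈ U)
    {x y : Ω} (h : σ.SameCycle x y) : x ∈ U ↔ y ∈ U := by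
  obtain ⟨i, -, -, rfl⟩ := h.exists_pow_eq
  clear h
  induction i with
  | zero => simp
  | succ i ih => rw [pow_succ', Perm.mul_apply, hU, ih]

theorem cycleClass_eq_of_eqOn {σ τ : Perm Ω} {U : Finset Ω} (hσ : ∀ x, σ x ∈ U ↔ x ∈ U)
    (h : ∀ x ∈ U, σ x = τ x) {x : Ω} (hx : x ∈ U) : cycleClass σ x = cycleClass τ x := by
  have hpow : ∀ i : ℕ, (σ ^ i) x ∈ U ∧ (σ ^ i) x = (τ ^ i) x := by
    intro i
    induction i with
    | zero => simpa using hx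
    | succ i ih =>
      rw [pow_succ', Perm.mul_apply, pow_succ', Perm.mul_apply, hσ]
      exact ⟨ih.1, by rw [h _ ih.1, ih.2]⟩
  ext y
  rw [mem_cycleClass, mem_cycleClass]
  constructor
  · intro hs
    obtain ⟨i, -, -, rfl⟩ := hs.exists_pow_eq
    rw [(hpow i).2]
    exact ⟨i, by simp⟩
  · intro hs
    obtain ⟨i, -, -, rfl⟩ := hs.exists_pow_eq
    rw [← (hpow i).2]
    exact ⟨i, by simp⟩

theorem cycleCountOn_congr {σ τ : Perm Ω} {U : Finset Ω} (hσ : ∀ x, σ x ∈ U ↔ x ∈ U)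
    (h : ∀ x ∈ U, σ x = τ x) : cycleCountOn σ U = cycleCountOn τ U := by
  rw [cycleCountOn, cycleCountOn]
  congr 1
  exact Finset.image_congr fun x hx => cycleClass_eq_of_eqOn hσ h hx

theorem cycleCount_eq_add {σ : Perm Ω} {U : Finset Ω} (hσ : ∀ x, σ x ∈ U ↔ x ∈ U) :
    cycleCount σ = cycleCountOn σ U + cycleCountOn σ Uᶜ := by
  rw [cycleCount, cycleCountOn, ← Finset.union_compl U, Finset.image_union,
    Finset.card_union_of_disjoint]
  · rfl
  · rw [Finset.disjoint_left]
    intro B hB hB'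
    obtain ⟨x, hx, rfl⟩ := Finset.mem_image.1 hB
    obtain ⟨y, hy, h⟩ := Finset.mem_image.1 hB'
    have := apply_mem_iff_of_sameCycle hσ (cycleClass_eq_iff.1 h)
    rw [Finset.mem_compl] at hy
    exact hy (this.2 hx)

theorem preserves_compl {σ : Perm Ω} {U : Finset Ω} (hσ : ∀ x, σ x ∈ U ↔ x ∈ U) (x : Ω) :
    σ x ∈ Uᶜ ↔ x ∈ Uᶜ := by
  simp [hσ]

theorem preserves_of_fixed_compl {σ : Perm Ω} {U : Finset Ω} (hσ : ∀ x, x ∉ U → σ x = x) (x : Ω) :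
    σ x ∈ U ↔ x ∈ U := by
  constructor
  · intro h
    by_contra hx
    rw [hσ x hx] at h
    exact hx h
  · intro h
    by_contra hx
    have := σ.injective (hσ _ hx)
    rw [this] at hx
    exact hx h

theorem preserves_inv {σ : Perm Ω} {U : Finset Ω} (hσ : ∀ x, σ x ∈ U ↔ x ∈ U) (x : Ω) :
    σ⁻¹ x ∈ U ↔ x ∈ U := by
  rw [← hσ (σ⁻¹ x), ← Perm.mul_apply, mul_inv_cancel, Perm.one_apply]

theorem preserves_mul {σ τ : Perm Ω} {U : Finset Ω} (hσ : ∀ x, σ x ∈ U ↔ x ∈ U)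
    (hτ : ∀ x, τ x ∈ U ↔ x ∈ U) (x : Ω) : (σ * τ) x ∈ U ↔ x ∈ U := by
  rw [Perm.mul_apply, hσ, hτ]

/-- Every cycle count in the defect splits over `U` and its complement, and on each half one of the
factors is the identity. Additivity is what lets the weighted sums factor. -/
theorem defect_mul {γ σ τ : Perm Ω} {U : Finset Ω} (hγ : ∀ x, γ x ∈ U ↔ x ∈ U)
    (hσ : ∀ x, x ∉ U → σ x = x) (hτ : ∀ x, x ∈ U → τ x = x) :
    defect γ (σ * τ) = defect γ σ + defect γ τ := by
  have pσ := preserves_of_fixed_compl hσ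
  have pτ' := preserves_of_fixed_compl (U := Uᶜ) (σ := τ) (by simpa using hτ)
  have pτ : ∀ x, τ x ∈ U ↔ x ∈ U := by simpa using preserves_compl pτ'
  have hσi : ∀ x, x ∉ U → σ⁻¹ x = x := fun x hx => by
    rw [Perm.inv_eq_iff_eq, hσ x hx]
  have hτi : ∀ x, x ∈ U → τ⁻¹ x = x := fun x hx => by
    rw [Perm.inv_eq_iff_eq, hτ x hx]
  have p1 := preserves_mul pσ pτ
  have pi1 := preserves_mul (preserves_inv p1) hγ
  have pi2 := preserves_mul (preserves_inv pσ) hγ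
  have pi3 := preserves_mul (preserves_inv pτ) hγ
  have hcard : (Fintype.card Ω : ℤ) = U.card + Uᶜ.card := by
    rw [Finset.card_compl, Nat.cast_sub (Finset.card_le_univ U)]; ring
  have e1 : cycleCountOn (σ * τ) U = cycleCountOn σ U :=
    cycleCountOn_congr p1 fun x hx => by rw [Perm.mul_apply, hτ x hx]
  have e2 : cycleCountOn (σ * τ) Uᶜ = cycleCountOn τ Uᶜ :=
    cycleCountOn_congr (preserves_compl p1) fun x hx => by
      rw [Perm.mul_apply, hσ]
      rw [pτ]; simpa using hx
  have e3 : cycleCountOn σ Uᶜ = Uᶜ.card := by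
    rw [← cycleCountOn_one]
    exact cycleCountOn_congr (preserves_compl pσ) fun x hx => by
      rw [hσ x (by simpa using hx)]; rfl
  have e4 : cycleCountOn τ U = U.card := by
    rw [← cycleCountOn_one]
    exact cycleCountOn_congr pτ fun x hx => by
      rw [hτ x hx]; rfl
  have e5 : cycleCountOn ((σ * τ)⁻¹ * γ) U = cycleCountOn (σ⁻¹ * γ) U :=
    cycleCountOn_congr pi1 fun x hx => by
      rw [Perm.mul_apply, mul_inv_rev, Perm.mul_apply, hτi]
      · rfl
      · rw [preserves_inv pσ, hγ]; exact hx
  have e6 : cycleCountOn ((σ * τ)⁻¹ * γ) Uᶜ = cycleCountOn (τ⁻¹ * γ) Uᶜ :=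
    cycleCountOn_congr (preserves_compl pi1) fun x hx => by
      rw [Perm.mul_apply, mul_inv_rev, Perm.mul_apply, hσi]
      · rfl
      · rw [hγ]; simpa using hx
  have e7 : cycleCountOn (σ⁻¹ * γ) Uᶜ = cycleCountOn γ Uᶜ :=
    cycleCountOn_congr (preserves_compl pi2) fun x hx => by
      rw [Perm.mul_apply, hσi]
      rw [hγ]; simpa using hx
  have e8 : cycleCountOn (τ⁻¹ * γ) U = cycleCountOn γ U :=
    cycleCountOn_congr pi3 fun x hx => by
      rw [Perm.mul_apply, hτi]
      rw [hγ]; exact hx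
  unfold defect
  rw [cycleCount_eq_add p1, cycleCount_eq_add pi1, cycleCount_eq_add hγ, cycleCount_eq_add pσ,
    cycleCount_eq_add pτ, cycleCount_eq_add pi2, cycleCount_eq_add pi3, e1, e2, e3, e4, e5, e6, e7,
    e8, hcard]
  push_cast
  ring

end Defect

/-! ### Weighted sums over permutations and removal of a root -/

section Weights

variable {Ω : Type*} [Fintype Ω] [DecidableEq Ω]

theorem cycleClass_swap_mul {σ : Perm Ω} {a b : Ω} (hab : ¬ σ.SameCycle a b) :
    cycleClass (swap a b * σ) = joinClass σ a b := by
  have hne : a ≠ b := by rintro rfl; exact hab (SameCycle.refl _ _)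
  rw [← joinClass_swap_mul, joinClass_of_sameCycle ((not_sameCycle_iff_swap_mul hne).2 hab)]

/-- The product of the weights `f` of the cycles of `σ` meeting `S`. -/
noncomputable def cycleProd (f : Finset Ω → ℝ) (σ : Perm Ω) (S : Finset Ω) : ℝ :=
  ∏ B ∈ S.image (cycleClass σ), f B

/-- The weight `r_|B|`, where the block of the root `a` counts for `k` elements more. -/
noncomputable def rootWeight (r : ℕ → ℝ) (a : Ω) (k : ℕ) (B : Finset Ω) : ℝ :=
  r (B.card + if a ∈ B then k else 0)

theorem rootWeight_zero (r : ℕ → ℝ) (a : Ω) : rootWeight r a 0 = fun B => r B.card := by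
  funext B
  simp [rootWeight]

theorem cycleClass_subset {σ : Perm Ω} {S : Finset Ω} (hσ : ∀ x, x ∉ S → σ x = x) {x : Ω}
    (hx : x ∈ S) : cycleClass σ x ⊆ S := by
  intro y hy
  exact (apply_mem_iff_of_sameCycle (preserves_of_fixed_compl hσ) (mem_cycleClass.1 hy)).1 hx

theorem cycleProd_congr {f g : Finset Ω → ℝ} {σ : Perm Ω} {S : Finset Ω}
    (hσ : ∀ x, x ∉ S → σ x = x) (h : ∀ B ⊆ S, f B = g B) : cycleProd f σ S = cycleProd g σ S := by
  refine Finset.prod_congr rfl fun B hB => ?_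
  obtain ⟨x, hx, rfl⟩ := Finset.mem_image.1 hB
  exact h _ (cycleClass_subset hσ hx)

theorem cycleProd_rootWeight_of_notMem (r : ℕ → ℝ) {a : Ω} (k : ℕ) {σ : Perm Ω} {S : Finset Ω}
    (hσ : ∀ x, x ∉ S → σ x = x) (ha : a ∉ S) :
    cycleProd (rootWeight r a k) σ S = cycleProd (fun B => r B.card) σ S :=
  cycleProd_congr hσ fun B hB => by
    rw [rootWeight, if_neg fun h => ha (hB h), add_zero]

theorem cycleProd_of_fixed (r : ℕ → ℝ) {a : Ω} (k : ℕ) {σ : Perm Ω} {S : Finset Ω} (ha : a ∈ S)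
    (hσ : ∀ x, x ∉ S.erase a → σ x = x) :
    cycleProd (rootWeight r a k) σ S =
      r (k + 1) * cycleProd (fun B => r B.card) σ (S.erase a) := by
  rw [← cycleProd_rootWeight_of_notMem r k hσ (Finset.notMem_erase a S)]
  have hfix : σ a = a := hσ a (Finset.notMem_erase a S)
  unfold cycleProd
  conv_lhs => rw [← Finset.insert_erase ha, Finset.image_insert, cycleClass_of_fixed hfix]
  rw [Finset.prod_insert]
  · rw [rootWeight, Finset.card_singleton, if_pos (Finset.mem_singleton_self a), add_comm]
  · intro h
    obtain ⟨x, hx, h⟩ := Finset.mem_image.1 h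
    have : a ∈ cycleClass σ x := by rw [h]; simp
    exact Finset.notMem_erase a S (cycleClass_subset hσ hx this)

/-- When the root `a` is sent to `b`, deleting `a` from its cycle makes `b` the new root, whose
block has absorbed `k + 1` elements. Only cycles meeting the current set are counted, so deleted
points, fixed from then on, contribute no factor `r 1`. -/
theorem cycleProd_swap_mul (r : ℕ → ℝ) {a b : Ω} (k : ℕ) {σ : Perm Ω} {S : Finset Ω} (ha : a ∈ S)
    (hb : b ∈ S.erase a) (hσ : ∀ x, x ∉ S.erase a → σ x = x) :
    cycleProd (rootWeight r a k) (swap a b * σ) S =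
      cycleProd (rootWeight r b (k + 1)) σ (S.erase a) := by
  have hfix : σ a = a := hσ a (Finset.notMem_erase a S)
  have hba : b ≠ a := Finset.ne_of_mem_erase hb
  have hns : ∀ x, x ≠ a → ¬ σ.SameCycle a x := fun x hx h => hx (h.eq_of_left hfix).symm
  let φ : Finset Ω → Finset Ω := fun B => if b ∈ B then insert a B else B
  have hcls : ∀ x ∈ S.erase a, cycleClass (swap a b * σ) x = φ (cycleClass σ x) := by
    intro x hx
    rw [cycleClass_swap_mul (hns b hba)]
    simp only [joinClass, φ, mem_cycleClass, hns x (Finset.ne_of_mem_erase hx), false_or,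
      cycleClass_of_fixed hfix, sameCycle_comm (x := x)]
    split_ifs with h
    · rw [cycleClass_eq_iff.2 h]; rfl
    · rfl
  have hab : cycleClass (swap a b * σ) a = cycleClass (swap a b * σ) b :=
    cycleClass_eq_iff.2 ((not_sameCycle_iff_swap_mul hba.symm).2 (hns b hba))
  have himg : S.image (cycleClass (swap a b * σ)) =
      ((S.erase a).image (cycleClass σ)).image φ := by
    conv_lhs => rw [← Finset.insert_erase ha, Finset.image_insert, hab]
    rw [Finset.insert_eq_of_mem (Finset.mem_image_of_mem _ hb), Finset.image_image]
    exact Finset.image_congr fun x hx => hcls x hx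
  have hnot : ∀ B ∈ (S.erase a).image (cycleClass σ), a ∉ B := by
    intro B hB h
    obtain ⟨x, hx, rfl⟩ := Finset.mem_image.1 hB
    exact Finset.notMem_erase a S (cycleClass_subset hσ hx h)
  unfold cycleProd
  rw [himg, Finset.prod_image]
  · refine Finset.prod_congr rfl fun B hB => ?_
    have := hnot B hB
    simp only [rootWeight, φ]
    by_cases h1 : b ∈ B
    · simp only [h1, if_true, Finset.mem_insert_self, Finset.card_insert_of_notMem this]
      congr 1; ring
    · simp only [h1, this, if_false]
  · intro B hB C hC h
    have h1 := hnot B hB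
    have h2 := hnot C hC
    simp only [φ] at h
    split_ifs at h with h3 h4 h4
    · rw [← Finset.erase_insert h1, h, Finset.erase_insert h2]
    · rw [← h] at h2; simp at h2
    · rw [h] at h1; simp at h1
    · exact h

theorem cycleProd_mul (f : Finset Ω → ℝ) {σ τ : Perm Ω} {U S T : Finset Ω}
    (hS : S ⊆ U) (hT : T ⊆ Uᶜ)
    (hσ : ∀ x, x ∉ S → σ x = x) (hτ : ∀ x, x ∉ T → τ x = x) :
    cycleProd f (σ * τ) (S ∪ T) = cycleProd f σ S * cycleProd f τ T := by
  have hTU : ∀ x ∈ U, x ∉ T := fun x hx h => by simpa [hx] using hT h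
  have hSU : ∀ x ∈ Uᶜ, x ∉ S := fun x hx h => by
    have := hS h; simp at hx; exact hx this
  have pσ : ∀ x, σ x ∈ U ↔ x ∈ U :=
    preserves_of_fixed_compl fun x hx => hσ x fun h => hx (hS h)
  have pτ' : ∀ x, τ x ∈ Uᶜ ↔ x ∈ Uᶜ :=
    preserves_of_fixed_compl fun x hx => hτ x fun h => hx (hT h)
  have pτ : ∀ x, τ x ∈ U ↔ x ∈ U := by simpa using preserves_compl pτ'
  have h1 : S.image (cycleClass (σ * τ)) = S.image (cycleClass σ) :=
    Finset.image_congr fun x hx => cycleClass_eq_of_eqOn (preserves_mul pσ pτ)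
      (fun y hy => by rw [Perm.mul_apply, hτ y (hTU y hy)]) (hS hx)
  have h2 : T.image (cycleClass (σ * τ)) = T.image (cycleClass τ) :=
    Finset.image_congr fun x hx => cycleClass_eq_of_eqOn (preserves_compl (preserves_mul pσ pτ))
      (fun y hy => by rw [Perm.mul_apply, hσ _ (hSU _ ((pτ' y).2 hy))]) (hT hx)
  unfold cycleProd
  rw [Finset.image_union, h1, h2, Finset.prod_union]
  rw [Finset.disjoint_left]
  intro B hB hB'
  obtain ⟨x, hx, rfl⟩ := Finset.mem_image.1 hB
  obtain ⟨y, hy, h⟩ := Finset.mem_image.1 hB'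
  have : x ∈ cycleClass τ y := by rw [h]; exact mem_cycleClass.2 (SameCycle.refl _ _)
  exact hTU x (hS hx) (cycleClass_subset hτ hy this)

/-- The permutations fixing all points outside `S`. -/
noncomputable def supportedPerms (S : Finset Ω) : Finset (Perm Ω) :=
  Finset.univ.filter fun σ => ∀ x, x ∉ S → σ x = x

theorem mem_supportedPerms {S : Finset Ω} {σ : Perm Ω} :
    σ ∈ supportedPerms S ↔ ∀ x, x ∉ S → σ x = x := by
  simp [supportedPerms]

open Classical in
/-- The sum of the weights of the permutations satisfying `P` and fixing all points outside `S`. -/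
noncomputable def permSum (f : Finset Ω → ℝ) (S : Finset Ω) (P : Perm Ω → Prop) : ℝ :=
  ∑ σ ∈ (supportedPerms S).filter P, cycleProd f σ S

theorem permSum_congr {f g : Finset Ω → ℝ} {S : Finset Ω} {P Q : Perm Ω → Prop}
    (hPQ : ∀ σ ∈ supportedPerms S, P σ ↔ Q σ) (hfg : ∀ B ⊆ S, f B = g B) :
    permSum f S P = permSum g S Q := by
  classical
  unfold permSum
  rw [Finset.filter_congr hPQ]
  exact Finset.sum_congr rfl fun σ hσ =>
    cycleProd_congr (mem_supportedPerms.1 (Finset.mem_filter.1 hσ).1) hfg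

theorem permSum_rootWeight_of_notMem (r : ℕ → ℝ) {a : Ω} (k : ℕ) {S : Finset Ω}
    (P : Perm Ω → Prop) (ha : a ∉ S) :
    permSum (rootWeight r a k) S P = permSum (fun B => r B.card) S P :=
  permSum_congr (fun _ _ => Iff.rfl) fun B hB => by
    rw [rootWeight, if_neg fun h => ha (hB h), add_zero]

theorem permSum_or {f : Finset Ω → ℝ} {S : Finset Ω} {P Q : Perm Ω → Prop}
    (h : ∀ σ ∈ supportedPerms S, P σ → ¬ Q σ) :
    permSum f S (fun σ => P σ ∨ Q σ) = permSum f S P + permSum f S Q := by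
  classical
  unfold permSum
  rw [← Finset.sum_union]
  · refine Finset.sum_congr ?_ fun _ _ => rfl
    ext σ
    simp only [Finset.mem_filter, Finset.mem_union, and_or_left]
  rw [Finset.disjoint_left]
  intro σ h1 h2
  rw [Finset.mem_filter] at h1 h2
  exact h σ h1.1 h1.2 h2.2

theorem permSum_eq_zero {f : Finset Ω → ℝ} {S : Finset Ω} {P : Perm Ω → Prop}
    (h : ∀ σ ∈ supportedPerms S, ¬ P σ) : permSum f S P = 0 := by
  classical
  unfold permSum
  rw [Finset.filter_false_of_mem h, Finset.sum_empty]

theorem permSum_empty {f : Finset Ω → ℝ} {P : Perm Ω → Prop} (h : P 1) :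
    permSum f ∅ P = 1 := by
  classical
  unfold permSum
  have : (supportedPerms (∅ : Finset Ω)).filter P = {1} := by
    ext σ
    simp only [Finset.mem_filter, mem_supportedPerms, Finset.mem_singleton]
    constructor
    · rintro ⟨h, -⟩
      exact Perm.ext fun x => h x (Finset.notMem_empty x)
    · rintro rfl
      simpa using h
  rw [Finset.sum_congr this fun _ _ => rfl, Finset.sum_singleton]
  simp [cycleProd]

/-- Factorization of a sum over permutations preserving a set `U`. -/
theorem permSum_eq_mul (f : Finset Ω → ℝ) {U S T : Finset Ω} (hS : S ⊆ U) (hT : T ⊆ Uᶜ)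
    (P P₁ P₂ : Perm Ω → Prop)
    (hP : ∀ σ ∈ supportedPerms S, ∀ τ ∈ supportedPerms T, P (σ * τ) ↔ P₁ σ ∧ P₂ τ) :
    permSum f (S ∪ T) (fun σ => (∀ x, σ x ∈ U ↔ x ∈ U) ∧ P σ) =
      permSum f S P₁ * permSum f T P₂ := by
  classical
  unfold permSum
  have hTU : ∀ x ∈ U, x ∉ T := fun x hx h => by simpa [hx] using hT h
  have hSU : ∀ x, x ∉ U → x ∉ S := fun x hx h => hx (hS h)
  rw [Finset.sum_mul_sum, ← Finset.sum_product']
  symm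
  refine Finset.sum_bij (fun στ _ => στ.1 * στ.2) ?_ ?_ ?_ ?_
  · rintro ⟨σ, τ⟩ h
    simp only [Finset.mem_product, Finset.mem_filter, mem_supportedPerms] at h ⊢
    obtain ⟨⟨hσ, h1⟩, hτ, h2⟩ := h
    refine ⟨fun x hx => ?_, ?_, ?_⟩
    · rw [Finset.mem_union, not_or] at hx
      rw [Perm.mul_apply, hτ x hx.2, hσ x hx.1]
    · refine preserves_mul (preserves_of_fixed_compl fun x hx => hσ x (hSU x hx)) ?_
      have := preserves_of_fixed_compl (U := Uᶜ) (σ := τ) fun x hx => hτ x fun h => hx (hT h)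
      simpa using preserves_compl this
    · exact (hP σ (mem_supportedPerms.2 hσ) τ (mem_supportedPerms.2 hτ)).2 ⟨h1, h2⟩
  · rintro ⟨σ, τ⟩ h ⟨σ', τ'⟩ h' heq
    simp only [Finset.mem_product, Finset.mem_filter, mem_supportedPerms] at h h' heq
    obtain ⟨⟨hσ, -⟩, hτ, -⟩ := h
    obtain ⟨⟨hσ', -⟩, hτ', -⟩ := h'
    have e : ∀ x, σ (τ x) = σ' (τ' x) := fun x => by
      rw [← Perm.mul_apply, heq, Perm.mul_apply]
    have e1 : σ = σ' := by
      ext x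
      by_cases hx : x ∈ U
      · have := e x
        rwa [hτ x (hTU x hx), hτ' x (hTU x hx)] at this
      · rw [hσ x (hSU x hx), hσ' x (hSU x hx)]
    subst e1
    simpa using heq
  · intro ρ hρ
    simp only [Finset.mem_filter, mem_supportedPerms] at hρ
    obtain ⟨hρ, hU, hPρ⟩ := hρ
    let σ : Perm Ω := ofSubtype (p := (· ∈ U)) (subtypePerm ρ fun x => (hU x))
    let τ : Perm Ω := ofSubtype (p := (· ∉ U)) (subtypePerm ρ fun x => not_congr (hU x))
    have σin : ∀ x ∈ U, σ x = ρ x := fun x hx => by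
      simp only [σ]; rw [ofSubtype_apply_of_mem _ hx]; rfl
    have σout : ∀ x, x ∉ U → σ x = x := fun x hx => by
      simp only [σ]; rw [ofSubtype_apply_of_not_mem _ hx]
    have τin : ∀ x, x ∉ U → τ x = ρ x := fun x hx => by
      simp only [τ]; rw [ofSubtype_apply_of_mem (p := (· ∉ U)) _ hx]; rfl
    have τout : ∀ x ∈ U, τ x = x := fun x hx => by
      simp only [τ]; rw [ofSubtype_apply_of_not_mem _ (by simpa using hx)]
    have hmul : σ * τ = ρ := by
      ext x
      rw [Perm.mul_apply]
      by_cases hx : x ∈ U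
      · rw [τout x hx, σin x hx]
      · rw [τin x hx, σout _ (by rwa [hU])]
    have hσ : σ ∈ supportedPerms S := mem_supportedPerms.2 fun x hx => by
      by_cases hxU : x ∈ U
      · rw [σin x hxU]
        exact hρ x (by simp [hx, hTU x hxU])
      · exact σout x hxU
    have hτ : τ ∈ supportedPerms T := mem_supportedPerms.2 fun x hx => by
      by_cases hxU : x ∈ U
      · exact τout x hxU
      · rw [τin x hxU]
        exact hρ x (by simp [hx, hSU x hxU])
    have := (hP σ hσ τ hτ).1 (by rwa [hmul])
    exact ⟨(σ, τ), by
      simp only [Finset.mem_product, Finset.mem_filter]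
      exact ⟨⟨hσ, this.1⟩, hτ, this.2⟩, hmul⟩
  · rintro ⟨σ, τ⟩ h
    simp only [Finset.mem_product, Finset.mem_filter, mem_supportedPerms] at h
    exact (cycleProd_mul f hS hT h.1.1 h.2.1).symm

/-- Summation over permutations according to the image of the root `a`. -/
theorem permSum_eq_sum_root (r : ℕ → ℝ) {a : Ω} (k : ℕ) {S : Finset Ω} (ha : a ∈ S)
    (P : Perm Ω → Prop) :
    permSum (rootWeight r a k) S P =
      r (k + 1) * permSum (fun B => r B.card) (S.erase a) P +
      ∑ b ∈ S.erase a,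
        permSum (rootWeight r b (k + 1)) (S.erase a) (fun σ => P (swap a b * σ)) := by
  classical
  unfold permSum
  have hmaps : ∀ σ ∈ (supportedPerms S).filter P, σ a ∈ S := by
    intro σ hσ
    have := mem_supportedPerms.1 (Finset.mem_filter.1 hσ).1
    exact (preserves_of_fixed_compl this a).2 ha
  rw [← Finset.sum_fiberwise_of_maps_to hmaps, ← Finset.add_sum_erase _ _ ha, Finset.mul_sum]
  congr 1
  · refine Finset.sum_congr ?_ fun σ hσ => ?_
    · ext σ
      simp only [Finset.mem_filter, mem_supportedPerms]
      constructor
      · rintro ⟨⟨h1, h2⟩, h3⟩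
        refine ⟨fun x hx => ?_, h2⟩
        by_cases hxa : x = a
        · rw [hxa, h3]
        · exact h1 x fun h => hx (Finset.mem_erase.2 ⟨hxa, h⟩)
      · rintro ⟨h1, h2⟩
        exact ⟨⟨fun x hx => h1 x fun h => hx (Finset.mem_of_mem_erase h), h2⟩,
          h1 a (Finset.notMem_erase a S)⟩
    · exact cycleProd_of_fixed r k ha (mem_supportedPerms.1 (Finset.mem_filter.1 hσ).1)
  · refine Finset.sum_congr rfl fun b hb => ?_
    have hbS := Finset.mem_of_mem_erase hb
    symm
    -- Left multiplication by `swap a b` is an involution that exchanges the permutations fixing `a`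
    -- with those sending `a` to `b`.
    refine Finset.sum_bij' (fun σ _ => swap a b * σ) (fun σ _ => swap a b * σ) ?_ ?_ ?_ ?_ ?_
    · intro σ hσ
      simp only [Finset.mem_filter, mem_supportedPerms] at hσ ⊢
      refine ⟨⟨fun x hx => ?_, hσ.2⟩, ?_⟩
      · rw [Perm.mul_apply, hσ.1 x fun h => hx (Finset.mem_of_mem_erase h),
          swap_apply_of_ne_of_ne]
        · rintro rfl; exact hx ha
        · rintro rfl; exact hx hbS
      · rw [Perm.mul_apply, hσ.1 a (Finset.notMem_erase a S), swap_apply_left]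
    · intro σ hσ
      simp only [Finset.mem_filter, mem_supportedPerms] at hσ ⊢
      refine ⟨fun x hx => ?_, by rw [swap_mul_self_mul]; exact hσ.1.2⟩
      by_cases hxa : x = a
      · rw [hxa, Perm.mul_apply, hσ.2, swap_apply_right]
      · have hxS : x ∉ S := fun h => hx (Finset.mem_erase.2 ⟨hxa, h⟩)
        rw [Perm.mul_apply, hσ.1.1 x hxS, swap_apply_of_ne_of_ne hxa]
        rintro rfl; exact hxS hbS
    · intro σ _; rw [swap_mul_self_mul]
    · intro σ _; rw [swap_mul_self_mul]
    · intro σ hσ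
      exact (cycleProd_swap_mul r k ha hb
        (mem_supportedPerms.1 (Finset.mem_filter.1 hσ).1)).symm

end Weights

/-! ### Recursions for the disc and the annulus -/

/-- The weighted number of non-crossing configurations on a disc with `n` points, where the block
of a root counts for `k` elements more. -/
noncomputable def rootedDisc (r : ℕ → ℝ) : ℕ → ℕ → ℝ
  -- Without points there is no root to absorb anything. The value zero for `k > 0` also removes the
  -- boundary terms when the recursions are written as Cauchy products.
  | 0, k => if k = 0 then 1 else 0
  | n + 1, k => r (k + 1) * rootedDisc r n 0 +
      ∑ i : Fin n, rootedDisc r i 0 * rootedDisc r (n - i) (k + 1)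
termination_by n => n
decreasing_by all_goals omega

theorem rootedDisc_succ (r : ℕ → ℝ) (n k : ℕ) :
    rootedDisc r (n + 1) k = r (k + 1) * rootedDisc r n 0 +
      ∑ i ∈ Finset.range n, rootedDisc r i 0 * rootedDisc r (n - i) (k + 1) := by
  rw [rootedDisc, Finset.sum_range]

/-- The weighted number of connected non-crossing configurations on an annulus with `t` points on
the circle of the root and `s` points on the other circle, where the block of the root counts for
`k` elements more. -/
noncomputable def rootedAnnulus (r : ℕ → ℝ) (s : ℕ) : ℕ → ℕ → ℝ
  | 0, _ => 0
  | t + 1, k => r (k + 1) * rootedAnnulus r s t 0 +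
      ∑ i : Fin t, (rootedAnnulus r s i 0 * rootedDisc r (t - i) (k + 1) +
        rootedDisc r i 0 * rootedAnnulus r s (t - i) (k + 1)) + s * rootedDisc r (t + s) (k + 1)
termination_by t => t
decreasing_by all_goals omega

theorem rootedAnnulus_succ (r : ℕ → ℝ) (s t k : ℕ) :
    rootedAnnulus r s (t + 1) k = r (k + 1) * rootedAnnulus r s t 0 +
      ∑ i ∈ Finset.range t, (rootedAnnulus r s i 0 * rootedDisc r (t - i) (k + 1) +
        rootedDisc r i 0 * rootedAnnulus r s (t - i) (k + 1)) +
      s * rootedDisc r (t + s) (k + 1) := by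
  rw [rootedAnnulus, Finset.sum_range]

/-- Each rank `0, …, |T| - 1` is attained once. This turns a sum over the image of the root into a
sum over the size of the arc cut off. -/
theorem sum_card_filter_lt {α : Type*} [DecidableEq α] (T : Finset α) (f : α → ℕ)
    (hf : Set.InjOn f T) (F : ℕ → ℝ) :
    ∑ b ∈ T, F (T.filter fun x => f x < f b).card = ∑ i ∈ Finset.range T.card, F i := by
  induction T using Finset.induction_on_max_value f with
  | empty => simp
  | insert a s ha hmax ih =>
    have hlt : ∀ x ∈ s, f x < f a := fun x hx => lt_of_le_of_ne (hmax x hx) fun h =>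
      ha ((hf (by simp [hx]) (by simp) h) ▸ hx)
    rw [Finset.sum_insert ha, Finset.card_insert_of_notMem ha, Finset.sum_range_succ, add_comm,
      ← ih (hf.mono (by simp))]
    congr 1
    · refine Finset.sum_congr rfl fun b hb => ?_
      rw [Finset.filter_insert, if_neg (by have := hlt b hb; omega)]
    · rw [Finset.filter_insert, if_neg (lt_irrefl _), Finset.filter_true_of_mem hlt]

/-! ### The sum over permutations of defect zero inside one cycle -/

section Recursion

variable {Ω : Type*} [Fintype Ω] [DecidableEq Ω]

/-- The least `i` such that `γ ^ i` maps `a` to `x`. -/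
noncomputable def cycleIndex (γ : Perm Ω) (a x : Ω) : ℕ := sInf {i : ℕ | (γ ^ i) a = x}

theorem pow_cycleIndex {γ : Perm Ω} {a x : Ω} (h : γ.SameCycle a x) :
    (γ ^ cycleIndex γ a x) a = x := by
  obtain ⟨i, -, -, hi⟩ := h.exists_pow_eq
  exact Nat.sInf_mem (s := {i : ℕ | (γ ^ i) a = x}) ⟨i, hi⟩

theorem cycleIndex_le {γ : Perm Ω} {a x : Ω} {i : ℕ} (h : (γ ^ i) a = x) :
    cycleIndex γ a x ≤ i :=
  Nat.sInf_le (s := {i : ℕ | (γ ^ i) a = x}) h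

theorem pow_apply_inj_of_le_cycleIndex {γ : Perm Ω} {a x : Ω} (h : γ.SameCycle a x) {i j : ℕ}
    (hij : i < j) (hj : j ≤ cycleIndex γ a x) : (γ ^ i) a ≠ (γ ^ j) a := by
  intro heq
  have h1 := pow_cycleIndex h
  have : (γ ^ (cycleIndex γ a x - j + i)) a = x := by
    rw [pow_add, Perm.mul_apply, heq, ← Perm.mul_apply, ← pow_add, Nat.sub_add_cancel hj, h1]
  have := cycleIndex_le this
  omega

/-- Composing with the transposition cuts the cycle `a, γ a, γ² a, …` just before `b`: the
predecessor of `b` is now sent back to `a`. -/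
theorem sameCycle_swap_mul_iff_lt {γ : Perm Ω} {a b x : Ω} (hab : a ≠ b) (hb : γ.SameCycle a b)
    (hx : γ.SameCycle a x) :
    (swap a b * γ).SameCycle a x ↔ cycleIndex γ a x < cycleIndex γ a b := by
  have hxi := pow_cycleIndex hx
  have hbi := pow_cycleIndex hb
  have hb0 : cycleIndex γ a b ≠ 0 := by
    intro h; rw [h] at hbi; exact hab hbi
  constructor
  · intro h
    by_contra hle
    push Not at hle
    -- From `b` up to `x` the iterates avoid `a` and do not return to `b`, so both permutations
    -- agree along the way. Then `x` lies in the new cycle of `b`, which is no longer that of `a`.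
    have key : ∀ j, cycleIndex γ a b + j ≤ cycleIndex γ a x →
        (swap a b * γ).SameCycle b ((γ ^ (cycleIndex γ a b + j)) a) := by
      intro j
      induction j with
      | zero => intro _; rw [add_zero, hbi]
      | succ j ih =>
        intro hj
        have h1 := pow_apply_inj_of_le_cycleIndex hx (i := 0) (by omega) hj
        rw [pow_zero, Perm.one_apply] at h1
        have h2 := pow_apply_inj_of_le_cycleIndex hx (i := cycleIndex γ a b) (by omega) hj
        rw [hbi] at h2
        rw [← add_assoc, pow_succ', Perm.mul_apply] at h1 h2 ⊢
        have e : γ ((γ ^ (cycleIndex γ a b + j)) a) =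
            (swap a b * γ) ((γ ^ (cycleIndex γ a b + j)) a) := by
          rw [Perm.mul_apply, swap_apply_of_ne_of_ne (Ne.symm h1) (Ne.symm h2)]
        rw [e, sameCycle_apply_right]
        exact ih (by omega)
    have h3 := key (cycleIndex γ a x - cycleIndex γ a b) (by omega)
    rw [Nat.add_sub_cancel' hle, hxi] at h3
    exact (not_sameCycle_iff_swap_mul hab).1 (h.trans h3.symm) hb
  · intro hlt
    have key : ∀ j, j < cycleIndex γ a b → (swap a b * γ).SameCycle a ((γ ^ j) a) := by
      intro j
      induction j with
      | zero => intro _; simpa using SameCycle.refl _ _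
      | succ j ih =>
        intro hj
        have h1 := pow_apply_inj_of_le_cycleIndex hb (i := 0) (by omega) hj.le
        rw [pow_zero, Perm.one_apply] at h1
        have h2 := pow_apply_inj_of_le_cycleIndex hb hj le_rfl
        rw [hbi] at h2
        rw [pow_succ', Perm.mul_apply] at h1 h2 ⊢
        have e : γ ((γ ^ j) a) = (swap a b * γ) ((γ ^ j) a) := by
          rw [Perm.mul_apply, swap_apply_of_ne_of_ne (Ne.symm h1) h2]
        rw [e, sameCycle_apply_right]
        exact ih (by omega)
    rw [← hxi]
    exact key _ hlt

open Classical in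
theorem sum_card_filter_sameCycle (γ : Perm Ω) (a : Ω) (T : Finset Ω) (haT : a ∉ T)
    (hT : ∀ x ∈ T, γ.SameCycle a x) (F : ℕ → ℝ) :
    ∑ b ∈ T, F (T ∩ cycleClass (swap a b * γ) a).card = ∑ i ∈ Finset.range T.card, F i := by
  rw [← sum_card_filter_lt T (cycleIndex γ a)]
  · refine Finset.sum_congr rfl fun b hb => ?_
    congr 2
    ext x
    simp only [Finset.mem_inter, mem_cycleClass, Finset.mem_filter]
    refine and_congr_right fun hx => ?_
    exact sameCycle_swap_mul_iff_lt (by rintro rfl; exact haT hb) (hT b hb) (hT x hx)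
  · intro x hx y hy h
    rw [← pow_cycleIndex (hT x hx), ← pow_cycleIndex (hT y hy), h]

theorem apply_mem_cycleClass_iff (γ : Perm Ω) (a x : Ω) :
    γ x ∈ cycleClass γ a ↔ x ∈ cycleClass γ a := by
  rw [mem_cycleClass, mem_cycleClass, sameCycle_apply_right]

theorem preserves_cycleClass {γ σ : Perm Ω} (h : ∀ x, γ.SameCycle x (σ x)) (a x : Ω) :
    σ x ∈ cycleClass γ a ↔ x ∈ cycleClass γ a := by
  rw [mem_cycleClass, mem_cycleClass]
  exact ⟨fun h' => h'.trans (h x).symm, fun h' => h'.trans (h x)⟩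

theorem defect_mul_of_supported {γ σ τ : Perm Ω} {U S T : Finset Ω} (hγ : ∀ x, γ x ∈ U ↔ x ∈ U)
    (hS : S ⊆ U) (hT : T ⊆ Uᶜ) (hσ : σ ∈ supportedPerms S) (hτ : τ ∈ supportedPerms T) :
    defect γ (σ * τ) = defect γ σ + defect γ τ :=
  defect_mul hγ (fun x hx => mem_supportedPerms.1 hσ x fun h => hx (hS h))
    fun x hx => mem_supportedPerms.1 hτ x fun h => by
      have := hT h
      rw [Finset.mem_compl] at this
      exact this hx

/-- The root is either fixed and closes a block of size `k + 1`, or it is sent to some `b`. In the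
second case the cycle of `γ` is cut into the arcs of `a` and of `b`, defect zero forces both to be
preserved, and the sum factors. Only `S` shrinks while `Ω` stays, so `S` need not be a full cycle of
`γ`. The unrooted sum is carried along because it occurs on the arc that misses `b`. -/
theorem sum_disc_aux (r : ℕ → ℝ) (n : ℕ) :
    ∀ (γ : Perm Ω) (S : Finset Ω), S.card = n → (∀ x ∈ S, ∀ y ∈ S, γ.SameCycle x y) →
      (permSum (fun B => r B.card) S (fun σ => defect γ σ = 0) = rootedDisc r n 0) ∧
      ∀ a ∈ S, ∀ k, permSum (rootWeight r a k) S (fun σ => defect γ σ = 0) = rootedDisc r n k := by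
  induction n using Nat.strong_induction_on with
  | _ n ih =>
    intro γ S hn hS
    have rooted : ∀ a ∈ S, ∀ k, permSum (rootWeight r a k) S (fun σ => defect γ σ = 0) = rootedDisc r n k := by
      intro a ha k
      obtain ⟨m, rfl⟩ : ∃ m, n = m + 1 :=
        Nat.exists_eq_succ_of_ne_zero (by rw [← hn]; exact Finset.card_ne_zero_of_mem ha)
      have hTcard : (S.erase a).card = m := by rw [Finset.card_erase_of_mem ha, hn]; rfl
      have haT := Finset.notMem_erase a S
      have hTS : ∀ x ∈ S.erase a, x ∈ S := fun x hx => Finset.mem_of_mem_erase hx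
      rw [permSum_eq_sum_root r k ha, rootedDisc_succ]
      rw [(ih m (by omega) γ (S.erase a) hTcard fun x hx y hy => hS x (hTS x hx) y (hTS y hy)).1]
      congr 1
      rw [← hTcard, ← sum_card_filter_sameCycle γ a (S.erase a) haT fun x hx => hS a ha x (hTS x hx)]
      refine Finset.sum_congr rfl fun b hb => ?_
      set T := S.erase a with hTdef
      have hba : a ≠ b := by rintro rfl; exact haT hb
      have hsab : γ.SameCycle a b := hS a ha b (hTS b hb)
      set γ' := swap a b * γ with hγ'
      set U := cycleClass γ' a with hU
      have hnab : ¬ γ'.SameCycle a b := fun h => (not_sameCycle_iff_swap_mul hba).1 h hsab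
      have hbU : b ∉ U := fun h => hnab (mem_cycleClass.1 h)
      have hUT : T ∩ U ∪ T \ U = T := by
        rw [Finset.union_comm]; exact Finset.sdiff_union_inter T U
      have h1 : T ∩ U ⊆ U := Finset.inter_subset_right
      have h2 : T \ U ⊆ Uᶜ := by
        intro x hx; simp only [Finset.mem_sdiff] at hx; simpa using hx.2
      have hfac := permSum_eq_mul (rootWeight r b (k + 1)) h1 h2
        (fun σ => defect γ' σ = 0) (fun σ => defect γ' σ = 0) (fun σ => defect γ' σ = 0)
        (fun σ hσ τ hτ => by
          rw [defect_mul_of_supported (apply_mem_cycleClass_iff γ' a) h1 h2 hσ hτ]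
          have := defect_nonneg γ' σ
          have := defect_nonneg γ' τ
          omega)
      rw [hUT] at hfac
      have hfil : permSum (rootWeight r b (k + 1)) T (fun σ => defect γ (swap a b * σ) = 0) =
          permSum (rootWeight r b (k + 1)) T
            (fun σ => (∀ x, σ x ∈ U ↔ x ∈ U) ∧ defect γ' σ = 0) := by
        refine permSum_congr (fun σ hσ => ?_) fun _ _ => rfl
        rw [defect_swap_mul_of_sameCycle hba (mem_supportedPerms.1 hσ a haT) hsab]
        exact ⟨fun h => ⟨preserves_cycleClass (sameCycle_apply_of_defect_eq_zero h) a, h⟩,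
          fun h => h.2⟩
      rw [hfil, hfac]
      have hsame1 : ∀ x ∈ T ∩ U, ∀ y ∈ T ∩ U, γ'.SameCycle x y := by
        intro x hx y hy
        exact (mem_cycleClass.1 (h1 hx)).symm.trans (mem_cycleClass.1 (h1 hy))
      have hsame2 : ∀ x ∈ T \ U, ∀ y ∈ T \ U, γ'.SameCycle x y := by
        have : ∀ x ∈ T \ U, γ'.SameCycle b x := by
          intro x hx
          rw [Finset.mem_sdiff] at hx
          have h3 := sameCycle_or_swap_mul (σ := γ) (a := a) (b := b)
            (Or.inl (hS a ha x (hTS x hx.1)))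
          exact h3.resolve_left fun h => hx.2 (mem_cycleClass.2 h)
        intro x hx y hy
        exact (this x hx).symm.trans (this y hy)
      have hbT : b ∈ T \ U := Finset.mem_sdiff.2 ⟨hb, hbU⟩
      have hc2 : (T \ U).card = T.card - (T ∩ U).card := by
        rw [Finset.card_sdiff, Finset.inter_comm]
      have hle : (T ∩ U).card ≤ T.card := Finset.card_le_card Finset.inter_subset_left
      congr 1
      · rw [← (ih (T ∩ U).card (by omega) γ' (T ∩ U) rfl hsame1).1]
        exact permSum_rootWeight_of_notMem r _ _ fun h => hbU (h1 h)
      · rw [← hc2, (ih (T \ U).card (by omega) γ' (T \ U) rfl hsame2).2 b hbT]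
    refine ⟨?_, rooted⟩
    rcases S.eq_empty_or_nonempty with rfl | ⟨a, ha⟩
    · rw [permSum_empty (defect_one γ), ← hn]
      simp [rootedDisc]
    · have := rooted a ha 0
      rwa [rootWeight_zero] at this

theorem sum_disc (r : ℕ → ℝ) (γ : Perm Ω) (S : Finset Ω)
    (hS : ∀ x ∈ S, ∀ y ∈ S, γ.SameCycle x y) :
    permSum (fun B => r B.card) S (fun σ => defect γ σ = 0) = rootedDisc r S.card 0 :=
  (sum_disc_aux r _ γ S rfl hS).1

theorem sum_rooted_disc (r : ℕ → ℝ) (γ : Perm Ω) (S : Finset Ω)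
    (hS : ∀ x ∈ S, ∀ y ∈ S, γ.SameCycle x y) {a : Ω} (ha : a ∈ S) (k : ℕ) :
    permSum (rootWeight r a k) S (fun σ => defect γ σ = 0) = rootedDisc r S.card k :=
  (sum_disc_aux r _ γ S rfl hS).2 a ha k

end Recursion

/-! ### The sum over permutations of defect two joining two cycles -/

section Annulus

variable {Ω : Type*} [Fintype Ω] [DecidableEq Ω]

/-- Permutations of defect two connecting two cycles of `γ`. -/
def IsAnnular (γ σ : Perm Ω) : Prop :=
  defect γ σ = 2 ∧ ∃ x, ¬ γ.SameCycle x (σ x)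

/-- The factor `σ` stays within one cycle of `γ`, so any crossing belongs to `τ` and costs the full
defect two, leaving none for `σ`. -/
theorem isAnnular_mul_iff {γ σ τ : Perm Ω} {c : Ω} {S T : Finset Ω} (hS : S ⊆ cycleClass γ c)
    (hT : T ⊆ (cycleClass γ c)ᶜ) (hσ : σ ∈ supportedPerms S) (hτ : τ ∈ supportedPerms T) :
    IsAnnular γ (σ * τ) ↔ defect γ σ = 0 ∧ IsAnnular γ τ := by
  have hadd := defect_mul_of_supported (apply_mem_cycleClass_iff γ c) hS hT hσ hτ
  have hσ1 : ∀ x, x ∉ cycleClass γ c → σ x = x := fun x hx =>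
    mem_supportedPerms.1 hσ x fun h => hx (hS h)
  have hτ1 : ∀ x, x ∉ (cycleClass γ c)ᶜ → τ x = x := fun x hx =>
    mem_supportedPerms.1 hτ x fun h => hx (hT h)
  have hσp := preserves_of_fixed_compl hσ1
  have hτp := preserves_of_fixed_compl hτ1
  unfold IsAnnular
  rw [hadd]
  have key : ∀ y, ¬ γ.SameCycle y ((σ * τ) y) ↔ ¬ γ.SameCycle y (τ y) := by
    intro y
    rw [Perm.mul_apply]
    by_cases hy : y ∈ cycleClass γ c
    · have h1 : τ y = y := hτ1 y (by simpa using hy)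
      rw [h1]
      have h2 := (hσp y).2 hy
      have : γ.SameCycle y (σ y) := (mem_cycleClass.1 hy).symm.trans (mem_cycleClass.1 h2)
      simp [this, SameCycle.refl]
    · have h2 := (hτp y).2 (by simpa using hy)
      rw [hσ1 (τ y) (by simpa using h2)]
  simp only [key]
  constructor
  · rintro ⟨h, y, hy⟩
    have h1 := two_le_defect_of_not_sameCycle hy
    have h2 := defect_nonneg γ σ
    exact ⟨by omega, by omega, y, hy⟩
  · rintro ⟨h1, h2, h3⟩
    exact ⟨by omega, h3⟩

/-- Three cases for the image `b` of the root. A fixed root closes its block. If `b` is on the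
root's circle, the circle is cut into two arcs, exactly one of which is joined to the other circle,
and the remaining arc carries a disc. If `b` is on the other circle, the two circles merge, the
defect drops to zero, and a disc on all remaining points is left; this happens for each of the
`|S₂|` choices. -/
theorem sum_annulus_aux (r : ℕ → ℝ) (n : ℕ) :
    ∀ (γ : Perm Ω) (S₁ S₂ : Finset Ω), S₁.card = n → (∀ x ∈ S₁, ∀ y ∈ S₁, γ.SameCycle x y) →
      (∀ x ∈ S₂, ∀ y ∈ S₂, γ.SameCycle x y) → (∀ x ∈ S₁, ∀ y ∈ S₂, ¬ γ.SameCycle x y) →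
      permSum (fun B => r B.card) (S₁ ∪ S₂) (IsAnnular γ) = rootedAnnulus r S₂.card n 0 ∧
      ∀ a ∈ S₁, ∀ k, permSum (rootWeight r a k) (S₁ ∪ S₂) (IsAnnular γ) =
        rootedAnnulus r S₂.card n k := by
  induction n using Nat.strong_induction_on with
  | _ n ih =>
    intro γ S₁ S₂ hn h11 h22 h12
    have rooted : ∀ a ∈ S₁, ∀ k, permSum (rootWeight r a k) (S₁ ∪ S₂) (IsAnnular γ) =
        rootedAnnulus r S₂.card n k := by
      intro a ha k
      obtain ⟨m, rfl⟩ : ∃ m, n = m + 1 :=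
        Nat.exists_eq_succ_of_ne_zero (by rw [← hn]; exact Finset.card_ne_zero_of_mem ha)
      have haS2 : a ∉ S₂ := fun h => h12 a ha a h (SameCycle.refl _ _)
      have hTcard : (S₁.erase a).card = m := by rw [Finset.card_erase_of_mem ha, hn]; rfl
      have haT := Finset.notMem_erase a S₁
      have hTS : ∀ x ∈ S₁.erase a, x ∈ S₁ := fun x hx => Finset.mem_of_mem_erase hx
      have hdis : Disjoint (S₁.erase a) S₂ := Finset.disjoint_left.2 fun x hx hx' =>
        h12 x (hTS x hx) x hx' (SameCycle.refl _ _)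
      rw [permSum_eq_sum_root r k (Finset.mem_union_left _ ha), rootedAnnulus_succ,
        Finset.erase_union_distrib, Finset.erase_eq_of_notMem haS2]
      rw [(ih m (by omega) γ (S₁.erase a) S₂ hTcard
        (fun x hx y hy => h11 x (hTS x hx) y (hTS y hy)) h22
        fun x hx y hy => h12 x (hTS x hx) y hy).1, Finset.sum_union hdis, add_assoc]
      congr 1
      set T := S₁.erase a with hTdef
      have haT2 : a ∉ T ∪ S₂ := by simp [haT, haS2]
      congr 1
      · rw [← hTcard, ← sum_card_filter_sameCycle γ a T haT (fun x hx => h11 a ha x (hTS x hx))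
          (F := fun i => rootedAnnulus r S₂.card i 0 * rootedDisc r (T.card - i) (k + 1) +
            rootedDisc r i 0 * rootedAnnulus r S₂.card (T.card - i) (k + 1))]
        refine Finset.sum_congr rfl fun b hb => ?_
        have hba : a ≠ b := by rintro rfl; exact haT hb
        have hsab : γ.SameCycle a b := h11 a ha b (hTS b hb)
        set γ' := swap a b * γ with hγ'
        set U := cycleClass γ' a with hU
        set V := cycleClass γ' b with hV
        have hnab : ¬ γ'.SameCycle a b := fun h => (not_sameCycle_iff_swap_mul hba).1 h hsab
        have hUV : ∀ x, x ∈ U → x ∉ V := fun x hx hx' =>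
          hnab ((mem_cycleClass.1 hx).trans (mem_cycleClass.1 hx').symm)
        have hbU : b ∉ U := fun h => hnab (mem_cycleClass.1 h)
        have hjoin : ∀ x, (x ∈ U ∨ x ∈ V) ↔ γ.SameCycle a x := by
          intro x
          rw [mem_cycleClass, mem_cycleClass, hγ', sameCycle_or_swap_mul_iff]
          exact ⟨fun h => h.elim id fun h' => hsab.trans h', Or.inl⟩
        have hS2n : ∀ x ∈ S₂, x ∉ U ∧ x ∉ V := by
          intro x hx
          rw [← not_or, hjoin]
          exact h12 a ha x hx
        have hT : ∀ x ∈ T, x ∈ U ∨ x ∈ V := fun x hx => (hjoin x).2 (h11 a ha x (hTS x hx))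
        have hUU : ∀ x ∈ U, ∀ y ∈ U, γ'.SameCycle x y := fun x hx y hy =>
          (mem_cycleClass.1 hx).symm.trans (mem_cycleClass.1 hy)
        have hVV : ∀ x ∈ V, ∀ y ∈ V, γ'.SameCycle x y := fun x hx y hy =>
          (mem_cycleClass.1 hx).symm.trans (mem_cycleClass.1 hy)
        have h22' : ∀ x ∈ S₂, ∀ y ∈ S₂, γ'.SameCycle x y := fun x hx y hy =>
          sameCycle_swap_mul_of_not (h22 x hx y hy) fun h => by
            refine h12 a ha x hx (h.elim id fun h' => hsab.trans h')
        have hUT : T ∩ U ∪ T \ U = T := by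
          rw [Finset.union_comm]; exact Finset.sdiff_union_inter T U
        have hu : T ∩ U ⊆ U := Finset.inter_subset_right
        have hv : T \ U ⊆ V := by
          intro x hx; rw [Finset.mem_sdiff] at hx
          exact (hT x hx.1).resolve_left hx.2
        have hus : T ∩ U ∪ S₂ ⊆ Vᶜ := by
          intro x hx
          rw [Finset.mem_compl]
          rcases Finset.mem_union.1 hx with h | h
          · exact hUV x (hu h)
          · exact (hS2n x h).2
        have hvs : T \ U ∪ S₂ ⊆ Uᶜ := by
          intro x hx
          rw [Finset.mem_compl]
          rcases Finset.mem_union.1 hx with h | h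
          · exact (Finset.mem_sdiff.1 h).2
          · exact (hS2n x h).1
        have hswap : ∀ z w, γ.SameCycle z (swap a b w) ↔ γ.SameCycle z w := by
          intro z w
          by_cases h1 : w = a
          · rw [h1, swap_apply_left]
            exact ⟨fun h => h.trans hsab.symm, fun h => h.trans hsab⟩
          by_cases h2 : w = b
          · rw [h2, swap_apply_right]
            exact ⟨fun h => h.trans hsab, fun h => h.trans hsab.symm⟩
          rw [swap_apply_of_ne_of_ne h1 h2]
        -- With defect two all crossings take place between a single pair of cycles of `γ'`. Here
        -- one of the two is the cycle containing `S₂` and the other is an arc, so the other arc is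
        -- preserved.
        have hiff : ∀ σ ∈ supportedPerms (T ∪ S₂), IsAnnular γ (swap a b * σ) ↔
            ((∀ x, σ x ∈ V ↔ x ∈ V) ∧ IsAnnular γ' σ) ∨
              ((∀ x, σ x ∈ U ↔ x ∈ U) ∧ IsAnnular γ' σ) := by
          intro σ hσ
          have hσ0 := mem_supportedPerms.1 hσ
          have hσp := preserves_of_fixed_compl hσ0
          unfold IsAnnular
          rw [defect_swap_mul_of_sameCycle hba (hσ0 a haT2) hsab]
          simp only [Perm.mul_apply, hswap]
          have hmem : ∀ y, ¬ σ y = y → y ∈ T ∪ S₂ := fun y hy => by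
            by_contra h; exact hy (hσ0 y h)
          constructor
          · rintro ⟨hd, y, hy⟩
            have hyσ : ¬ σ y = y := fun h => hy (by rw [h])
            have hyT := hmem y hyσ
            have hσyT := (hσp y).2 hyT
            have hy' : ¬ γ'.SameCycle y (σ y) := by
              intro h
              apply hy
              by_cases hya : γ.SameCycle a y
              · have h1 := (hjoin y).2 hya
                have h2 : σ y ∈ U ∨ σ y ∈ V := h1.imp
                  (fun h' => mem_cycleClass.2 ((mem_cycleClass.1 h').trans h))
                  (fun h' => mem_cycleClass.2 ((mem_cycleClass.1 h').trans h))
                exact hya.symm.trans ((hjoin _).1 h2)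
              · have h1 := sameCycle_swap_mul_of_not (a := a) (b := b) h (by
                  rw [sameCycle_or_swap_mul_iff]
                  exact fun h' => hya (h'.elim id fun h'' => hsab.trans h''))
                rwa [swap_mul_self_mul] at h1
            have hcross := sameCycle_apply_of_defect_eq_two hd hy'
            have hpres : ∀ W : Finset Ω, (∀ z ∈ W, ∀ w, γ'.SameCycle z w ↔ w ∈ W) → y ∉ W →
                σ y ∉ W → ∀ x, σ x ∈ W ↔ x ∈ W := by
              intro W hW hy1 hy2 x
              rcases hcross x with h | ⟨h, h'⟩
              · exact ⟨fun h' => (hW _ h' x).1 h.symm, fun h' => (hW _ h' _).1 h⟩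
              · refine ⟨fun h1 => ?_, fun h1 => ?_⟩
                · rcases h' with h' | h'
                  · exact absurd ((hW _ h1 y).1 h'.symm) hy1
                  · exact absurd ((hW _ h1 _).1 h'.symm) hy2
                · rcases h with h | h
                  · exact absurd ((hW _ h1 y).1 h.symm) hy1
                  · exact absurd ((hW _ h1 _).1 h.symm) hy2
            have hWU : ∀ z ∈ U, ∀ w, γ'.SameCycle z w ↔ w ∈ U := fun z hz w =>
              ⟨fun h => mem_cycleClass.2 ((mem_cycleClass.1 hz).trans h), fun h => hUU z hz w h⟩
            have hWV : ∀ z ∈ V, ∀ w, γ'.SameCycle z w ↔ w ∈ V := fun z hz w =>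
              ⟨fun h => mem_cycleClass.2 ((mem_cycleClass.1 hz).trans h), fun h => hVV z hz w h⟩
            rcases Finset.mem_union.1 hyT with h1 | h1
            · have h2 : σ y ∈ S₂ := (Finset.mem_union.1 hσyT).resolve_left fun h2 =>
                hy (h11 _ (hTS _ h1) _ (hTS _ h2))
              rcases hT y h1 with h3 | h3
              · exact Or.inl ⟨hpres V hWV (hUV y h3) (hS2n _ h2).2, hd, y, hy'⟩
              · exact Or.inr ⟨hpres U hWU (fun h => hUV y h h3) (hS2n _ h2).1, hd, y, hy'⟩
            · have h2 : σ y ∈ T := (Finset.mem_union.1 hσyT).resolve_right fun h2 =>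
                hy (h22 _ h1 _ h2)
              rcases hT _ h2 with h3 | h3
              · exact Or.inl ⟨hpres V hWV (hS2n _ h1).2 (hUV _ h3), hd, y, hy'⟩
              · exact Or.inr ⟨hpres U hWU (hS2n _ h1).1 (fun h => hUV _ h h3), hd, y, hy'⟩
          · intro h
            have hback : ∀ y, ¬ γ'.SameCycle y (σ y) →
                ((∀ x, σ x ∈ V ↔ x ∈ V) ∨ (∀ x, σ x ∈ U ↔ x ∈ U)) → ¬ γ.SameCycle y (σ y) := by
              intro y hy' hp
              have hyσ : ¬ σ y = y := fun h => hy' (by rw [h])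
              have hyT := hmem y hyσ
              have hσyT := (hσp y).2 hyT
              have hTT : y ∈ T → σ y ∈ T → False := by
                intro h1 h2
                rcases hp with hp | hp
                · have := hp y
                  rcases hT y h1 with h3 | h3
                  · have h4 : σ y ∉ V := fun h => hUV y h3 (this.1 h)
                    exact hy' (hUU _ h3 _ ((hT _ h2).resolve_right h4))
                  · exact hy' (hVV _ h3 _ (this.2 h3))
                · have := hp y
                  rcases hT y h1 with h3 | h3
                  · exact hy' (hUU _ h3 _ (this.2 h3))
                  · have h4 : σ y ∉ U := fun h => hUV y (this.1 h) h3
                    exact hy' (hVV _ h3 _ ((hT _ h2).resolve_left h4))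
              rcases Finset.mem_union.1 hyT with h1 | h1
              · rcases Finset.mem_union.1 hσyT with h2 | h2
                · exact (hTT h1 h2).elim
                · exact h12 _ (hTS _ h1) _ h2
              · rcases Finset.mem_union.1 hσyT with h2 | h2
                · exact fun h => h12 _ (hTS _ h2) _ h1 h.symm
                · exact (hy' (h22' _ h1 _ h2)).elim
            rcases h with ⟨hp, hd, y, hy⟩ | ⟨hp, hd, y, hy⟩
            · exact ⟨hd, y, hback y hy (Or.inl hp)⟩
            · exact ⟨hd, y, hback y hy (Or.inr hp)⟩
        -- If both arcs were preserved, `S₂` would have nothing to be joined to.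
        have hexcl : ∀ σ ∈ supportedPerms (T ∪ S₂),
            ((∀ x, σ x ∈ V ↔ x ∈ V) ∧ IsAnnular γ' σ) →
              ¬ ((∀ x, σ x ∈ U ↔ x ∈ U) ∧ IsAnnular γ' σ) := by
          rintro σ hσ ⟨hpV, hd, y, hy⟩ ⟨hpU, -⟩
          have hσ0 := mem_supportedPerms.1 hσ
          have hσp := preserves_of_fixed_compl hσ0
          have hyT : y ∈ T ∪ S₂ := by
            by_contra h; rw [hσ0 y h] at hy; exact hy (SameCycle.refl _ _)
          have hσyT := (hσp y).2 hyT
          by_cases h1 : y ∈ U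
          · exact hy (hUU _ h1 _ ((hpU y).2 h1))
          by_cases h2 : y ∈ V
          · exact hy (hVV _ h2 _ ((hpV y).2 h2))
          have h3 : y ∈ S₂ := (Finset.mem_union.1 hyT).resolve_left fun h =>
            (hT y h).elim h1 h2
          have h4 : σ y ∈ S₂ := (Finset.mem_union.1 hσyT).resolve_left fun h =>
            (hT _ h).elim (fun h' => h1 ((hpU y).1 h')) (fun h' => h2 ((hpV y).1 h'))
          exact hy (h22' _ h3 _ h4)
        rw [permSum_congr (g := rootWeight r b (k + 1)) hiff fun _ _ => rfl, permSum_or hexcl]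
        have hfac1 := permSum_eq_mul (rootWeight r b (k + 1)) hv hus (IsAnnular γ')
          (fun σ => defect γ' σ = 0) (IsAnnular γ')
          fun σ hσ τ hτ => isAnnular_mul_iff hv hus hσ hτ
        have hfac2 := permSum_eq_mul (rootWeight r b (k + 1)) hu hvs (IsAnnular γ')
          (fun σ => defect γ' σ = 0) (IsAnnular γ')
          fun σ hσ τ hτ => isAnnular_mul_iff hu hvs hσ hτ
        rw [← Finset.union_assoc, Finset.union_comm (T \ U), hUT] at hfac1
        rw [← Finset.union_assoc, hUT] at hfac2
        have hbT : b ∈ T \ U := Finset.mem_sdiff.2 ⟨hb, hbU⟩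
        have hc2 : (T \ U).card = T.card - (T ∩ U).card := by
          rw [Finset.card_sdiff, Finset.inter_comm]
        have hle : (T ∩ U).card ≤ T.card := Finset.card_le_card Finset.inter_subset_left
        have hbu : b ∉ T ∩ U ∪ S₂ := fun h => by
          have := hus h
          rw [Finset.mem_compl] at this
          exact this (mem_cycleClass.2 (SameCycle.refl _ _))
        have hsU : ∀ x ∈ T ∩ U, ∀ y ∈ T ∩ U, γ'.SameCycle x y := fun x hx y hy =>
          hUU x (hu hx) y (hu hy)
        have hsV : ∀ x ∈ T \ U, ∀ y ∈ T \ U, γ'.SameCycle x y := fun x hx y hy =>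
          hVV x (hv hx) y (hv hy)
        rw [hfac1, hfac2, sum_rooted_disc r γ' _ hsV hbT,
          permSum_rootWeight_of_notMem r _ _ hbu,
          permSum_rootWeight_of_notMem r _ _ (fun h => hbu (Finset.mem_union_left _ h)),
          sum_disc r γ' _ hsU, ← hc2,
          (ih (T ∩ U).card (by omega) γ' (T ∩ U) S₂ rfl hsU h22' fun x hx y hy h =>
            (hS2n y hy).1 (mem_cycleClass.2 ((mem_cycleClass.1 (hu hx)).trans h))).1,
          (ih (T \ U).card (by omega) γ' (T \ U) S₂ rfl hsV h22' fun x hx y hy h =>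
            (hS2n y hy).2 (mem_cycleClass.2 ((mem_cycleClass.1 (hv hx)).trans h))).2 b hbT]
        ring
      · rw [← nsmul_eq_mul]
        refine Finset.sum_eq_card_nsmul fun b hb => ?_
        have hnab : ¬ γ.SameCycle a b := h12 a ha b hb
        have hba : a ≠ b := by rintro rfl; exact haS2 hb
        set γ' := swap a b * γ with hγ'
        have hab' : γ'.SameCycle a b := (not_sameCycle_iff_swap_mul hba).2 hnab
        have hall : ∀ x ∈ T ∪ S₂, γ'.SameCycle a x := by
          intro x hx
          have : γ.SameCycle a x ∨ γ.SameCycle b x := by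
            rcases Finset.mem_union.1 hx with h | h
            · exact Or.inl (h11 a ha x (hTS x h))
            · exact Or.inr (h22 b hb x h)
          exact (sameCycle_or_swap_mul this).elim id fun h => hab'.trans h
        rw [← hTcard, ← Finset.card_union_of_disjoint hdis,
          ← sum_rooted_disc r γ' (T ∪ S₂) (fun x hx y hy => (hall x hx).symm.trans (hall y hy))
            (Finset.mem_union_right _ hb) (k + 1)]
        refine permSum_congr (fun σ hσ => ?_) fun _ _ => rfl
        have hσa := mem_supportedPerms.1 hσ a haT2
        unfold IsAnnular
        rw [defect_swap_mul_of_not_sameCycle hσa hnab, ← hγ']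
        constructor
        · rintro ⟨h, -⟩
          omega
        · intro h
          refine ⟨by omega, a, ?_⟩
          rwa [Perm.mul_apply, hσa, swap_apply_left]
    refine ⟨?_, rooted⟩
    rcases S₁.eq_empty_or_nonempty with rfl | ⟨a, ha⟩
    · rw [Finset.card_empty] at hn
      rw [← hn, rootedAnnulus, Finset.empty_union]
      refine permSum_eq_zero ?_
      rintro σ hσ ⟨-, y, hy⟩
      have hσ0 := mem_supportedPerms.1 hσ
      have hyS : y ∈ S₂ := by
        by_contra h; rw [hσ0 y h] at hy; exact hy (SameCycle.refl _ _)
      exact hy (h22 _ hyS _ ((preserves_of_fixed_compl hσ0 y).2 hyS))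
    · have := rooted a ha 0
      rwa [rootWeight_zero] at this

theorem sum_annulus (r : ℕ → ℝ) (γ : Perm Ω) (S₁ S₂ : Finset Ω)
    (h11 : ∀ x ∈ S₁, ∀ y ∈ S₁, γ.SameCycle x y) (h22 : ∀ x ∈ S₂, ∀ y ∈ S₂, γ.SameCycle x y)
    (h12 : ∀ x ∈ S₁, ∀ y ∈ S₂, ¬ γ.SameCycle x y) :
    permSum (fun B => r B.card) (S₁ ∪ S₂) (IsAnnular γ) = rootedAnnulus r S₂.card S₁.card 0 :=
  (sum_annulus_aux r _ γ S₁ S₂ rfl h11 h22 h12).1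

end Annulus

/-! ### Annular non-crossing permutations and the numbers `h_n` -/

section AnnularNC

theorem annularGamma_inl (t s : ℕ) (x : Fin t) :
    annularGamma t s (Sum.inl x) = Sum.inl (finRotate t x) := rfl

theorem annularGamma_inr (t s : ℕ) (x : Fin s) :
    annularGamma t s (Sum.inr x) = Sum.inr (finRotate s x) := rfl

theorem sameCycle_of_finRotate_conj {α : Type*} (n : ℕ) (f : Fin n → α) (γ : Perm α)
    (hf : ∀ x, γ (f x) = f (finRotate n x)) (x y : Fin n) : γ.SameCycle (f x) (f y) := by
  rcases n with _ | n
  · exact x.elim0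
  have h0 : ∀ z : Fin (n + 1), γ.SameCycle (f 0) (f z) := by
    intro z
    induction z using Fin.induction with
    | zero => exact SameCycle.refl _ _
    | succ i ih =>
      have : f i.succ = γ (f i.castSucc) := by
        rw [hf, finRotate_apply, Fin.coeSucc_eq_succ]
      rw [this, sameCycle_apply_right]
      exact ih
  exact (h0 x).symm.trans (h0 y)

theorem sameCycle_annularGamma_inl (t s : ℕ) (x y : Fin t) :
    (annularGamma t s).SameCycle (Sum.inl x) (Sum.inl y) :=
  sameCycle_of_finRotate_conj t Sum.inl _ (annularGamma_inl t s) x y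

theorem sameCycle_annularGamma_inr (t s : ℕ) (x y : Fin s) :
    (annularGamma t s).SameCycle (Sum.inr x) (Sum.inr y) :=
  sameCycle_of_finRotate_conj s Sum.inr _ (annularGamma_inr t s) x y

theorem not_sameCycle_annularGamma (t s : ℕ) (x : Fin t) (y : Fin s) :
    ¬ (annularGamma t s).SameCycle (Sum.inl x) (Sum.inr y) := by
  intro h
  have hU : ∀ z, annularGamma t s z ∈ (Finset.univ.image Sum.inl : Finset (Fin t ⊕ Fin s)) ↔
      z ∈ (Finset.univ.image Sum.inl : Finset (Fin t ⊕ Fin s)) := by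
    rintro (z | z)
    · simp [annularGamma_inl]
    · simp [annularGamma_inr]
  have := (apply_mem_iff_of_sameCycle hU h).1 (by simp)
  simp at this

theorem sameCycle_annularGamma_iff (t s : ℕ) (x y : Fin t ⊕ Fin s) :
    (annularGamma t s).SameCycle x y ↔ x.isLeft = y.isLeft := by
  rcases x with x | x <;> rcases y with y | y
  · simp [sameCycle_annularGamma_inl]
  · simp [not_sameCycle_annularGamma]
  · simp [not_sameCycle_annularGamma, sameCycle_comm (x := Sum.inr x)]
  · simp [sameCycle_annularGamma_inr]

theorem cycleCount_annularGamma {t s : ℕ} (ht : 1 ≤ t) (hs : 1 ≤ s) :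
    cycleCount (annularGamma t s) = 2 := by
  have : (Finset.univ.image (cycleClass (annularGamma t s))) =
      {cycleClass (annularGamma t s) (Sum.inl ⟨0, ht⟩),
        cycleClass (annularGamma t s) (Sum.inr ⟨0, hs⟩)} := by
    ext B
    simp only [Finset.mem_image, Finset.mem_univ, true_and, Finset.mem_insert,
      Finset.mem_singleton]
    constructor
    · rintro ⟨x | x, rfl⟩
      · exact Or.inl (cycleClass_eq_iff.2 (sameCycle_annularGamma_inl t s _ _))
      · exact Or.inr (cycleClass_eq_iff.2 (sameCycle_annularGamma_inr t s _ _))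
    · rintro (rfl | rfl)
      · exact ⟨_, rfl⟩
      · exact ⟨_, rfl⟩
  rw [cycleCount, cycleCountOn, this, Finset.card_pair]
  exact fun h => not_sameCycle_annularGamma t s _ _ (cycleClass_eq_iff.1 h)

/-- As `γ` has two cycles, the condition on the cycle counts is defect two. As `γ` is transitive on
each circle, the generated group is transitive exactly when `σ` moves some point from one circle to
the other. -/
theorem isAnnularNC_iff {t s : ℕ} (ht : 1 ≤ t) (hs : 1 ≤ s) (σ : Perm (Fin t ⊕ Fin s)) :
    IsAnnularNC t s σ ↔ IsAnnular (annularGamma t s) σ := by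
  have hcount : ∀ τ : Perm (Fin t ⊕ Fin s), numCycles τ = cycleCount τ := fun τ =>
    (cycleCount_eq_card_parts τ).symm
  unfold IsAnnularNC IsAnnular defect
  rw [hcount, hcount, cycleCount_annularGamma ht hs, Fintype.card_sum, Fintype.card_fin,
    Fintype.card_fin]
  rw [and_comm]
  refine and_congr ⟨fun h => by push_cast; omega, fun h => by push_cast at h; omega⟩ ?_
  constructor
  · intro htrans
    by_contra hcon
    push Not at hcon
    have hinv : ∀ g ∈ Subgroup.closure {σ, annularGamma t s}, ∀ x : Fin t ⊕ Fin s,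
        (g x).isLeft = x.isLeft := by
      intro g hg
      induction hg using Subgroup.closure_induction with
      | mem g hg =>
        intro x
        rcases hg with rfl | rfl
        · exact ((sameCycle_annularGamma_iff t s _ _).1 (hcon x)).symm
        · rw [eq_comm, ← sameCycle_annularGamma_iff, sameCycle_apply_right]
      | one => intro x; rfl
      | mul g h _ _ ihg ihh => intro x; rw [Perm.mul_apply, ihg, ihh]
      | inv g _ ih =>
        intro x
        rw [← ih (g⁻¹ x), ← Perm.mul_apply, mul_inv_cancel, Perm.one_apply]
    obtain ⟨g, hg⟩ := htrans.exists_smul_eq (Sum.inl ⟨0, ht⟩) (Sum.inr ⟨0, hs⟩)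
    have h1 := hinv g.1 g.2 (Sum.inl ⟨0, ht⟩)
    have h2 : g.1 (Sum.inl ⟨0, ht⟩) = Sum.inr ⟨0, hs⟩ := hg
    rw [h2] at h1
    simp at h1
  · rintro ⟨x, hx⟩
    set G := Subgroup.closure {σ, annularGamma t s} with hG
    have hσ : σ ∈ G := Subgroup.subset_closure (by simp)
    have hγ : annularGamma t s ∈ G := Subgroup.subset_closure (by simp)
    have hsame : ∀ y z, (annularGamma t s).SameCycle y z → ∃ g ∈ G, g y = z := by
      rintro y z ⟨i, hi⟩
      exact ⟨_, G.zpow_mem hγ i, hi⟩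
    have hreach : ∀ y, ∃ g ∈ G, g x = y := by
      intro y
      by_cases hy : (annularGamma t s).SameCycle x y
      · exact hsame x y hy
      · have : (annularGamma t s).SameCycle (σ x) y := by
          rw [sameCycle_annularGamma_iff] at hx hy ⊢
          revert hx hy
          cases x.isLeft <;> cases (σ x).isLeft <;> cases y.isLeft <;> simp
        obtain ⟨g, hg, hgy⟩ := hsame _ _ this
        exact ⟨g * σ, G.mul_mem hg hσ, hgy⟩
    refine ⟨fun y z => ?_⟩
    obtain ⟨g, hg, hgy⟩ := hreach y
    obtain ⟨h, hh, hhz⟩ := hreach z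
    refine ⟨⟨h * g⁻¹, G.mul_mem hh (G.inv_mem hg)⟩, ?_⟩
    change (h * g⁻¹) y = z
    rw [Perm.mul_apply, ← hgy, ← Perm.mul_apply g⁻¹, inv_mul_cancel, Perm.one_apply, hhz]

theorem cycleProd_univ {Ω : Type*} [Fintype Ω] [DecidableEq Ω] (r : ℕ → ℝ) (σ : Perm Ω) :
    cycleProd (fun B => r B.card) σ Finset.univ = (σ.partition.parts.map r).prod := by
  rw [← image_cycleClass_val_map_card, Multiset.map_map]
  rfl

theorem permSum_annularGamma (r : ℕ → ℝ) {t s : ℕ} (ht : 1 ≤ t) (hs : 1 ≤ s) :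
    permSum (fun B => r B.card) Finset.univ (IsAnnular (annularGamma t s)) =
      ∑ σ ∈ annularNC t s, (σ.partition.parts.map r).prod := by
  unfold permSum annularNC
  refine Finset.sum_congr ?_ fun σ _ => cycleProd_univ r σ
  ext σ
  simp [mem_supportedPerms, isAnnularNC_iff ht hs]

theorem sum_annularNC (r : ℕ → ℝ) {t s : ℕ} (ht : 1 ≤ t) (hs : 1 ≤ s) :
    ∑ σ ∈ annularNC t s, (σ.partition.parts.map r).prod = rootedAnnulus r s t 0 ∧
    ∑ σ ∈ annularNC t s, (σ.partition.parts.map r).prod = rootedAnnulus r t s 0 := by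
  rw [← permSum_annularGamma r ht hs]
  have hu : (Finset.univ.image Sum.inl ∪ Finset.univ.image Sum.inr : Finset (Fin t ⊕ Fin s)) =
      Finset.univ := by
    ext x; rcases x with x | x <;> simp
  have hl : (Finset.univ.image Sum.inl : Finset (Fin t ⊕ Fin s)).card = t := by
    rw [Finset.card_image_of_injective _ Sum.inl_injective]; simp
  have hr : (Finset.univ.image Sum.inr : Finset (Fin t ⊕ Fin s)).card = s := by
    rw [Finset.card_image_of_injective _ Sum.inr_injective]; simp
  have hll : ∀ x ∈ (Finset.univ.image Sum.inl : Finset (Fin t ⊕ Fin s)),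
      ∀ y ∈ (Finset.univ.image Sum.inl : Finset (Fin t ⊕ Fin s)),
      (annularGamma t s).SameCycle x y := by
    simp [sameCycle_annularGamma_inl]
  have hrr : ∀ x ∈ (Finset.univ.image Sum.inr : Finset (Fin t ⊕ Fin s)),
      ∀ y ∈ (Finset.univ.image Sum.inr : Finset (Fin t ⊕ Fin s)),
      (annularGamma t s).SameCycle x y := by
    simp [sameCycle_annularGamma_inr]
  have hlr : ∀ x ∈ (Finset.univ.image Sum.inl : Finset (Fin t ⊕ Fin s)),
      ∀ y ∈ (Finset.univ.image Sum.inr : Finset (Fin t ⊕ Fin s)),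
      ¬ (annularGamma t s).SameCycle x y := by
    simp [not_sameCycle_annularGamma]
  constructor
  · have := sum_annulus r (annularGamma t s) _ _ hll hrr hlr
    rwa [hu, hl, hr] at this
  · have := sum_annulus r (annularGamma t s) _ _ hrr hll
      fun x hx y hy h => hlr y hy x hx h.symm
    rwa [Finset.union_comm, hu, hl, hr] at this

/-- For `n = t + s` the weight `n / (2 t s)` is `½ (1/t + 1/s)`. Since either circle may carry the
root (`sum_annularNC`), both halves have the same sum, and only the weight `1/s` of the rootless
circle remains. It is the weight that cancels the factor `s` in `rootedAnnulus_succ`. -/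
theorem hCoeff_eq (μ : Measure ℝ) (n : ℕ) :
    hCoeff μ n = ∑ s ∈ Finset.range n,
      rootedAnnulus (freeCumulant μ) (s + 1) (n - 1 - s) 0 / ((s : ℝ) + 1) := by
  set r := freeCumulant μ with hr
  set D := (Finset.HasAntidiagonal.antidiagonal n).filter
    (fun ts : ℕ × ℕ => 1 ≤ ts.1 ∧ 1 ≤ ts.2) with hD
  have hiff : ∀ ts, ts ∈ D ↔ ts.1 + ts.2 = n ∧ 1 ≤ ts.1 ∧ 1 ≤ ts.2 := by
    intro ts
    simp [hD]
  have hmem := fun ts => (hiff ts).1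
  have hsym : ∑ ts ∈ D, rootedAnnulus r ts.2 ts.1 0 / (ts.1 : ℝ) =
      ∑ ts ∈ D, rootedAnnulus r ts.2 ts.1 0 / (ts.2 : ℝ) := by
    refine Finset.sum_bij' (fun ts _ => ts.swap) (fun ts _ => ts.swap) ?_ ?_ ?_ ?_ ?_
    · intro ts hts
      have := hmem ts hts
      simp only [hiff, Prod.fst_swap, Prod.snd_swap]
      omega
    · intro ts hts
      have := hmem ts hts
      simp only [hiff, Prod.fst_swap, Prod.snd_swap]
      omega
    · intro ts _; simp
    · intro ts _; simp
    · intro ts hts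
      have := hmem ts hts
      have h := sum_annularNC r this.2.1 this.2.2
      simp only [Prod.fst_swap, Prod.snd_swap]
      rw [← h.1, h.2]
  have h1 : hCoeff μ n = ∑ ts ∈ D, rootedAnnulus r ts.2 ts.1 0 / (ts.2 : ℝ) := by
    unfold hCoeff
    have : ∀ ts ∈ D, (n : ℝ) / 2 * ∑ σ ∈ annularNC ts.1 ts.2,
        (σ.partition.parts.map (freeCumulant μ)).prod / ((ts.1 : ℝ) * (ts.2 : ℝ)) =
        (1 / 2) * (rootedAnnulus r ts.2 ts.1 0 / (ts.1 : ℝ)) +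
          (1 / 2) * (rootedAnnulus r ts.2 ts.1 0 / (ts.2 : ℝ)) := by
      intro ts hts
      obtain ⟨h, h1, h2⟩ := hmem ts hts
      rw [← Finset.sum_div, (sum_annularNC r h1 h2).1, ← h]
      have : (ts.1 : ℝ) ≠ 0 := by positivity
      have : (ts.2 : ℝ) ≠ 0 := by positivity
      push_cast
      field_simp
      ring
    rw [Finset.mul_sum, Finset.sum_congr rfl this, Finset.sum_add_distrib, ← Finset.mul_sum,
      ← Finset.mul_sum, hsym]
    ring
  rw [h1]
  rcases n with _ | n
  · exact Finset.sum_eq_zero fun ts hts => by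
      have := hmem ts hts; omega
  -- The last index leaves no point on the root's circle and contributes zero.
  rw [Finset.sum_range_succ]
  have : n + 1 - 1 - n = 0 := by omega
  rw [this, rootedAnnulus, zero_div, add_zero]
  refine Finset.sum_bij' (fun ts _ => ts.2 - 1) (fun s _ => (n - s, s + 1)) ?_ ?_ ?_ ?_ ?_
  · intro ts hts
    have := hmem ts hts
    rw [Finset.mem_range]; omega
  · intro s hs
    rw [Finset.mem_range] at hs
    simp only [hiff]
    omega
  · intro ts hts
    have := hmem ts hts
    ext
    · simp; omega
    · simp; omega
  · intro s _; simp
  · intro ts hts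
    obtain ⟨h, h1, h2⟩ := hmem ts hts
    have e1 : ts.2 - 1 + 1 = ts.2 := by omega
    have e2 : n + 1 - 1 - (ts.2 - 1) = ts.1 := by omega
    have e3 : ((ts.2 - 1 : ℕ) : ℝ) + 1 = ts.2 := by exact_mod_cast e1
    rw [e1, e2, e3]

end AnnularNC

end FiniteFree

namespace FiniteFree

/-! ### Generating series of the recursions -/

section SeriesAlgebra

open PowerSeries

theorem coeff_pow_eq_zero_of_lt {y : PowerSeries ℝ} (hy : PowerSeries.constantCoeff y = 0) {k n : ℕ}
    (h : k < n) (Z : PowerSeries ℝ) : PowerSeries.coeff k (y ^ n * Z) = 0 := by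
  have : (PowerSeries.X : PowerSeries ℝ) ^ n ∣ y ^ n * Z :=
    Dvd.dvd.mul_right (pow_dvd_pow_of_dvd (PowerSeries.X_dvd_iff.2 hy) n) Z
  exact PowerSeries.X_pow_dvd_iff.1 this k h

theorem coeff_subst_eq_sum {y : PowerSeries ℝ} (hy : PowerSeries.constantCoeff y = 0) (F : PowerSeries ℝ)
    {k N : ℕ} (h : k < N) :
    PowerSeries.coeff k (PowerSeries.subst y F) = ∑ n ∈ Finset.range N, PowerSeries.coeff n F * PowerSeries.coeff k (y ^ n) := by
  rw [coeff_subst' (HasSubst.of_constantCoeff_zero' hy)]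
  rw [finsum_eq_sum_of_support_subset (s := Finset.range N)]
  · simp only [smul_eq_mul]
  · intro n hn
    simp only [Finset.coe_range, Set.mem_Iio]
    by_contra hcon
    apply hn
    have := coeff_pow_eq_zero_of_lt hy (k := k) (n := n) (by omega) 1
    rw [mul_one] at this
    simp [this]

theorem coeff_subst_mul_eq_sum {y : PowerSeries ℝ} (hy : PowerSeries.constantCoeff y = 0)
    (F Z : PowerSeries ℝ) {k N : ℕ} (h : k < N) :
    PowerSeries.coeff k (PowerSeries.subst y F * Z) =
      ∑ n ∈ Finset.range N, PowerSeries.coeff n F * PowerSeries.coeff k (y ^ n * Z) := by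
  rw [PowerSeries.coeff_mul]
  have : ∀ ij ∈ Finset.HasAntidiagonal.antidiagonal k, PowerSeries.coeff ij.1 (PowerSeries.subst y F) * PowerSeries.coeff ij.2 Z =
      ∑ n ∈ Finset.range N, PowerSeries.coeff n F * (PowerSeries.coeff ij.1 (y ^ n) * PowerSeries.coeff ij.2 Z) := by
    intro ij hij
    rw [coeff_subst_eq_sum hy F (N := N) (by
      have := Finset.HasAntidiagonal.mem_antidiagonal.1 hij; omega), Finset.sum_mul]
    exact Finset.sum_congr rfl fun _ _ => by ring
  rw [Finset.sum_congr rfl this, Finset.sum_comm]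
  refine Finset.sum_congr rfl fun n _ => ?_
  rw [PowerSeries.coeff_mul, Finset.mul_sum]

/-- Iteration gives `D k = yⁿ D (k + n)`, divisible by every power of `X`. This provides uniqueness
for recursions in which the number `k` of absorbed elements grows without bound. -/
theorem eq_zero_of_forall_eq_mul {y : PowerSeries ℝ} (hy : PowerSeries.constantCoeff y = 0)
    (D : ℕ → PowerSeries ℝ) (h : ∀ k, D k = y * D (k + 1)) (k : ℕ) : D k = 0 := by
  have hD : ∀ n k, D k = y ^ n * D (k + n) := by
    intro n
    induction n with
    | zero => intro k; simp
    | succ n ih => intro k; rw [h k, ih (k + 1), pow_succ']; ring_nf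
  ext n
  rw [hD (n + 1) k, coeff_pow_eq_zero_of_lt hy (Nat.lt_succ_self n), map_zero]

/-- The series `∑_{j ≥ 1} r_{j + k} z ^ j`. -/
noncomputable def cumulantSeries (r : ℕ → ℝ) (k : ℕ) : PowerSeries ℝ :=
  PowerSeries.mk fun j => if j = 0 then 0 else r (j + k)

theorem cumulantSeries_eq (r : ℕ → ℝ) (k : ℕ) :
    cumulantSeries r k = PowerSeries.X * (PowerSeries.C (r (k + 1)) + cumulantSeries r (k + 1)) := by
  ext n
  rcases n with _ | n
  · simp [cumulantSeries]
  · rw [PowerSeries.coeff_succ_X_mul]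
    simp only [cumulantSeries, PowerSeries.coeff_mk, map_add, PowerSeries.coeff_C]
    rcases n with _ | n
    · simp [add_comm]
    · simp; congr 1; ring

/-- The generating series of the numbers `rootedDisc r n k`. -/
noncomputable def discSeries (r : ℕ → ℝ) (k : ℕ) : PowerSeries ℝ :=
  PowerSeries.mk fun n => rootedDisc r n k

/-- The series `X M`, where `M` is the moment series. -/
noncomputable def discCauchy (r : ℕ → ℝ) : PowerSeries ℝ := PowerSeries.X * discSeries r 0

theorem constantCoeff_discCauchy (r : ℕ → ℝ) : PowerSeries.constantCoeff (discCauchy r) = 0 := by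
  simp [discCauchy]

theorem hasSubst_discCauchy (r : ℕ → ℝ) : HasSubst (discCauchy r) :=
  HasSubst.of_constantCoeff_zero' (constantCoeff_discCauchy r)

theorem discSeries_eq (r : ℕ → ℝ) (k : ℕ) :
    discSeries r k = (if k = 0 then 1 else 0) +
      discCauchy r * (PowerSeries.C (r (k + 1)) + discSeries r (k + 1)) := by
  ext n
  rw [discCauchy, mul_assoc]
  rcases n with _ | n
  · simp only [discSeries, PowerSeries.coeff_mk, rootedDisc, map_add, PowerSeries.coeff_zero_X_mul, add_zero]
    split_ifs <;> simp
  · have h0 : PowerSeries.coeff (n + 1) (if k = 0 then (1 : PowerSeries ℝ) else 0) = 0 := by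
      split_ifs <;> simp [PowerSeries.coeff_one]
    rw [map_add, h0, zero_add, PowerSeries.coeff_succ_X_mul, mul_add, map_add, PowerSeries.coeff_mul_C, PowerSeries.coeff_mul,
      discSeries, PowerSeries.coeff_mk, rootedDisc_succ, Finset.Nat.sum_antidiagonal_eq_sum_range_succ_mk,
      Finset.sum_range_succ]
    simp only [discSeries, PowerSeries.coeff_mk, Nat.sub_self]
    have : rootedDisc r 0 (k + 1) = 0 := by simp [rootedDisc]
    rw [this]
    ring

theorem subst_cumulantSeries {y : PowerSeries ℝ} (hy : HasSubst y) (r : ℕ → ℝ) (k : ℕ) :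
    (cumulantSeries r k).subst y =
      y * (PowerSeries.C (r (k + 1)) + (cumulantSeries r (k + 1)).subst y) := by
  conv_lhs => rw [cumulantSeries_eq]
  rw [subst_mul hy, subst_add hy, subst_X hy, subst_C]
  rfl

/-- Tails of the cumulant series, evaluated at `y = discCauchy r`, satisfy the recursion `D_k = y
(r_{k+1} + D_{k+1})` of the disc series. The case `k = 0` is the functional equation `M = 1 + S(X
M)`. -/
theorem discSeries_eq_subst (r : ℕ → ℝ) (k : ℕ) :
    discSeries r k = (if k = 0 then 1 else 0) + (cumulantSeries r k).subst (discCauchy r) := by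
  have := eq_zero_of_forall_eq_mul (constantCoeff_discCauchy r)
    (fun k => discSeries r k - (if k = 0 then (1 : PowerSeries ℝ) else 0) -
      (cumulantSeries r k).subst (discCauchy r)) (fun k => by
        rw [discSeries_eq r k, subst_cumulantSeries (hasSubst_discCauchy r)]
        simp only [Nat.succ_ne_zero, if_false]
        ring) k
  rw [sub_sub, sub_eq_zero] at this
  exact this

/-- The generating series of the annular numbers, weighted by the inverse of the size of the
circle without root. -/
noncomputable def annulusSeries (r : ℕ → ℝ) (k : ℕ) : PowerSeries ℝ :=
  PowerSeries.mk fun n => ∑ s ∈ Finset.range n,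
    rootedAnnulus r (s + 1) (n - 1 - s) k / ((s : ℝ) + 1)

theorem coeff_X_mul_derivative (F : PowerSeries ℝ) (n : ℕ) :
    PowerSeries.coeff n (PowerSeries.X * PowerSeries.derivative ℝ F) = n * PowerSeries.coeff n F := by
  rcases n with _ | n
  · simp
  · rw [PowerSeries.coeff_succ_X_mul, PowerSeries.coeff_derivative]; push_cast; ring

/-- After division by the size of the rootless circle, merging the circles contributes `rootedDisc r
N (k + 1)` once for each of `N` sizes, hence the operator `X d/dX`. All other terms are Cauchy
products. -/
theorem annulusSeries_eq (r : ℕ → ℝ) (k : ℕ) :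
    annulusSeries r k = PowerSeries.X * (PowerSeries.C (r (k + 1)) * annulusSeries r 0 +
      annulusSeries r 0 * discSeries r (k + 1) + discSeries r 0 * annulusSeries r (k + 1) +
      PowerSeries.X * PowerSeries.derivative ℝ (discSeries r (k + 1))) := by
  ext N
  rcases N with _ | N
  · simp [annulusSeries]
  rw [PowerSeries.coeff_succ_X_mul, map_add, map_add, map_add, PowerSeries.coeff_C_mul, coeff_X_mul_derivative, PowerSeries.coeff_mul,
    PowerSeries.coeff_mul, Finset.Nat.sum_antidiagonal_eq_sum_range_succ_mk,
    Finset.Nat.sum_antidiagonal_eq_sum_range_succ_mk]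
  simp only [annulusSeries, discSeries, PowerSeries.coeff_mk]
  have e1 : ∀ s ∈ Finset.range N, rootedAnnulus r (s + 1) (N + 1 - 1 - s) k / ((s : ℝ) + 1) =
      r (k + 1) * (rootedAnnulus r (s + 1) (N - 1 - s) 0 / ((s : ℝ) + 1)) +
      ∑ i ∈ Finset.range (N - 1 - s), rootedAnnulus r (s + 1) i 0 / ((s : ℝ) + 1) *
        rootedDisc r (N - 1 - s - i) (k + 1) +
      ∑ i ∈ Finset.range (N - 1 - s), rootedDisc r i 0 *
        (rootedAnnulus r (s + 1) (N - 1 - s - i) (k + 1) / ((s : ℝ) + 1)) +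
      rootedDisc r N (k + 1) := by
    intro s hs
    rw [Finset.mem_range] at hs
    have e : N + 1 - 1 - s = (N - 1 - s) + 1 := by omega
    have e' : N - 1 - s + (s + 1) = N := by omega
    have hs0 : (s : ℝ) + 1 ≠ 0 := by positivity
    rw [e, rootedAnnulus_succ, e', Finset.sum_add_distrib, add_div, add_div, add_div,
      Finset.sum_div, Finset.sum_div]
    push_cast
    rw [mul_div_cancel_left₀ _ hs0, mul_div_assoc, ← add_assoc]
    congr 1
    congr 1
    · congr 1
      exact Finset.sum_congr rfl fun i _ => by ring
    · exact Finset.sum_congr rfl fun i _ => by ring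
  have e2 : rootedAnnulus r (N + 1) (N + 1 - 1 - N) k / ((N : ℝ) + 1) = 0 := by
    have : N + 1 - 1 - N = 0 := by omega
    rw [this, rootedAnnulus, zero_div]
  rw [Finset.sum_range_succ, e2, add_zero, Finset.sum_congr rfl e1, Finset.sum_add_distrib,
    Finset.sum_add_distrib, Finset.sum_add_distrib, ← Finset.mul_sum, Finset.sum_const,
    Finset.card_range, nsmul_eq_mul]
  congr 1
  congr 1
  · congr 1
    rw [Finset.sum_range_succ]
    have : rootedDisc r (N - N) (k + 1) = 0 := by simp [rootedDisc]
    rw [this, mul_zero, add_zero]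
    simp only [Finset.sum_mul]
    rw [Finset.sum_sigma', Finset.sum_sigma']
    -- The new summation index is the total number `s + 1 + i` of points in the annular factor.
    refine Finset.sum_bij' (fun x _ => ⟨x.1 + 1 + x.2, x.1⟩) (fun x _ => ⟨x.2, x.1 - 1 - x.2⟩)
      ?_ ?_ ?_ ?_ ?_
    · rintro ⟨s, i⟩ h
      simp only [Finset.mem_sigma, Finset.mem_range] at h ⊢
      omega
    · rintro ⟨j, s⟩ h
      simp only [Finset.mem_sigma, Finset.mem_range] at h ⊢
      omega
    · rintro ⟨s, i⟩ h
      simp only [Sigma.mk.injEq, heq_eq_eq, true_and]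
      omega
    · rintro ⟨j, s⟩ h
      simp only [Finset.mem_sigma, Finset.mem_range] at h
      simp only [Sigma.mk.injEq, heq_eq_eq, and_true]
      omega
    · rintro ⟨s, i⟩ h
      simp only
      congr 2
      · congr 1; omega
      · omega
  · rw [Finset.sum_range_succ, Nat.sub_self, Finset.range_zero, Finset.sum_empty, mul_zero,
      add_zero]
    simp only [Finset.mul_sum]
    have e3 : ∀ i ∈ Finset.range N, ∑ s ∈ Finset.range (N - i), rootedDisc r i 0 *
        (rootedAnnulus r (s + 1) (N - i - 1 - s) (k + 1) / ((s : ℝ) + 1)) =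
        ∑ s ∈ Finset.range (N - 1 - i), rootedDisc r i 0 *
        (rootedAnnulus r (s + 1) (N - i - 1 - s) (k + 1) / ((s : ℝ) + 1)) := by
      intro i hi
      rw [Finset.mem_range] at hi
      have : N - i = (N - 1 - i) + 1 := by omega
      rw [this, Finset.sum_range_succ]
      have : N - 1 - i + 1 - 1 - (N - 1 - i) = 0 := by omega
      rw [this, rootedAnnulus, zero_div, mul_zero, add_zero]
    rw [Finset.sum_congr rfl e3]
    rw [Finset.sum_comm' (t' := Finset.range N) (s' := fun i => Finset.range (N - 1 - i))
      (by intro x y; simp only [Finset.mem_range]; omega)]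
    refine Finset.sum_congr rfl fun i _ => Finset.sum_congr rfl fun s _ => ?_
    have : N - 1 - s - i = N - i - 1 - s := by omega
    rw [this]

theorem derivative_cumulantSeries (r : ℕ → ℝ) (k : ℕ) :
    PowerSeries.derivative ℝ (cumulantSeries r k) = PowerSeries.C (r (k + 1)) + cumulantSeries r (k + 1) +
      PowerSeries.X * PowerSeries.derivative ℝ (cumulantSeries r (k + 1)) := by
  conv_lhs => rw [cumulantSeries_eq, Derivation.leibniz, PowerSeries.derivative_X]
  simp only [smul_eq_mul, map_add, PowerSeries.derivative_C, zero_add, mul_one]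
  ring

theorem derivative_derivative_cumulantSeries (r : ℕ → ℝ) (k : ℕ) :
    PowerSeries.derivative ℝ (PowerSeries.derivative ℝ (cumulantSeries r k)) =
      2 * PowerSeries.derivative ℝ (cumulantSeries r (k + 1)) +
      PowerSeries.X * PowerSeries.derivative ℝ (PowerSeries.derivative ℝ (cumulantSeries r (k + 1))) := by
  rw [derivative_cumulantSeries, map_add, map_add, Derivation.leibniz, PowerSeries.derivative_X]
  simp only [smul_eq_mul, PowerSeries.derivative_C, zero_add, mul_one]
  ring

/-- Let `S_k` be the tails of the cumulant series, `y = discCauchy r` and derivatives be in `X`. The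
recursion `a_k = X a_0 (r_{k+1} + S_{k+1}(y)) + y a_{k+1} + X² S_{k+1}'(y) y'` is solved by `a_k = X
a_0 S_k'(y) + ½ X² y' S_k''(y)`, as one sees by differentiating `S_k = w (r_{k+1} + S_{k+1})` once
and twice. The factor two clears the denominator. -/
theorem annulusSeries_eq_subst (r : ℕ → ℝ) (k : ℕ) :
    2 * annulusSeries r k = 2 * (PowerSeries.X * annulusSeries r 0 *
        (PowerSeries.derivative ℝ (cumulantSeries r k)).subst (discCauchy r)) +
      PowerSeries.X ^ 2 * PowerSeries.derivative ℝ (discCauchy r) *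
        (PowerSeries.derivative ℝ (PowerSeries.derivative ℝ (cumulantSeries r k))).subst (discCauchy r) := by
  have hs := hasSubst_discCauchy r
  have := eq_zero_of_forall_eq_mul (constantCoeff_discCauchy r)
    (fun k => 2 * annulusSeries r k - (2 * (PowerSeries.X * annulusSeries r 0 *
        (PowerSeries.derivative ℝ (cumulantSeries r k)).subst (discCauchy r)) +
      PowerSeries.X ^ 2 * PowerSeries.derivative ℝ (discCauchy r) *
        (PowerSeries.derivative ℝ (PowerSeries.derivative ℝ (cumulantSeries r k))).subst (discCauchy r))) (fun k => by
      have h2 : (2 : PowerSeries ℝ) = PowerSeries.C 2 :=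
        (map_ofNat PowerSeries.C 2).symm
      have h2' : (2 : PowerSeries ℝ).subst (discCauchy r) = (2 : PowerSeries ℝ) := by
        rw [h2, subst_C]; rfl
      have hd1 : (PowerSeries.derivative ℝ (cumulantSeries r k)).subst (discCauchy r) =
          PowerSeries.C (r (k + 1)) + (cumulantSeries r (k + 1)).subst (discCauchy r) +
          discCauchy r * (PowerSeries.derivative ℝ (cumulantSeries r (k + 1))).subst (discCauchy r) := by
        rw [derivative_cumulantSeries, subst_add hs, subst_add hs, subst_mul hs, subst_X hs,
          subst_C]
        rfl
      have hd2 : (PowerSeries.derivative ℝ (PowerSeries.derivative ℝ (cumulantSeries r k))).subst (discCauchy r) =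
          2 * (PowerSeries.derivative ℝ (cumulantSeries r (k + 1))).subst (discCauchy r) +
          discCauchy r * (PowerSeries.derivative ℝ (PowerSeries.derivative ℝ (cumulantSeries r (k + 1)))).subst
            (discCauchy r) := by
        rw [derivative_derivative_cumulantSeries, subst_add hs, subst_mul hs, subst_mul hs,
          subst_X hs, h2']
      have hW : discSeries r (k + 1) = (cumulantSeries r (k + 1)).subst (discCauchy r) := by
        rw [discSeries_eq_subst]; simp
      have hW' : PowerSeries.derivative ℝ (discSeries r (k + 1)) =
          (PowerSeries.derivative ℝ (cumulantSeries r (k + 1))).subst (discCauchy r) *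
            PowerSeries.derivative ℝ (discCauchy r) := by
        rw [hW, derivative_subst hs]
      simp only [hd1, hd2]
      rw [annulusSeries_eq r k, hW', hW]
      have hM : PowerSeries.X * discSeries r 0 = discCauchy r := rfl
      rw [← hM]
      ring) k
  rw [sub_eq_zero] at this
  exact this

/-- The defining equation of the annular series. -/
theorem annulusSeries_zero (r : ℕ → ℝ) :
    2 * ((1 - PowerSeries.X * (PowerSeries.derivative ℝ (cumulantSeries r 0)).subst (discCauchy r)) *
        annulusSeries r 0) =
      PowerSeries.X ^ 2 * PowerSeries.derivative ℝ (discCauchy r) *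
        (PowerSeries.derivative ℝ (PowerSeries.derivative ℝ (cumulantSeries r 0))).subst (discCauchy r) := by
  linear_combination annulusSeries_eq_subst r 0

/-! ### Uniqueness in the functional equation -/

/-- The factor `X` makes the right-hand side an `X`-adic contraction: agreement modulo `Xⁿ` improves
to agreement modulo `Xⁿ⁺¹`. -/
theorem eq_of_functional_eq (S M₁ M₂ : PowerSeries ℝ)
    (h₁ : M₁ = 1 + S.subst (PowerSeries.X * M₁)) (h₂ : M₂ = 1 + S.subst (PowerSeries.X * M₂)) :
    M₁ = M₂ := by
  have key : ∀ n, (PowerSeries.X : PowerSeries ℝ) ^ n ∣ M₁ - M₂ := by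
    intro n
    induction n with
    | zero => simp
    | succ n ih =>
      rw [PowerSeries.X_pow_dvd_iff]
      intro m hm
      have hy : ∀ M : PowerSeries ℝ, PowerSeries.constantCoeff (PowerSeries.X * M) = 0 := by simp
      have e : M₁ - M₂ = S.subst (PowerSeries.X * M₁) - S.subst (PowerSeries.X * M₂) := by
        linear_combination h₁ - h₂
      rw [e, map_sub, coeff_subst_eq_sum (hy _) S (Nat.lt_succ_self m),
        coeff_subst_eq_sum (hy _) S (Nat.lt_succ_self m), ← Finset.sum_sub_distrib]
      refine Finset.sum_eq_zero fun j _ => ?_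
      rw [← mul_sub, ← map_sub]
      have : (PowerSeries.X : PowerSeries ℝ) ^ (n + 1) ∣
          (PowerSeries.X * M₁) ^ j - (PowerSeries.X * M₂) ^ j := by
        refine dvd_trans ?_ (sub_dvd_pow_sub_pow _ _ j)
        rw [← mul_sub, pow_succ']
        exact mul_dvd_mul_left _ ih
      rw [PowerSeries.X_pow_dvd_iff.1 this m hm, mul_zero]
  ext n
  have := PowerSeries.X_pow_dvd_iff.1 (key (n + 1)) n (Nat.lt_succ_self n)
  rwa [map_sub, sub_eq_zero] at this

theorem coeff_self_X_mul_pow (M : PowerSeries ℝ) (n : ℕ) :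
    PowerSeries.coeff n ((PowerSeries.X * M) ^ n) = (PowerSeries.constantCoeff M) ^ n := by
  rw [mul_pow, PowerSeries.coeff_X_pow_mul', if_pos le_rfl, Nat.sub_self, PowerSeries.coeff_zero_eq_constantCoeff, map_pow]

/-- Substitution of a series with leading term `X` is unitriangular on coefficients. -/
theorem subst_X_mul_injective {M S₁ S₂ : PowerSeries ℝ} (hM : PowerSeries.constantCoeff M = 1)
    (h : S₁.subst (PowerSeries.X * M) = S₂.subst (PowerSeries.X * M)) : S₁ = S₂ := by
  have hy : PowerSeries.constantCoeff (PowerSeries.X * M) = 0 := by simp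
  ext n
  induction n using Nat.strong_induction_on with
  | _ n ih =>
    have := congrArg (PowerSeries.coeff n) h
    rw [coeff_subst_eq_sum hy _ (Nat.lt_succ_self n), coeff_subst_eq_sum hy _ (Nat.lt_succ_self n),
      Finset.sum_range_succ, Finset.sum_range_succ, coeff_self_X_mul_pow, hM, one_pow, mul_one,
      mul_one] at this
    rw [Finset.sum_congr rfl fun j hj => by rw [ih j (Finset.mem_range.1 hj)]] at this
    exact add_left_cancel this

end SeriesAlgebra

/-! ### Set partitions as sets of blocks -/

section SetPartitions

variable {α : Type*} [DecidableEq α]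

/-- `P` is a partition of `S` into nonempty blocks. -/
structure IsSetPartition (P : Finset (Finset α)) (S : Finset α) : Prop where
  nonempty : ∀ B ∈ P, B.Nonempty
  subset : ∀ B ∈ P, B ⊆ S
  cover : ∀ x ∈ S, ∃ B ∈ P, x ∈ B
  eq_of_mem : ∀ B ∈ P, ∀ C ∈ P, ∀ x, x ∈ B → x ∈ C → B = C

open Classical in
/-- The set of all partitions of `S`. -/
noncomputable def partitionsOf (S : Finset α) : Finset (Finset (Finset α)) :=
  S.powerset.powerset.filter fun P => IsSetPartition P S

theorem mem_partitionsOf {S : Finset α} {P : Finset (Finset α)} :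
    P ∈ partitionsOf S ↔ IsSetPartition P S := by
  simp only [partitionsOf, Finset.mem_filter, Finset.mem_powerset, and_iff_right_iff_imp]
  intro h B hB
  exact Finset.mem_powerset.2 (h.subset B hB)

theorem isSetPartition_parts {S : Finset α} (π : Finpartition S) : IsSetPartition π.parts S where
  nonempty _ hB := π.nonempty_of_mem_parts hB
  subset _ hB := π.subset hB
  cover _ hx := π.exists_mem hx
  eq_of_mem _ hB _ hC _ hxB hxC := π.eq_of_mem_parts hB hC hxB hxC

theorem IsSetPartition.exists_finpartition {S : Finset α} {P : Finset (Finset α)}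
    (h : IsSetPartition P S) : ∃ π : Finpartition S, π.parts = P :=
  ⟨Finpartition.ofExistsUnique P h.subset (fun x hx => by
      obtain ⟨B, hB, hxB⟩ := h.cover x hx
      exact ⟨B, ⟨hB, hxB⟩, fun C hC => h.eq_of_mem C hC.1 B hB x hC.2 hxB⟩)
    (fun h0 => by simpa using h.nonempty _ h0), rfl⟩

theorem sum_finpartition_eq_sum_partitionsOf {S : Finset α} (s : Finset (Finpartition S))
    (Q : Finset (Finset α) → Prop) [DecidablePred Q] (hs : ∀ π, π ∈ s ↔ Q π.parts)
    (F : Finset (Finset α) → ℝ) :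
    ∑ π ∈ s, F π.parts = ∑ P ∈ (partitionsOf S).filter Q, F P := by
  refine Finset.sum_bij (fun π _ => π.parts) ?_ ?_ ?_ ?_
  · intro π hπ
    exact Finset.mem_filter.2 ⟨mem_partitionsOf.2 (isSetPartition_parts π), (hs π).1 hπ⟩
  · intro π _ π' _ h
    exact Finpartition.ext h
  · intro P hP
    rw [Finset.mem_filter, mem_partitionsOf] at hP
    obtain ⟨π, rfl⟩ := hP.1.exists_finpartition
    exact ⟨π, (hs π).2 hP.2, rfl⟩
  · intro π _
    rfl

theorem partitionsOf_empty : partitionsOf (∅ : Finset α) = {∅} := by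
  ext P
  rw [mem_partitionsOf, Finset.mem_singleton]
  constructor
  · intro h
    rw [Finset.eq_empty_iff_forall_notMem]
    intro B hB
    obtain ⟨x, hx⟩ := h.nonempty B hB
    exact Finset.notMem_empty x (h.subset B hB hx)
  · rintro rfl
    exact ⟨by simp, by simp, by simp, by simp⟩

theorem IsSetPartition.erase {P : Finset (Finset α)} {S B : Finset α} (h : IsSetPartition P S)
    (hB : B ∈ P) : IsSetPartition (P.erase B) (S \ B) where
  nonempty C hC := h.nonempty C (Finset.mem_of_mem_erase hC)
  subset C hC x hx := by
    obtain ⟨hne, hC⟩ := Finset.mem_erase.1 hC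
    exact Finset.mem_sdiff.2 ⟨h.subset C hC hx, fun hxB => hne (h.eq_of_mem C hC B hB x hx hxB)⟩
  cover x hx := by
    obtain ⟨hxS, hxB⟩ := Finset.mem_sdiff.1 hx
    obtain ⟨C, hC, hxC⟩ := h.cover x hxS
    exact ⟨C, Finset.mem_erase.2 ⟨by rintro rfl; exact hxB hxC, hC⟩, hxC⟩
  eq_of_mem C hC D hD := h.eq_of_mem C (Finset.mem_of_mem_erase hC) D (Finset.mem_of_mem_erase hD)

theorem IsSetPartition.insert {P : Finset (Finset α)} {S B : Finset α}
    (h : IsSetPartition P (S \ B)) (hB : B ⊆ S) (hne : B.Nonempty) :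
    IsSetPartition (insert B P) S where
  nonempty C hC := by
    rcases Finset.mem_insert.1 hC with rfl | hC
    · exact hne
    · exact h.nonempty C hC
  subset C hC := by
    rcases Finset.mem_insert.1 hC with rfl | hC
    · exact hB
    · exact (h.subset C hC).trans Finset.sdiff_subset
  cover x hx := by
    by_cases hxB : x ∈ B
    · exact ⟨B, Finset.mem_insert_self _ _, hxB⟩
    · obtain ⟨C, hC, hxC⟩ := h.cover x (Finset.mem_sdiff.2 ⟨hx, hxB⟩)
      exact ⟨C, Finset.mem_insert_of_mem hC, hxC⟩
  eq_of_mem C hC D hD x hxC hxD := by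
    rcases Finset.mem_insert.1 hC with hC | hC <;> rcases Finset.mem_insert.1 hD with hD | hD
    · rw [hC, hD]
    · have := (Finset.mem_sdiff.1 (h.subset D hD hxD)).2
      rw [hC] at hxC; exact absurd hxC this
    · have := (Finset.mem_sdiff.1 (h.subset C hC hxC)).2
      rw [hD] at hxD; exact absurd hxD this
    · exact h.eq_of_mem C hC D hD x hxC hxD

theorem IsSetPartition.notMem_of_sdiff {P : Finset (Finset α)} {S B : Finset α}
    (h : IsSetPartition P (S \ B)) (hne : B.Nonempty) : B ∉ P := by
  intro hB
  obtain ⟨x, hx⟩ := hne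
  exact (Finset.mem_sdiff.1 (h.subset B hB hx)).2 hx

end SetPartitions

/-! ### Non-crossing partitions and the disc recursion -/

section NonCrossing

variable {N : ℕ}

/-- The non-crossing condition for a set of blocks. -/
def IsNonCrossingSet (P : Finset (Finset (Fin N))) : Prop :=
  ∀ V ∈ P, ∀ W ∈ P, ∀ a ∈ V, ∀ b ∈ W, ∀ c ∈ V, ∀ d ∈ W, a < b → b < c → c < d → V = W

open Classical in
/-- The non-crossing partitions of `S`. -/
noncomputable def ncPartitionsOf (S : Finset (Fin N)) : Finset (Finset (Finset (Fin N))) :=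
  (partitionsOf S).filter IsNonCrossingSet

theorem mem_ncPartitionsOf {S : Finset (Fin N)} {P : Finset (Finset (Fin N))} :
    P ∈ ncPartitionsOf S ↔ IsSetPartition P S ∧ IsNonCrossingSet P := by
  classical
  rw [ncPartitionsOf, Finset.mem_filter, mem_partitionsOf]

theorem IsNonCrossingSet.mono {P Q : Finset (Finset (Fin N))} (h : IsNonCrossingSet P)
    (hQ : Q ⊆ P) : IsNonCrossingSet Q :=
  fun V hV W hW => h V (hQ hV) W (hQ hW)

/-- The weighted sum over the non-crossing partitions of `S`. -/
noncomputable def ncSum (f : Finset (Fin N) → ℝ) (S : Finset (Fin N)) : ℝ :=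
  ∑ P ∈ ncPartitionsOf S, ∏ B ∈ P, f B

theorem ncSum_congr {f g : Finset (Fin N) → ℝ} {S : Finset (Fin N)} (h : ∀ B ⊆ S, f B = g B) :
    ncSum f S = ncSum g S :=
  Finset.sum_congr rfl fun _ hP => Finset.prod_congr rfl fun B hB =>
    h B ((mem_ncPartitionsOf.1 hP).1.subset B hB)

theorem ncSum_rootWeight_of_notMem (r : ℕ → ℝ) {a : Fin N} (k : ℕ) {S : Finset (Fin N)}
    (ha : a ∉ S) : ncSum (rootWeight r a k) S = ncSum (fun B => r B.card) S :=
  ncSum_congr fun B hB => by rw [rootWeight, if_neg fun h => ha (hB h), add_zero]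

/-- In `P`, the element `b` is the largest one below `a` in the block of `a`. -/
def IsPredecessor (P : Finset (Finset (Fin N))) (a b : Fin N) : Prop :=
  ∃ B ∈ P, a ∈ B ∧ b ∈ B ∧ b ≠ a ∧ ∀ x ∈ B, x = a ∨ x ≤ b

open Classical in
theorem sum_singleton_block (r : ℕ → ℝ) (k : ℕ) {a : Fin N} {S : Finset (Fin N)} (ha : a ∈ S) :
    ∑ P ∈ (ncPartitionsOf S).filter (fun P => {a} ∈ P), ∏ B ∈ P, rootWeight r a k B =
      r (k + 1) * ncSum (fun B => r B.card) (S.erase a) := by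
  rw [← ncSum_rootWeight_of_notMem r k (Finset.notMem_erase a S), ncSum, Finset.mul_sum]
  have hsd : S.erase a = S \ {a} := Finset.erase_eq S a
  refine Finset.sum_bij' (fun P _ => P.erase {a}) (fun Q _ => insert {a} Q) ?_ ?_ ?_ ?_ ?_
  · intro P hP
    simp only [Finset.mem_filter, mem_ncPartitionsOf] at hP ⊢
    rw [hsd]
    exact ⟨hP.1.1.erase hP.2, hP.1.2.mono (Finset.erase_subset _ _)⟩
  · intro Q hQ
    simp only [Finset.mem_filter, mem_ncPartitionsOf] at hQ ⊢
    rw [hsd] at hQ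
    refine ⟨⟨hQ.1.insert (by simpa using ha) (by simp), ?_⟩, Finset.mem_insert_self _ _⟩
    intro V hV W hW w hw x hx y hy z hz hwx hxy hyz
    rcases Finset.mem_insert.1 hV with hV | hV
    · rw [hV, Finset.mem_singleton] at hw hy
      rw [hw, hy] at *
      exact absurd (hwx.trans hxy) (lt_irrefl _)
    · rcases Finset.mem_insert.1 hW with hW | hW
      · rw [hW, Finset.mem_singleton] at hx hz
        rw [hx, hz] at *
        exact absurd (hxy.trans hyz) (lt_irrefl _)
      · exact hQ.2 V hV W hW w hw x hx y hy z hz hwx hxy hyz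
  · intro P hP
    exact Finset.insert_erase (Finset.mem_filter.1 hP).2
  · intro Q hQ
    rw [mem_ncPartitionsOf, hsd] at hQ
    exact Finset.erase_insert (hQ.1.notMem_of_sdiff (by simp))
  · intro P hP
    rw [← Finset.mul_prod_erase P _ (Finset.mem_filter.1 hP).2]
    congr 1
    rw [rootWeight, Finset.card_singleton, if_pos (Finset.mem_singleton_self a), add_comm]

/-- Adds `a` to the blocks containing `b`. -/
def addToBlock (a b : Fin N) (B : Finset (Fin N)) : Finset (Fin N) :=
  if b ∈ B then insert a B else B

theorem erase_addToBlock {a b : Fin N} {B : Finset (Fin N)} (ha : a ∉ B) :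
    (addToBlock a b B).erase a = B := by
  unfold addToBlock
  split_ifs
  · exact Finset.erase_insert ha
  · exact Finset.erase_eq_of_notMem ha

theorem mem_addToBlock {a b x : Fin N} {B : Finset (Fin N)} :
    x ∈ addToBlock a b B ↔ x ∈ B ∨ (b ∈ B ∧ x = a) := by
  unfold addToBlock
  split_ifs with h
  · simp [h, or_comm]
  · simp [h]

-- The arc from `b` to the largest element `a` separates the elements between them from those up to
-- `b`, so the other blocks lie entirely on one side. Deleting `a` leaves a block containing `b`
-- that has absorbed `k + 1` elements. Moreover `b` is the maximum of its side, so the situation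
-- reproduces itself.
open Classical in
theorem sum_predecessor (r : ℕ → ℝ) (k : ℕ) {a b : Fin N} {S : Finset (Fin N)} (ha : a ∈ S)
    (hmax : ∀ x ∈ S, x ≤ a) (hb : b ∈ S.erase a) :
    ∑ P ∈ (ncPartitionsOf S).filter (fun P => IsPredecessor P a b),
        ∏ B ∈ P, rootWeight r a k B =
      ncSum (fun B => r B.card) ((S.erase a).filter fun x => b < x) *
        ncSum (rootWeight r b (k + 1)) ((S.erase a).filter fun x => x ≤ b) := by
  set R := (S.erase a).filter fun x => b < x with hR
  set L := (S.erase a).filter fun x => x ≤ b with hL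
  have hba : b ≠ a := Finset.ne_of_mem_erase hb
  have hbS : b ∈ S := Finset.mem_of_mem_erase hb
  have hblt : b < a := lt_of_le_of_ne (hmax b hbS) hba
  have memR : ∀ x, x ∈ R ↔ x ∈ S ∧ x ≠ a ∧ b < x := fun x => by
    simp only [hR, Finset.mem_filter, Finset.mem_erase]; tauto
  have memL : ∀ x, x ∈ L ↔ x ∈ S ∧ x ≤ b := fun x => by
    simp only [hL, Finset.mem_filter, Finset.mem_erase]
    constructor
    · tauto
    · rintro ⟨h1, h2⟩
      exact ⟨⟨fun h => absurd (h ▸ h2) (not_le.2 hblt), h1⟩, h2⟩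
  have haR : a ∉ R := fun h => ((memR a).1 h).2.1 rfl
  have haL : a ∉ L := fun h => absurd ((memL a).1 h).2 (not_le.2 hblt)
  have hbL : b ∈ L := (memL b).2 ⟨hbS, le_rfl⟩
  have hRlt : ∀ x ∈ R, x < a := fun x hx =>
    lt_of_le_of_ne (hmax x ((memR x).1 hx).1) ((memR x).1 hx).2.1
  rw [← ncSum_rootWeight_of_notMem r k haR, ncSum, ncSum, Finset.sum_mul_sum,
    ← Finset.sum_product']
  symm
  have disj : ∀ Q₁ ∈ ncPartitionsOf R, ∀ Q₂ ∈ ncPartitionsOf L,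
      Disjoint Q₁ (Q₂.image (addToBlock a b)) := by
    intro Q₁ h₁ Q₂ h₂
    rw [mem_ncPartitionsOf] at h₁ h₂
    rw [Finset.disjoint_left]
    intro B hB hB'
    obtain ⟨C, hC, rfl⟩ := Finset.mem_image.1 hB'
    obtain ⟨x, hx⟩ := h₂.1.nonempty C hC
    have h1 := (memR x).1 (h₁.1.subset _ hB (mem_addToBlock.2 (Or.inl hx)))
    have h2 := (memL x).1 (h₂.1.subset C hC hx)
    exact absurd h1.2.2 (not_lt.2 h2.2)
  have injOn : ∀ Q₂ ∈ ncPartitionsOf L, Set.InjOn (addToBlock a b) (Q₂ : Set (Finset (Fin N))) := by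
    intro Q₂ h₂ B hB C hC h
    rw [mem_ncPartitionsOf] at h₂
    have h1 : a ∉ B := fun h' => haL (h₂.1.subset B hB h')
    have h2 : a ∉ C := fun h' => haL (h₂.1.subset C hC h')
    rw [← erase_addToBlock (b := b) h1, h, erase_addToBlock h2]
  refine Finset.sum_bij (fun Q _ => Q.1 ∪ Q.2.image (addToBlock a b)) ?_ ?_ ?_ ?_
  · rintro ⟨Q₁, Q₂⟩ hQ
    rw [Finset.mem_product] at hQ
    obtain ⟨h₁, h₂⟩ := hQ
    rw [mem_ncPartitionsOf] at h₁ h₂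
    obtain ⟨p₁, n₁⟩ := h₁
    obtain ⟨p₂, n₂⟩ := h₂
    simp only at p₁ n₁ p₂ n₂
    have hmem : ∀ B ∈ Q₁ ∪ Q₂.image (addToBlock a b),
        B ∈ Q₁ ∨ ∃ C ∈ Q₂, B = addToBlock a b C := by
      intro B hB
      rcases Finset.mem_union.1 hB with h | h
      · exact Or.inl h
      · obtain ⟨C, hC, rfl⟩ := Finset.mem_image.1 h
        exact Or.inr ⟨C, hC, rfl⟩
    have hadd : ∀ C ∈ Q₂, ∀ x ∈ addToBlock a b C, (x ∈ C ∧ x ∈ S ∧ x ≤ b) ∨ (b ∈ C ∧ x = a) := by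
      intro C hC x hx
      rcases mem_addToBlock.1 hx with h | h
      · exact Or.inl ⟨h, (memL x).1 (p₂.subset C hC h)⟩
      · exact Or.inr h
    rw [Finset.mem_filter, mem_ncPartitionsOf]
    refine ⟨⟨⟨?_, ?_, ?_, ?_⟩, ?_⟩, ?_⟩
    · intro B hB
      rcases hmem B hB with h | ⟨C, hC, rfl⟩
      · exact p₁.nonempty B h
      · obtain ⟨x, hx⟩ := p₂.nonempty C hC
        exact ⟨x, mem_addToBlock.2 (Or.inl hx)⟩
    · intro B hB x hx
      rcases hmem B hB with h | ⟨C, hC, rfl⟩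
      · exact ((memR x).1 (p₁.subset B h hx)).1
      · rcases hadd C hC x hx with h | h
        · exact h.2.1
        · rw [h.2]; exact ha
    · intro x hx
      by_cases hxa : x = a
      · obtain ⟨C, hC, hbC⟩ := p₂.cover b hbL
        exact ⟨addToBlock a b C, Finset.mem_union_right _ (Finset.mem_image_of_mem _ hC),
          mem_addToBlock.2 (Or.inr ⟨hbC, hxa⟩)⟩
      by_cases hxb : x ≤ b
      · obtain ⟨C, hC, hxC⟩ := p₂.cover x ((memL x).2 ⟨hx, hxb⟩)
        exact ⟨addToBlock a b C, Finset.mem_union_right _ (Finset.mem_image_of_mem _ hC),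
          mem_addToBlock.2 (Or.inl hxC)⟩
      · obtain ⟨C, hC, hxC⟩ := p₁.cover x ((memR x).2 ⟨hx, hxa, not_le.1 hxb⟩)
        exact ⟨C, Finset.mem_union_left _ hC, hxC⟩
    · have key : ∀ B ∈ Q₁, ∀ C ∈ Q₂, ∀ x, x ∈ B → x ∈ addToBlock a b C → False := by
        intro B hB C hC x hxB hxC
        have h1 := (memR x).1 (p₁.subset B hB hxB)
        rcases hadd C hC x hxC with h | h
        · exact absurd h1.2.2 (not_lt.2 h.2.2)
        · exact h1.2.1 h.2
      intro B hB C hC x hxB hxC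
      rcases hmem B hB with hB' | ⟨B, hB', rfl⟩ <;> rcases hmem C hC with hC' | ⟨C, hC', rfl⟩
      · exact p₁.eq_of_mem B hB' C hC' x hxB hxC
      · exact (key B hB' C hC' x hxB hxC).elim
      · exact (key C hC' B hB' x hxC hxB).elim
      · congr 1
        rcases hadd B hB' x hxB with h | h <;> rcases hadd C hC' x hxC with h' | h'
        · exact p₂.eq_of_mem B hB' C hC' x h.1 h'.1
        · exact absurd (h'.2 ▸ h.2.2) (not_le.2 hblt)
        · exact absurd (h.2 ▸ h'.2.2) (not_le.2 hblt)
        · exact p₂.eq_of_mem B hB' C hC' b h.1 h'.1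
    · intro V hV W hW w hw x hx y hy z hz hwx hxy hyz
      rcases hmem V hV with hV' | ⟨V, hV', rfl⟩ <;> rcases hmem W hW with hW' | ⟨W, hW', rfl⟩
      · exact n₁ V hV' W hW' w hw x hx y hy z hz hwx hxy hyz
      · have h1 := (memR w).1 (p₁.subset V hV' hw)
        have h2 := hRlt y (p₁.subset V hV' hy)
        rcases hadd W hW' x hx with h | h
        · exact absurd (h1.2.2.trans hwx) (not_lt.2 h.2.2)
        · rw [h.2] at hxy; exact absurd hxy (not_lt.2 h2.le)
      · have h1 := (memR x).1 (p₁.subset W hW' hx)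
        have h2 := hRlt z (p₁.subset W hW' hz)
        rcases hadd V hV' y hy with h | h
        · exact absurd (h1.2.2.trans hxy) (not_lt.2 h.2.2)
        · rw [h.2] at hyz; exact absurd hyz (not_lt.2 h2.le)
      · congr 1
        have hza : z ≤ a := by
          rcases hadd W hW' z hz with h | h
          · exact hmax z h.2.1
          · exact h.2.le
        have hin : ∀ C ∈ Q₂, ∀ u ∈ addToBlock a b C, u < z → u ∈ C ∧ u ≤ b := by
          intro C hC u hu huz
          rcases hadd C hC u hu with h | h
          · exact ⟨h.1, h.2.2⟩
          · rw [h.2] at huz; exact absurd huz (not_lt.2 hza)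
        have hw' := hin V hV' w hw (hwx.trans (hxy.trans hyz))
        have hx' := hin W hW' x hx (hxy.trans hyz)
        have hy' := hin V hV' y hy hyz
        rcases hadd W hW' z hz with h | h
        · exact n₂ V hV' W hW' w hw'.1 x hx'.1 y hy'.1 z h.1 hwx hxy hyz
        -- Here `z` is the added point `a`, and `b`, in the same block, takes its place in the
        -- crossing pattern. The position `y = b` is excluded from the pattern but puts `b` in both
        -- blocks.
        · rcases hy'.2.eq_or_lt with h3 | h3
          · exact p₂.eq_of_mem V hV' W hW' b (h3 ▸ hy'.1) h.1
          · exact n₂ V hV' W hW' w hw'.1 x hx'.1 y hy'.1 b h.1 hwx hxy h3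
    · obtain ⟨C, hC, hbC⟩ := p₂.cover b hbL
      refine ⟨addToBlock a b C, Finset.mem_union_right _ (Finset.mem_image_of_mem _ hC),
        mem_addToBlock.2 (Or.inr ⟨hbC, rfl⟩), mem_addToBlock.2 (Or.inl hbC), hba, ?_⟩
      intro x hx
      rcases hadd C hC x hx with h | h
      · exact Or.inr h.2.2
      · exact Or.inl h.2
  · rintro ⟨Q₁, Q₂⟩ hQ ⟨Q₁', Q₂'⟩ hQ' heq
    rw [Finset.mem_product] at hQ hQ'
    simp only at hQ hQ' heq
    -- Injectivity: the blocks contained in `R` recover the first partition, and the others with `a`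
    -- erased recover the second.
    have hfil : ∀ P₁ ∈ ncPartitionsOf R, ∀ P₂ ∈ ncPartitionsOf L,
        (P₁ ∪ P₂.image (addToBlock a b)).filter (fun B => B ⊆ R) = P₁ := by
      intro P₁ h₁ P₂ h₂
      have hd := disj P₁ h₁ P₂ h₂
      rw [mem_ncPartitionsOf] at h₁ h₂
      ext B
      rw [Finset.mem_filter, Finset.mem_union]
      constructor
      · rintro ⟨h | h, hBR⟩
        · exact h
        · obtain ⟨C, hC, rfl⟩ := Finset.mem_image.1 h
          obtain ⟨x, hx⟩ := h₂.1.nonempty C hC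
          have h1 := (memR x).1 (hBR (mem_addToBlock.2 (Or.inl hx)))
          have h2 := (memL x).1 (h₂.1.subset C hC hx)
          exact absurd h1.2.2 (not_lt.2 h2.2)
      · exact fun h => ⟨Or.inl h, h₁.1.subset B h⟩
    have e1 : Q₁ = Q₁' := by
      rw [← hfil Q₁ hQ.1 Q₂ hQ.2, heq, hfil Q₁' hQ'.1 Q₂' hQ'.2]
    have e2 : Q₂.image (addToBlock a b) = Q₂'.image (addToBlock a b) := by
      have hd := disj Q₁ hQ.1 Q₂ hQ.2
      have hd' := disj Q₁' hQ'.1 Q₂' hQ'.2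
      rw [← Finset.union_sdiff_cancel_left hd, heq, e1, Finset.union_sdiff_cancel_left hd']
    have himg : ∀ P₂ ∈ ncPartitionsOf L,
        (P₂.image (addToBlock a b)).image (fun B => B.erase a) = P₂ := by
      intro P₂ h₂
      rw [mem_ncPartitionsOf] at h₂
      rw [Finset.image_image]
      have : ∀ B ∈ P₂, ((fun B => B.erase a) ∘ addToBlock a b) B = id B := fun B hB =>
        erase_addToBlock fun h => haL (h₂.1.subset B hB h)
      rw [Finset.image_congr this, Finset.image_id]
    have e3 : Q₂ = Q₂' := by rw [← himg Q₂ hQ.2, e2, himg Q₂' hQ'.2]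
    rw [e1, e3]
  · intro P hP
    rw [Finset.mem_filter, mem_ncPartitionsOf] at hP
    obtain ⟨⟨p, n⟩, V, hV, haV, hbV, -, hVmax⟩ := hP
    -- A block with elements on both sides would contain `x < b < y < a` and cross the block of `a`
    -- and `b`.
    have hsplit : ∀ B ∈ P, B ≠ V → B ⊆ R ∨ B ⊆ L := by
      intro B hB hne
      have hnot : ∀ x ∈ B, x ∉ V := fun x hx hxV => hne (p.eq_of_mem B hB V hV x hx hxV)
      by_contra hcon
      push Not at hcon
      obtain ⟨⟨x, hx, hxR⟩, y, hy, hyL⟩ :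
          (∃ x ∈ B, x ∉ R) ∧ ∃ y ∈ B, y ∉ L :=
        ⟨Finset.not_subset.1 hcon.1, Finset.not_subset.1 hcon.2⟩
      have hxa : x ≠ a := fun h => hnot x hx (h ▸ haV)
      have hya : y ≠ a := fun h => hnot y hy (h ▸ haV)
      have hxb : x ≠ b := fun h => hnot x hx (h ▸ hbV)
      have hxS := p.subset B hB hx
      have hyS := p.subset B hB hy
      have h1 : x < b := by
        refine lt_of_le_of_ne ?_ hxb
        by_contra h
        exact hxR ((memR x).2 ⟨hxS, hxa, not_le.1 h⟩)
      have h2 : b < y := by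
        by_contra h
        exact hyL ((memL y).2 ⟨hyS, not_lt.1 h⟩)
      have h3 : y < a := lt_of_le_of_ne (hmax y hyS) hya
      exact hne (n B hB V hV x hx b hbV y hy a haV h1 h2 h3)
    have hVL : V.erase a ⊆ L := by
      intro x hx
      obtain ⟨hxa, hxV⟩ := Finset.mem_erase.1 hx
      exact (memL x).2 ⟨p.subset V hV hxV, (hVmax x hxV).resolve_left hxa⟩
    have hnotR : ∀ B ∈ P, ¬ B ⊆ R → B.erase a ⊆ L := by
      intro B hB hBR
      by_cases h : B = V
      · rw [h]; exact hVL
      · exact (Finset.erase_subset _ _).trans ((hsplit B hB h).resolve_left hBR)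
    have hVR : ¬ V ⊆ R := fun h => haR (h haV)
    have haB : ∀ B ∈ P, a ∈ B → B = V := fun B hB h => p.eq_of_mem B hB V hV a h haV
    have hback : ∀ B ∈ P, ¬ B ⊆ R → addToBlock a b (B.erase a) = B := by
      intro B hB hBR
      unfold addToBlock
      by_cases h : B = V
      · rw [h, if_pos (Finset.mem_erase.2 ⟨hba, hbV⟩), Finset.insert_erase haV]
      · have h1 : a ∉ B := fun h' => h (haB B hB h')
        rw [Finset.erase_eq_of_notMem h1, if_neg]
        intro h2
        exact h (p.eq_of_mem B hB V hV b h2 hbV)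
    refine ⟨(P.filter (fun B => B ⊆ R), (P.filter fun B => ¬ B ⊆ R).image fun B => B.erase a),
      ?_, ?_⟩
    · rw [Finset.mem_product, mem_ncPartitionsOf, mem_ncPartitionsOf]
      refine ⟨⟨⟨?_, ?_, ?_, ?_⟩, n.mono (Finset.filter_subset _ _)⟩, ⟨?_, ?_, ?_, ?_⟩, ?_⟩
      · exact fun B hB => p.nonempty B (Finset.mem_filter.1 hB).1
      · exact fun B hB => (Finset.mem_filter.1 hB).2
      · intro x hx
        obtain ⟨B, hB, hxB⟩ := p.cover x ((memR x).1 hx).1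
        refine ⟨B, Finset.mem_filter.2 ⟨hB, ?_⟩, hxB⟩
        by_contra hBR
        have h1 := hnotR B hB hBR (Finset.mem_erase.2 ⟨((memR x).1 hx).2.1, hxB⟩)
        exact absurd ((memR x).1 hx).2.2 (not_lt.2 ((memL x).1 h1).2)
      · exact fun B hB C hC => p.eq_of_mem B (Finset.mem_filter.1 hB).1 C (Finset.mem_filter.1 hC).1
      · intro B hB
        obtain ⟨C, hC, rfl⟩ := Finset.mem_image.1 hB
        obtain ⟨hC, hCR⟩ := Finset.mem_filter.1 hC
        by_cases h : C = V
        · exact ⟨b, Finset.mem_erase.2 ⟨hba, h ▸ hbV⟩⟩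
        · rw [Finset.erase_eq_of_notMem fun h' => h (haB C hC h')]
          exact p.nonempty C hC
      · intro B hB
        obtain ⟨C, hC, rfl⟩ := Finset.mem_image.1 hB
        obtain ⟨hC, hCR⟩ := Finset.mem_filter.1 hC
        exact hnotR C hC hCR
      · intro x hx
        obtain ⟨hxS, hxb⟩ := (memL x).1 hx
        obtain ⟨B, hB, hxB⟩ := p.cover x hxS
        have hxa : x ≠ a := fun h => haL (h ▸ hx)
        refine ⟨B.erase a, Finset.mem_image_of_mem _ (Finset.mem_filter.2 ⟨hB, fun h => ?_⟩),
          Finset.mem_erase.2 ⟨hxa, hxB⟩⟩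
        exact absurd ((memR x).1 (h hxB)).2.2 (not_lt.2 hxb)
      · intro B hB C hC x hxB hxC
        obtain ⟨B', hB', rfl⟩ := Finset.mem_image.1 hB
        obtain ⟨C', hC', rfl⟩ := Finset.mem_image.1 hC
        rw [p.eq_of_mem B' (Finset.mem_filter.1 hB').1 C' (Finset.mem_filter.1 hC').1 x
          (Finset.mem_of_mem_erase hxB) (Finset.mem_of_mem_erase hxC)]
      · intro B hB C hC w hw x hx y hy z hz hwx hxy hyz
        obtain ⟨B', hB', rfl⟩ := Finset.mem_image.1 hB
        obtain ⟨C', hC', rfl⟩ := Finset.mem_image.1 hC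
        rw [n B' (Finset.mem_filter.1 hB').1 C' (Finset.mem_filter.1 hC').1
          w (Finset.mem_of_mem_erase hw) x (Finset.mem_of_mem_erase hx)
          y (Finset.mem_of_mem_erase hy) z (Finset.mem_of_mem_erase hz) hwx hxy hyz]
    · simp only
      rw [Finset.image_image]
      have : ∀ B ∈ P.filter (fun B => ¬ B ⊆ R),
          (addToBlock a b ∘ fun B => B.erase a) B = id B := fun B hB =>
        hback B (Finset.mem_filter.1 hB).1 (Finset.mem_filter.1 hB).2
      rw [Finset.image_congr this, Finset.image_id]
      exact Finset.filter_union_filter_not_eq _ _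
  · rintro ⟨Q₁, Q₂⟩ hQ
    rw [Finset.mem_product] at hQ
    simp only at hQ ⊢
    rw [Finset.prod_union (disj Q₁ hQ.1 Q₂ hQ.2), Finset.prod_image (injOn Q₂ hQ.2)]
    congr 1
    refine Finset.prod_congr rfl fun B hB => ?_
    have h1 : a ∉ B := fun h => haL ((mem_ncPartitionsOf.1 hQ.2).1.subset B hB h)
    simp only [rootWeight, addToBlock]
    by_cases h : b ∈ B
    · simp only [h, if_true, Finset.mem_insert_self, Finset.card_insert_of_notMem h1]
      congr 1; ring
    · simp only [h, h1, if_false]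

end NonCrossing

/-! ### The sum over non-crossing partitions -/

section NonCrossing

variable {N : ℕ}

open Classical in
theorem ncSum_eq_sum_predecessor (f : Finset (Fin N) → ℝ) {a : Fin N} {S : Finset (Fin N)}
    (ha : a ∈ S) :
    ncSum f S = ∑ P ∈ (ncPartitionsOf S).filter (fun P => {a} ∈ P), ∏ B ∈ P, f B +
      ∑ b ∈ S.erase a, ∑ P ∈ (ncPartitionsOf S).filter (fun P => IsPredecessor P a b),
        ∏ B ∈ P, f B := by
  simp only [Finset.sum_filter]
  rw [Finset.sum_comm, ← Finset.sum_add_distrib, ncSum]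
  refine Finset.sum_congr rfl fun P hP => ?_
  obtain ⟨p, -⟩ := mem_ncPartitionsOf.1 hP
  obtain ⟨V, hV, haV⟩ := p.cover a ha
  have hVa : ∀ B ∈ P, a ∈ B → B = V := fun B hB h => p.eq_of_mem B hB V hV a h haV
  by_cases hs : V.erase a = ∅
  · have hV1 : V = {a} := by
      rw [← Finset.insert_erase haV, hs]; simp
    rw [if_pos (hV1 ▸ hV), Finset.sum_eq_zero, add_zero]
    intro b hb
    rw [if_neg]
    rintro ⟨B, hB, haB, hbB, hba, -⟩
    rw [hVa B hB haB, hV1, Finset.mem_singleton] at hbB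
    exact hba hbB
  · have hne : (V.erase a).Nonempty := Finset.nonempty_iff_ne_empty.2 hs
    obtain ⟨hba, hbV⟩ := Finset.mem_erase.1 (Finset.max'_mem _ hne)
    have hle : ∀ x ∈ V, x = a ∨ x ≤ (V.erase a).max' hne := fun x hx => by
      by_cases h : x = a
      · exact Or.inl h
      · exact Or.inr (Finset.le_max' _ _ (Finset.mem_erase.2 ⟨h, hx⟩))
    rw [if_neg, zero_add, Finset.sum_eq_single ((V.erase a).max' hne), if_pos]
    · exact ⟨V, hV, haV, hbV, hba, hle⟩
    · intro b hb hne'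
      rw [if_neg]
      rintro ⟨B, hB, haB, hbB, hba', hB'⟩
      rw [hVa B hB haB] at hbB hB'
      refine hne' (le_antisymm ((hle b hbB).resolve_left hba') ((hB' _ hbV).resolve_left hba))
    · intro h
      exact absurd (Finset.mem_erase.2 ⟨hba, p.subset V hV hbV⟩) h
    · intro h
      have := hVa {a} h (Finset.mem_singleton_self a)
      rw [← this] at hs
      simp at hs

theorem ncSum_rootWeight (r : ℕ → ℝ) (n : ℕ) :
    ∀ S : Finset (Fin N), S.card = n →
      ncSum (fun B => r B.card) S = rootedDisc r n 0 ∧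
      ∀ a ∈ S, (∀ x ∈ S, x ≤ a) → ∀ k, ncSum (rootWeight r a k) S = rootedDisc r n k := by
  induction n using Nat.strong_induction_on with
  | _ n ih =>
    intro S hn
    have rooted : ∀ a ∈ S, (∀ x ∈ S, x ≤ a) → ∀ k,
        ncSum (rootWeight r a k) S = rootedDisc r n k := by
      intro a ha hmax k
      obtain ⟨m, rfl⟩ : ∃ m, n = m + 1 :=
        Nat.exists_eq_succ_of_ne_zero (by rw [← hn]; exact Finset.card_ne_zero_of_mem ha)
      have hT : (S.erase a).card = m := by rw [Finset.card_erase_of_mem ha, hn]; rfl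
      rw [ncSum_eq_sum_predecessor _ ha, sum_singleton_block r k ha, (ih m (by omega) _ hT).1,
        rootedDisc_succ]
      congr 1
      -- The order is reversed because the unrooted factor consists of the elements above `b`.
      rw [← hT, ← sum_card_filter_lt (S.erase a) (fun x : Fin N => N - x) (by
        intro x _ y _ h
        simp only at h
        ext
        omega) (fun i => rootedDisc r i 0 * rootedDisc r ((S.erase a).card - i) (k + 1))]
      refine Finset.sum_congr rfl fun b hb => ?_
      rw [sum_predecessor r k ha hmax hb]
      have e1 : (S.erase a).filter (fun x : Fin N => N - (x : ℕ) < N - (b : ℕ)) =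
          (S.erase a).filter fun x => b < x := by
        refine Finset.filter_congr fun x _ => ?_
        rw [Fin.lt_def]
        omega
      have e2 : ((S.erase a).filter fun x => x ≤ b).card =
          (S.erase a).card - ((S.erase a).filter fun x => b < x).card := by
        have := Finset.card_filter_add_card_filter_not (s := S.erase a) (fun x => b < x)
        simp only [not_lt] at this
        omega
      have hlt : ((S.erase a).filter fun x => b < x).card < m + 1 :=
        lt_of_le_of_lt (Finset.card_filter_le _ _) (by omega)
      have hlt' : ((S.erase a).filter fun x => x ≤ b).card < m + 1 :=
        lt_of_le_of_lt (Finset.card_filter_le _ _) (by omega)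
      rw [e1, (ih _ hlt _ rfl).1, (ih _ hlt' _ rfl).2 b
        (Finset.mem_filter.2 ⟨hb, le_rfl⟩) (fun x hx => (Finset.mem_filter.1 hx).2), e2]
    refine ⟨?_, rooted⟩
    rcases S.eq_empty_or_nonempty with rfl | hne
    · rw [Finset.card_empty] at hn
      rw [← hn]
      have : ncPartitionsOf (∅ : Finset (Fin N)) = {∅} := by
        ext P
        rw [mem_ncPartitionsOf, ← mem_partitionsOf, partitionsOf_empty, Finset.mem_singleton,
          and_iff_left_iff_imp]
        rintro rfl
        intro V hV
        simp at hV
      rw [ncSum, this, Finset.sum_singleton, Finset.prod_empty]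
      simp [rootedDisc]
    · have := rooted _ (S.max'_mem hne) (fun x hx => S.le_max' x hx) 0
      rwa [rootWeight_zero] at this

open Classical in
theorem sum_NC_eq_rootedDisc (r : ℕ → ℝ) (n : ℕ) :
    ∑ π ∈ NC n, ∏ V ∈ π.parts, r V.card = rootedDisc r n 0 := by
  have := (ncSum_rootWeight r n (Finset.univ : Finset (Fin n)) (by simp)).1
  rw [← this, ncSum, ncPartitionsOf]
  exact sum_finpartition_eq_sum_partitionsOf (NC n)
    (fun P : Finset (Finset (Fin n)) => IsNonCrossingSet P)
    (fun π => by simp [NC, IsNonCrossing, IsNonCrossingSet]) fun P => ∏ V ∈ P, r V.card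

end NonCrossing

/-! ### Free cumulants and the functional equation -/

section FreeCumulants

theorem mk_eq_discSeries_freeCumulantSeq {m : ℕ → ℝ} (h0 : m 0 = 1) :
    PowerSeries.mk m = discSeries (freeCumulantSeq m) 0 := by
  ext n
  rw [PowerSeries.coeff_mk, discSeries, PowerSeries.coeff_mk]
  rcases n with _ | n
  · simp [rootedDisc, h0]
  · rw [moment_eq_sum_freeCumulantSeq m (Nat.succ_le_succ (Nat.zero_le n)), sum_NC_eq_rootedDisc]

theorem cumulantSeries_congr {r r' : ℕ → ℝ} (h : ∀ n, 1 ≤ n → r n = r' n) :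
    cumulantSeries r 0 = cumulantSeries r' 0 := by
  ext n
  rw [cumulantSeries, cumulantSeries, PowerSeries.coeff_mk, PowerSeries.coeff_mk]
  split_ifs with hn
  · rfl
  · rw [add_zero]; exact h n (Nat.one_le_iff_ne_zero.2 hn)

theorem eq_of_cumulantSeries_eq {r r' : ℕ → ℝ} (h : cumulantSeries r 0 = cumulantSeries r' 0)
    {n : ℕ} (hn : 1 ≤ n) : r n = r' n := by
  have := congrArg (PowerSeries.coeff n) h
  rw [cumulantSeries, cumulantSeries, PowerSeries.coeff_mk, PowerSeries.coeff_mk,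
    if_neg (by omega), if_neg (by omega)] at this
  exact this

theorem discSeries_zero_eq (r : ℕ → ℝ) :
    discSeries r 0 = 1 + (cumulantSeries r 0).subst (PowerSeries.X * discSeries r 0) := by
  have := discSeries_eq_subst r 0
  rwa [if_pos rfl] at this

/-- A moment sequence satisfying the functional equation has the given free cumulants. -/
theorem freeCumulantSeq_eq_of_functional_eq {m r : ℕ → ℝ} (h0 : m 0 = 1)
    (h : PowerSeries.mk m = 1 + (cumulantSeries r 0).subst (PowerSeries.X * PowerSeries.mk m))
    {n : ℕ} (hn : 1 ≤ n) : freeCumulantSeq m n = r n := by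
  refine eq_of_cumulantSeries_eq ?_ hn
  have h1 := discSeries_zero_eq (freeCumulantSeq m)
  rw [← mk_eq_discSeries_freeCumulantSeq h0] at h1
  refine subst_X_mul_injective (M := PowerSeries.mk m) (by
    rw [← PowerSeries.coeff_zero_eq_constantCoeff_apply, PowerSeries.coeff_mk, h0]) ?_
  exact add_left_cancel (h1.symm.trans h)

end FreeCumulants

/-! ### Sums over all set partitions -/

section Partitions

variable {α : Type} [DecidableEq α]

theorem sum_partitionsOf_eq_sum_block {S : Finset α} {a : α} (ha : a ∈ S)
    (F : Finset (Finset α) → ℝ) :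
    ∑ P ∈ partitionsOf S, F P = ∑ T ∈ (S.erase a).powerset,
      ∑ P ∈ partitionsOf (S \ insert a T), F (insert (insert a T) P) := by
  classical
  rw [Finset.sum_sigma']
  symm
  refine Finset.sum_bij (fun x _ => insert (insert a x.1) x.2) ?_ ?_ ?_ ?_
  · rintro ⟨T, P⟩ h
    rw [Finset.mem_sigma, Finset.mem_powerset, mem_partitionsOf] at h
    refine mem_partitionsOf.2 (h.2.insert ?_ (Finset.insert_nonempty _ _))
    exact Finset.insert_subset ha (h.1.trans (Finset.erase_subset _ _))
  · rintro ⟨T, P⟩ h ⟨T', P'⟩ h' heq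
    rw [Finset.mem_sigma, Finset.mem_powerset, mem_partitionsOf] at h h'
    simp only at h h' heq
    have hp := h'.2.insert (Finset.insert_subset ha (h'.1.trans (Finset.erase_subset _ _)))
      (Finset.insert_nonempty _ _)
    have hTT : insert a T = insert a T' :=
      hp.eq_of_mem _ (heq ▸ Finset.mem_insert_self _ _) _ (Finset.mem_insert_self _ _) a
        (Finset.mem_insert_self _ _) (Finset.mem_insert_self _ _)
    have hT : T = T' := by
      rw [← Finset.erase_insert (fun h1 => Finset.notMem_erase a S (h.1 h1)), hTT,
        Finset.erase_insert (fun h1 => Finset.notMem_erase a S (h'.1 h1))]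
    subst hT
    have hP : P = P' := by
      rw [← Finset.erase_insert (h.2.notMem_of_sdiff (Finset.insert_nonempty _ _)), heq,
        Finset.erase_insert (h'.2.notMem_of_sdiff (Finset.insert_nonempty _ _))]
    rw [hP]
  · intro P hP
    rw [mem_partitionsOf] at hP
    obtain ⟨V, hV, haV⟩ := hP.cover a ha
    refine ⟨⟨V.erase a, P.erase V⟩, ?_, ?_⟩
    · rw [Finset.mem_sigma, Finset.mem_powerset, mem_partitionsOf]
      refine ⟨Finset.erase_subset_erase _ (hP.subset V hV), ?_⟩
      rw [Finset.insert_erase haV]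
      exact hP.erase hV
    · simp only
      rw [Finset.insert_erase haV, Finset.insert_erase hV]
  · intro _ _
    rfl

/-- The solution of the recursion for the sums over set partitions. -/
noncomputable def blockSum (f : ℕ → ℝ) : ℕ → (ℕ → ℝ) → ℝ
  -- The sequence `c` weights the number of blocks; each block removed shifts it by one.
  | 0, c => c 0
  | n + 1, c => ∑ j : Fin (n + 1), (n.choose j : ℝ) * (f (j + 1) *
      blockSum f (n - j) (fun i => c (i + 1)))

theorem blockSum_succ (f c : ℕ → ℝ) (n : ℕ) : blockSum f (n + 1) c =
    ∑ j ∈ Finset.range (n + 1), (n.choose j : ℝ) * (f (j + 1) *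
      blockSum f (n - j) (fun i => c (i + 1))) := by
  rw [blockSum, Finset.sum_range]

theorem sum_partitionsOf_eq_blockSum (f : ℕ → ℝ) (n : ℕ) : ∀ (c : ℕ → ℝ) (S : Finset α),
    S.card = n → ∑ P ∈ partitionsOf S, c P.card * ∏ B ∈ P, f B.card = blockSum f n c := by
  induction n using Nat.strong_induction_on with
  | _ n ih =>
    intro c S hS
    rcases n with _ | n
    · rw [Finset.card_eq_zero] at hS
      simp [hS, partitionsOf_empty, blockSum]
    · obtain ⟨a, ha⟩ : S.Nonempty := Finset.card_pos.1 (by omega)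
      have hcard : (S.erase a).card = n := by rw [Finset.card_erase_of_mem ha, hS]; rfl
      rw [sum_partitionsOf_eq_sum_block ha, blockSum_succ]
      have : ∀ T ∈ (S.erase a).powerset, ∑ P ∈ partitionsOf (S \ insert a T),
          c (insert (insert a T) P).card * ∏ B ∈ insert (insert a T) P, f B.card =
          f (T.card + 1) * blockSum f (n - T.card) (fun i => c (i + 1)) := by
        intro T hT
        rw [Finset.mem_powerset] at hT
        have haT : a ∉ T := fun h1 => Finset.notMem_erase a S (hT h1)
        have hsub : insert a T ⊆ S := Finset.insert_subset ha (hT.trans (Finset.erase_subset _ _))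
        have hTc := Finset.card_le_card hT
        have hc : (S \ insert a T).card = n - T.card := by
          rw [Finset.card_sdiff_of_subset hsub, Finset.card_insert_of_notMem haT, hS]
          omega
        rw [← ih (n - T.card) (by omega) _ _ hc, Finset.mul_sum]
        refine Finset.sum_congr rfl fun P hP => ?_
        have hP' := (mem_partitionsOf.1 hP).notMem_of_sdiff (Finset.insert_nonempty _ _)
        rw [Finset.card_insert_of_notMem hP', Finset.prod_insert hP',
          Finset.card_insert_of_notMem haT]
        ring
      rw [Finset.sum_congr rfl this, Finset.sum_powerset_apply_card
        (fun j => f (j + 1) * blockSum f (n - j) fun i => c (i + 1)), hcard]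
      simp only [nsmul_eq_mul]

end Partitions

/-! ### Exponential generating functions and the logarithm -/

section Exponential

/-- The exponential generating function of a sequence. -/
noncomputable def expSeries (f : ℕ → ℝ) : PowerSeries ℝ :=
  PowerSeries.mk fun n => f n / (n.factorial : ℝ)

theorem expSeries_mul (f g : ℕ → ℝ) : expSeries f * expSeries g =
    expSeries fun k => ∑ i ∈ Finset.range (k + 1), (k.choose i : ℝ) * f i * g (k - i) := by
  ext n
  rw [PowerSeries.coeff_mul, Finset.Nat.sum_antidiagonal_eq_sum_range_succ_mk, expSeries,
    expSeries, expSeries, PowerSeries.coeff_mk, Finset.sum_div]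
  refine Finset.sum_congr rfl fun i hi => ?_
  have hi' : i ≤ n := Nat.lt_succ_iff.1 (Finset.mem_range.1 hi)
  rw [PowerSeries.coeff_mk, PowerSeries.coeff_mk, Nat.cast_choose ℝ hi']
  have h1 : (n.factorial : ℝ) ≠ 0 := Nat.cast_ne_zero.2 n.factorial_ne_zero
  have h2 : (i.factorial : ℝ) ≠ 0 := Nat.cast_ne_zero.2 i.factorial_ne_zero
  have h3 : ((n - i).factorial : ℝ) ≠ 0 := Nat.cast_ne_zero.2 (n - i).factorial_ne_zero
  field_simp

theorem derivative_expSeries (f : ℕ → ℝ) :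
    PowerSeries.derivative ℝ (expSeries f) = expSeries fun n => f (n + 1) := by
  ext n
  rw [PowerSeries.coeff_derivative, expSeries, expSeries, PowerSeries.coeff_mk,
    PowerSeries.coeff_mk, Nat.factorial_succ]
  have h1 : (n.factorial : ℝ) ≠ 0 := Nat.cast_ne_zero.2 n.factorial_ne_zero
  have h2 : ((n : ℝ) + 1) ≠ 0 := by positivity
  push_cast
  field_simp

theorem expSeries_injective {f g : ℕ → ℝ} (h : expSeries f = expSeries g) : f = g := by
  ext n
  have := congrArg (PowerSeries.coeff n) h
  rw [expSeries, expSeries, PowerSeries.coeff_mk, PowerSeries.coeff_mk] at this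
  have h1 : (n.factorial : ℝ) ≠ 0 := Nat.cast_ne_zero.2 n.factorial_ne_zero
  exact (div_left_inj' h1).1 this

theorem constantCoeff_expSeries (f : ℕ → ℝ) : PowerSeries.constantCoeff (expSeries f) = f 0 := by
  rw [← PowerSeries.coeff_zero_eq_constantCoeff_apply, expSeries, PowerSeries.coeff_mk]
  simp

theorem derivative_expSeries_blockSum (f c : ℕ → ℝ) :
    PowerSeries.derivative ℝ (expSeries fun n => blockSum f n c) =
      PowerSeries.derivative ℝ (expSeries f) *
        expSeries fun n => blockSum f n fun i => c (i + 1) := by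
  rw [derivative_expSeries, derivative_expSeries, expSeries_mul]
  congr 1
  ext n
  rw [blockSum_succ]
  exact Finset.sum_congr rfl fun i _ => (mul_assoc _ _ _).symm

/-- A coefficient of `F s` is determined by lower coefficients of `F (s + 1)`, so the induction on
the order has to treat all `s` at once. -/
theorem eq_of_derivative_eq_mul {D : PowerSeries ℝ} {F G : ℕ → PowerSeries ℝ}
    (hF : ∀ s, PowerSeries.derivative ℝ (F s) = D * F (s + 1))
    (hG : ∀ s, PowerSeries.derivative ℝ (G s) = D * G (s + 1))
    (h0 : ∀ s, PowerSeries.constantCoeff (F s) = PowerSeries.constantCoeff (G s)) (s : ℕ) :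
    F s = G s := by
  have key : ∀ n s, PowerSeries.coeff n (F s) = PowerSeries.coeff n (G s) := by
    intro n
    induction n using Nat.strong_induction_on with
    | _ n ih =>
      intro s
      rcases n with _ | n
      · simpa only [PowerSeries.coeff_zero_eq_constantCoeff_apply] using h0 s
      · have h1 := congrArg (PowerSeries.coeff n) (hF s)
        have h2 := congrArg (PowerSeries.coeff n) (hG s)
        rw [PowerSeries.coeff_derivative, PowerSeries.coeff_mul] at h1 h2
        have h3 : ((n : ℝ) + 1) ≠ 0 := by positivity
        refine mul_right_cancel₀ h3 ?_
        rw [h1, h2]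
        refine Finset.sum_congr rfl fun p hp => ?_
        rw [ih p.2 (by
          have := Finset.HasAntidiagonal.mem_antidiagonal.1 hp
          omega)]
  ext n
  exact key n s

/-- The coefficients of the logarithm in the moment-cumulant formula. -/
noncomputable def logCoeff (m : ℕ) : ℝ := (-1) ^ (m - 1) * ((m - 1).factorial : ℝ)

/-- This is `E (log E)' = E'` for `E = expSeries f`. Differentiation removes a block and shifts the
weights, so the proof passes to the whole family of shifts, with values `(-1)ˢ s! E^{-(s+1)}`, the
successive derivatives of the logarithm at `E`. -/
theorem expSeries_mul_derivative_blockSum (f : ℕ → ℝ) (hf : f 0 = 1) :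
    expSeries f * PowerSeries.derivative ℝ (expSeries fun n => blockSum f n logCoeff) =
      PowerSeries.derivative ℝ (expSeries f) := by
  have hE : PowerSeries.constantCoeff (expSeries f) ≠ 0 := by
    rw [constantCoeff_expSeries, hf]; exact one_ne_zero
  have key := eq_of_derivative_eq_mul (D := PowerSeries.derivative ℝ (expSeries f))
    (F := fun s => expSeries fun n => blockSum f n fun i => logCoeff (i + (s + 1)))
    (G := fun s => PowerSeries.C (logCoeff (s + 1)) * ((expSeries f)⁻¹) ^ (s + 1))
    (fun s => by
      rw [derivative_expSeries_blockSum]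
      congr 3
      ext n
      congr 1
      ext i
      congr 1
      ring)
    (fun s => by
      rw [Derivation.leibniz, Derivation.leibniz_pow, PowerSeries.derivative_inv',
        PowerSeries.derivative_C]
      have : logCoeff (s + 1 + 1) = -((s : ℝ) + 1) * logCoeff (s + 1) := by
        simp only [logCoeff, Nat.add_sub_cancel, Nat.factorial_succ, pow_succ]
        push_cast
        ring
      rw [this]
      simp only [smul_eq_mul, nsmul_eq_mul, mul_zero, add_zero, Nat.add_sub_cancel, map_mul,
        map_neg, map_add, map_one, map_natCast, Nat.cast_add, Nat.cast_one]
      ring)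
    (fun s => by
      rw [constantCoeff_expSeries, map_mul, map_pow, PowerSeries.constantCoeff_inv,
        constantCoeff_expSeries, hf, blockSum]
      simp) 0
  rw [derivative_expSeries_blockSum]
  have h1 : (expSeries fun n => blockSum f n fun i => logCoeff (i + 1)) = (expSeries f)⁻¹ := by
    refine key.trans ?_
    simp [logCoeff]
  rw [h1, mul_left_comm, PowerSeries.mul_inv_cancel _ hE, mul_one]

/-- The recursion between moments and cumulants. -/
theorem sum_choose_mul_blockSum (f : ℕ → ℝ) (hf : f 0 = 1) (n : ℕ) :
    f (n + 1) = ∑ j ∈ Finset.range (n + 1),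
      (n.choose j : ℝ) * blockSum f (j + 1) logCoeff * f (n - j) := by
  have h := expSeries_mul_derivative_blockSum f hf
  rw [mul_comm, derivative_expSeries, derivative_expSeries, expSeries_mul] at h
  exact (congrFun (expSeries_injective h) n).symm

/-- Additivity of the cumulants under binomial convolution. -/
theorem blockSum_logCoeff_add {f g : ℕ → ℝ} (hf : f 0 = 1) (hg : g 0 = 1) (n : ℕ) :
    blockSum (fun k => ∑ i ∈ Finset.range (k + 1), (k.choose i : ℝ) * f i * g (k - i))
        (n + 1) logCoeff =
      blockSum f (n + 1) logCoeff + blockSum g (n + 1) logCoeff := by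
  set h : ℕ → ℝ := fun k => ∑ i ∈ Finset.range (k + 1), (k.choose i : ℝ) * f i * g (k - i)
    with hdef
  have hh : h 0 = 1 := by simp [hdef, hf, hg]
  have hmul : expSeries h = expSeries f * expSeries g := (expSeries_mul f g).symm
  have e1 := expSeries_mul_derivative_blockSum f hf
  have e2 := expSeries_mul_derivative_blockSum g hg
  have e3 := expSeries_mul_derivative_blockSum h hh
  have hne : expSeries h ≠ 0 := fun h0 => by
    have := constantCoeff_expSeries h
    rw [h0, map_zero, hh] at this
    exact zero_ne_one this
  have key : PowerSeries.derivative ℝ (expSeries fun n => blockSum h n logCoeff) =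
      PowerSeries.derivative ℝ (expSeries fun n => blockSum f n logCoeff) +
      PowerSeries.derivative ℝ (expSeries fun n => blockSum g n logCoeff) := by
    refine mul_left_cancel₀ hne ?_
    rw [e3, hmul, Derivation.leibniz, mul_add, smul_eq_mul, smul_eq_mul, ← e1, ← e2]
    ring
  have := congrArg (PowerSeries.coeff n) key
  rw [derivative_expSeries, derivative_expSeries, derivative_expSeries, map_add] at this
  simp only [expSeries, PowerSeries.coeff_mk] at this
  rw [← add_div] at this
  exact (div_left_inj' (Nat.cast_ne_zero.2 n.factorial_ne_zero)).1 this

end Exponential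

/-! ### Additivity of finite free cumulants -/

section FiniteCumulants

theorem finiteCumulant_eq_blockSum (d n : ℕ) (p : ℝ[X]) {e : ℕ → ℝ}
    (he : ∀ k ≤ n, coef d k p = e k) :
    finiteCumulant d n p = (-(d : ℝ)) ^ (n - 1) / ((n - 1).factorial : ℝ) *
      blockSum e n logCoeff := by
  classical
  rw [finiteCumulant, ← sum_partitionsOf_eq_blockSum e n logCoeff
    (Finset.univ : Finset (Fin n)) (by simp)]
  congr 1
  have h1 := sum_finpartition_eq_sum_partitionsOf (Finset.univ : Finset (SetPartition n))
    (fun _ => True) (fun _ => by simp)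
    fun P => logCoeff P.card * ∏ V ∈ P, coef d V.card p
  rw [Finset.filter_true] at h1
  refine h1.trans (Finset.sum_congr rfl fun P _ => ?_)
  congr 1
  refine Finset.prod_congr rfl fun V _ => he _ ?_
  simpa using Finset.card_le_univ V

theorem coef_zero {d : ℕ} {p : ℝ[X]} (hp : p ∈ realRooted d) : coef d 0 p = 1 := by
  have : p.coeff d = 1 := by
    have := hp.1.coeff_natDegree
    rwa [hp.2.1] at this
  simp [coef, this]

theorem coeff_finiteFreeAdd {d k : ℕ} (hk : k ≤ d) (p q : ℝ[X]) :
    (finiteFreeAdd d p q).coeff (d - k) = (-1) ^ k * (d.choose k : ℝ) *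
      ∑ i ∈ Finset.range (k + 1), (k.choose i : ℝ) * coef d i p * coef d (k - i) q := by
  rw [finiteFreeAdd, Polynomial.finsetSum_coeff, Finset.sum_eq_single k]
  · rw [Polynomial.coeff_C_mul_X_pow, if_pos rfl]
  · intro j hj hjk
    rw [Polynomial.coeff_C_mul_X_pow, if_neg]
    have := Finset.mem_range.1 hj
    omega
  · intro h
    exact absurd (Finset.mem_range.2 (Nat.lt_succ_of_le hk)) h

theorem coef_finiteFreeAdd {d k : ℕ} (hk : k ≤ d) (p q : ℝ[X]) :
    coef d k (finiteFreeAdd d p q) =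
      ∑ i ∈ Finset.range (k + 1), (k.choose i : ℝ) * coef d i p * coef d (k - i) q := by
  have h1 : (d.choose k : ℝ) ≠ 0 := Nat.cast_ne_zero.2 (Nat.choose_pos hk).ne'
  have h2 : ((-1 : ℝ) ^ k) * (-1) ^ k = 1 := by rw [← mul_pow]; simp
  rw [coef, coeff_finiteFreeAdd hk, div_eq_iff h1, mul_assoc, ← mul_assoc, h2, one_mul, mul_comm]

/-- On normalized coefficients the convolution is binomial convolution, that is, multiplication of
exponential generating functions, and cumulants are logarithmic coefficients. The cumulant of order
`n ≤ d` involves only the `e_k` with `k ≤ d`, where this holds. -/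
theorem finiteCumulant_finiteFreeAdd {d n : ℕ} (hn : 1 ≤ n) (hd : n ≤ d) {p q : ℝ[X]}
    (hp : p ∈ realRooted d) (hq : q ∈ realRooted d) :
    finiteCumulant d n (finiteFreeAdd d p q) = finiteCumulant d n p + finiteCumulant d n q := by
  obtain ⟨n, rfl⟩ := Nat.exists_eq_succ_of_ne_zero (by omega : n ≠ 0)
  rw [finiteCumulant_eq_blockSum d _ _ (fun k hk => coef_finiteFreeAdd (hk.trans hd) p q),
    blockSum_logCoeff_add (f := fun k => coef d k p) (g := fun k => coef d k q)
      (coef_zero hp) (coef_zero hq),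
    finiteCumulant_eq_blockSum d _ p (fun _ _ => rfl),
    finiteCumulant_eq_blockSum d _ q (fun _ _ => rfl), mul_add]

end FiniteCumulants

/-! ### Apolarity and Grace's theorem for a half-plane -/

section Apolar

/-- The apolar pairing of polynomials of degree at most `d`. -/
noncomputable def apolar (d : ℕ) (f g : ℂ[X]) : ℂ :=
  ∑ k ∈ Finset.range (d + 1), f.coeff k * g.coeff (d - k) / (d.choose k : ℂ)

/-- The polar derivative of a polynomial of degree `d` with respect to the point `w`. -/
noncomputable def polarDeriv (d : ℕ) (w : ℂ) (f : ℂ[X]) : ℂ[X] :=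
  C (d : ℂ) * f + (C w - X) * derivative f

theorem coeff_polarDeriv (d : ℕ) (w : ℂ) (f : ℂ[X]) (k : ℕ) : (polarDeriv d w f).coeff k =
    ((d : ℂ) - k) * f.coeff k + w * ((k : ℂ) + 1) * f.coeff (k + 1) := by
  rw [polarDeriv, sub_mul, Polynomial.coeff_add, Polynomial.coeff_sub, Polynomial.coeff_C_mul,
    Polynomial.coeff_C_mul, Polynomial.coeff_derivative]
  rcases k with _ | k
  · simp
  · rw [Polynomial.coeff_X_mul, Polynomial.coeff_derivative]
    push_cast
    ring

/-- Splitting off a linear factor on one side is a polar derivative on the other, which permits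
induction on the roots. The point is `-b` because the pairing omits the alternating signs of the
classical apolar form. -/
theorem apolar_mul_X_sub_C (d : ℕ) (f g : ℂ[X]) (b : ℂ) (hg : g.natDegree ≤ d) :
    ((d : ℂ) + 1) * apolar (d + 1) f ((X - C b) * g) = apolar d (polarDeriv (d + 1) (-b) f) g := by
  have hcoef : ∀ k ∈ Finset.range (d + 1),
      ((X - C b) * g).coeff (d + 1 - k) = g.coeff (d - k) - b * g.coeff (d + 1 - k) := by
    intro k hk
    have : d + 1 - k = (d - k) + 1 := by have := Finset.mem_range.1 hk; omega
    rw [this, sub_mul, Polynomial.coeff_sub, Polynomial.coeff_X_mul, Polynomial.coeff_C_mul]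
  have h0 : ((X - C b) * g).coeff 0 = - b * g.coeff 0 := by
    rw [sub_mul, Polynomial.coeff_sub, Polynomial.coeff_C_mul]
    simp
  have e1 : apolar (d + 1) f ((X - C b) * g) =
      ∑ k ∈ Finset.range (d + 1), f.coeff k * g.coeff (d - k) / ((d + 1).choose k : ℂ) -
      ∑ k ∈ Finset.range (d + 2), b * f.coeff k * g.coeff (d + 1 - k) /
        ((d + 1).choose k : ℂ) := by
    rw [apolar, Finset.sum_range_succ, Finset.sum_range_succ _ (d + 1), Finset.sum_congr rfl
      (fun k hk => by rw [hcoef k hk]), Nat.sub_self, h0]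
    have : ∀ k, f.coeff k * (g.coeff (d - k) - b * g.coeff (d + 1 - k)) /
        ((d + 1).choose k : ℂ) = f.coeff k * g.coeff (d - k) / ((d + 1).choose k : ℂ) -
        b * f.coeff k * g.coeff (d + 1 - k) / ((d + 1).choose k : ℂ) := fun k => by ring
    rw [Finset.sum_congr rfl fun k _ => this k, Finset.sum_sub_distrib]
    ring
  have h1 : g.coeff (d + 1) = 0 := Polynomial.coeff_eq_zero_of_natDegree_lt (by omega)
  rw [e1, Finset.sum_range_succ' _ (d + 1), Nat.sub_zero, h1, mul_zero, zero_div, add_zero,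
    ← Finset.sum_sub_distrib, Finset.mul_sum, apolar]
  refine Finset.sum_congr rfl fun k hk => ?_
  have hk' : k ≤ d := Nat.lt_succ_iff.1 (Finset.mem_range.1 hk)
  rw [coeff_polarDeriv, Nat.add_sub_add_right]
  have c1 : (d.choose k : ℂ) ≠ 0 := Nat.cast_ne_zero.2 (Nat.choose_pos hk').ne'
  have c2 : ((d + 1).choose k : ℂ) ≠ 0 := Nat.cast_ne_zero.2 (Nat.choose_pos (by omega)).ne'
  have c3 : ((d + 1).choose (k + 1) : ℂ) ≠ 0 :=
    Nat.cast_ne_zero.2 (Nat.choose_pos (by omega)).ne'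
  have i1 : ((d + 1).choose (k + 1) : ℂ) * ((k : ℂ) + 1) = ((d : ℂ) + 1) * (d.choose k : ℂ) := by
    exact_mod_cast (Nat.add_one_mul_choose_eq d k).symm
  have i2 : ((d + 1).choose k : ℂ) * ((d : ℂ) + 1 - k) = ((d : ℂ) + 1) * (d.choose k : ℂ) := by
    have := Nat.choose_mul_succ_eq d k
    have h2 : ((d : ℂ) + 1 - k) = ((d + 1 - k : ℕ) : ℂ) := by
      rw [Nat.cast_sub (by omega)]; push_cast; rfl
    rw [h2]
    have h3 : (d + 1).choose k * (d + 1 - k) = (d + 1) * d.choose k := by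
      rw [← this, mul_comm]
    exact_mod_cast h3
  have j1 : ((d : ℂ) + 1) / ((d + 1).choose (k + 1) : ℂ) = ((k : ℂ) + 1) / (d.choose k : ℂ) := by
    rw [div_eq_div_iff c3 c1, ← i1]; ring
  have j2 : ((d : ℂ) + 1) / ((d + 1).choose k : ℂ) = ((d : ℂ) + 1 - k) / (d.choose k : ℂ) := by
    rw [div_eq_div_iff c2 c1, ← i2]; ring
  calc _ = ((d : ℂ) + 1) / ((d + 1).choose k : ℂ) * (f.coeff k * g.coeff (d - k)) -
        ((d : ℂ) + 1) / ((d + 1).choose (k + 1) : ℂ) *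
          (b * f.coeff (k + 1) * g.coeff (d - k)) := by ring
    _ = _ := by rw [j1, j2]; push_cast; ring

/-- The image of a point of the lower half-plane under a Möbius map of pole in the closed upper
half-plane. -/
theorem im_mul_div_neg {w x a : ℂ} (hw : w.im = 0) (hx : 0 ≤ x.im) (ha : a.im < 0)
    (hne : w ≠ x) : ((w - x) * ((w - a) / (x - a))).im < 0 := by
  have h1 : w - x ≠ 0 := sub_ne_zero.2 hne
  have h2 : w - a ≠ 0 := fun h => by
    have := congrArg Complex.im h
    rw [Complex.sub_im, Complex.zero_im] at this
    linarith
  have h3 : x - a ≠ 0 := fun h => by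
    have := congrArg Complex.im h
    rw [Complex.sub_im, Complex.zero_im] at this
    linarith
  -- As `x - a = (w - a) - (w - x)`, the expression is the inverse of a difference of inverses, and
  -- the signs of their imaginary parts are evident.
  have e : (w - x) * ((w - a) / (x - a)) = ((w - x)⁻¹ - (w - a)⁻¹)⁻¹ := by
    rw [inv_sub_inv h1 h2, inv_div]
    have : w - a - (w - x) = x - a := by ring
    rw [this]
    ring
  have hpos : 0 < ((w - x)⁻¹ - (w - a)⁻¹).im := by
    rw [Complex.sub_im, Complex.inv_im, Complex.inv_im, Complex.sub_im, Complex.sub_im, hw]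
    have p1 : 0 ≤ -(0 - x.im) / Complex.normSq (w - x) :=
      div_nonneg (by linarith) (Complex.normSq_nonneg _)
    have p2 : -(0 - a.im) / Complex.normSq (w - a) < 0 :=
      div_neg_of_neg_of_pos (by linarith) (Complex.normSq_pos.2 h2)
    linarith
  rw [e, Complex.inv_im]
  refine div_neg_of_neg_of_pos (by linarith) (Complex.normSq_pos.2 fun h => ?_)
  rw [h] at hpos
  exact lt_irrefl _ hpos

theorem multiset_sum_im_neg {s : Multiset ℂ} (hs : s ≠ 0) (h : ∀ a ∈ s, a.im < 0) :
    s.sum.im < 0 := by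
  induction s using Multiset.induction_on with
  | empty => exact absurd rfl hs
  | cons a s ih =>
    rw [Multiset.sum_cons, Complex.add_im]
    have ha := h a (Multiset.mem_cons_self a s)
    by_cases h0 : s = 0
    · simpa [h0] using ha
    · have := ih h0 fun b hb => h b (Multiset.mem_cons_of_mem hb)
      linarith

/-- Laguerre's theorem for the lower half-plane. -/
theorem im_root_polarDeriv_neg {d : ℕ} (hd : d ≠ 0) {w : ℂ} (hw : w.im = 0) {f : ℂ[X]}
    (hf : f.natDegree = d) (hroot : ∀ a ∈ f.roots, a.im < 0) {x : ℂ}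
    (hx : (polarDeriv d w f).eval x = 0) : x.im < 0 := by
  by_contra hxim
  push Not at hxim
  have hf0 : f ≠ 0 := fun h => hd (by rw [← hf, h, Polynomial.natDegree_zero])
  have hfx : f.eval x ≠ 0 := fun h =>
    absurd (hroot x ((Polynomial.mem_roots hf0).2 h)) (not_lt.2 hxim)
  have hsplit := IsAlgClosed.splits f
  have hcard : f.roots.card = d := by rw [← hf]; exact hsplit.natDegree_eq_card_roots.symm
  have hdiv := hsplit.eval_derivative_div_eval_of_ne_zero hfx
  rw [polarDeriv, Polynomial.eval_add, Polynomial.eval_mul, Polynomial.eval_mul,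
    Polynomial.eval_sub, Polynomial.eval_C, Polynomial.eval_C, Polynomial.eval_X] at hx
  have hzero : (d : ℂ) + (w - x) * (f.derivative.eval x / f.eval x) = 0 := by
    have : (d : ℂ) + (w - x) * (f.derivative.eval x / f.eval x) =
        ((d : ℂ) * f.eval x + (w - x) * f.derivative.eval x) / f.eval x := by
      field_simp
    rw [this, hx, zero_div]
  by_cases hne : w = x
  · rw [hne, sub_self, zero_mul, add_zero] at hzero
    exact hd (Nat.cast_eq_zero.1 hzero)
  -- Each root contributes `1 + (w - x) / (x - a) = (w - a) / (x - a)`. The extra factor `w - x`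
  -- brings all summands into the open lower half-plane, where a nonempty sum cannot vanish.
  · have hsum : (f.roots.map fun a => (w - x) * ((w - a) / (x - a))).sum = 0 := by
      rw [Multiset.sum_map_mul_left]
      have : (f.roots.map fun a => (w - a) / (x - a)) =
          f.roots.map fun a => 1 + (w - x) * (1 / (x - a)) := by
        refine Multiset.map_congr rfl fun a ha => ?_
        have h3 : x - a ≠ 0 := fun h => by
          have := congrArg Complex.im h
          rw [Complex.sub_im, Complex.zero_im] at this
          have := hroot a ha
          linarith
        field_simp
        ring
      rw [this, Multiset.sum_map_add, Multiset.sum_map_mul_left, ← hdiv]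
      simp [hcard, hzero]
    have hneg : (f.roots.map fun a => (w - x) * ((w - a) / (x - a))).sum.im < 0 := by
      refine multiset_sum_im_neg (fun h => ?_) fun b hb => ?_
      · rw [Multiset.map_eq_zero] at h
        rw [h, Multiset.card_zero] at hcard
        exact hd hcard.symm
      · obtain ⟨a, ha, rfl⟩ := Multiset.mem_map.1 hb
        exact im_mul_div_neg hw hxim (hroot a ha) hne
    rw [hsum] at hneg
    exact lt_irrefl _ hneg

/-- The degree drops by exactly one: the new leading coefficient is that of `f` times `(d + 1) w`
minus the sum of the roots, which is not real. -/
theorem natDegree_polarDeriv {d : ℕ} {w : ℂ} (hw : w.im = 0) {f : ℂ[X]}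
    (hf : f.natDegree = d + 1) (hroot : ∀ a ∈ f.roots, a.im < 0) :
    (polarDeriv (d + 1) w f).natDegree = d := by
  refine Polynomial.natDegree_eq_of_le_of_coeff_ne_zero ?_ ?_
  · refine Polynomial.natDegree_le_iff_coeff_eq_zero.2 fun k hk => ?_
    rw [coeff_polarDeriv, Polynomial.coeff_eq_zero_of_natDegree_lt (n := k + 1) (by omega),
      mul_zero, add_zero]
    rcases eq_or_ne k (d + 1) with rfl | h
    · simp
    · rw [Polynomial.coeff_eq_zero_of_natDegree_lt (n := k) (by omega), mul_zero]
  · have hsplit := IsAlgClosed.splits f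
    have hcard : f.roots.card = d + 1 := by rw [← hf]; exact hsplit.natDegree_eq_card_roots.symm
    have hnext := hsplit.nextCoeff_eq_neg_sum_roots_mul_leadingCoeff
    rw [Polynomial.nextCoeff_of_natDegree_pos (by omega), Polynomial.leadingCoeff, hf,
      Nat.add_sub_cancel] at hnext
    rw [coeff_polarDeriv, hnext]
    have hlead : f.coeff (d + 1) ≠ 0 := by
      rw [← hf]
      refine Polynomial.leadingCoeff_ne_zero.2 fun h => ?_
      rw [h, Polynomial.natDegree_zero] at hf
      omega
    have him : f.roots.sum.im < 0 := multiset_sum_im_neg (fun h => by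
      rw [h, Multiset.card_zero] at hcard
      omega) hroot
    have e : (((d + 1 : ℕ) : ℂ) - d) * (-f.coeff (d + 1) * f.roots.sum) +
        w * ((d : ℂ) + 1) * f.coeff (d + 1) =
        f.coeff (d + 1) * (w * ((d : ℂ) + 1) - f.roots.sum) := by
      push_cast; ring
    intro h
    have h' : f.coeff (d + 1) * (w * ((d : ℂ) + 1) - f.roots.sum) = 0 := by
      rw [← e, ← h]
    have := congrArg Complex.im ((mul_eq_zero.1 h').resolve_left hlead)
    rw [Complex.sub_im, Complex.mul_im, hw] at this
    simp at this
    linarith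

/-- A form of Grace's theorem: no polynomial with all roots in the open lower half-plane is
apolar to a polynomial with real roots. -/
theorem apolar_ne_zero (s : Multiset ℂ) (hs : ∀ b ∈ s, b.im = 0) : ∀ f : ℂ[X], f ≠ 0 →
    f.natDegree = s.card → (∀ a ∈ f.roots, a.im < 0) →
    apolar s.card f (s.map fun b => X - C b).prod ≠ 0 := by
  induction s using Multiset.induction_on with
  | empty =>
    intro f hf hd _
    rw [Multiset.card_zero] at hd
    have h0 : f.coeff 0 ≠ 0 := fun h => hf (by
      rw [Polynomial.eq_C_of_natDegree_eq_zero hd, h, Polynomial.C_0])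
    simpa [apolar] using h0
  | cons b s ih =>
    intro f hf hd hroot h
    rw [Multiset.card_cons] at hd h
    rw [Multiset.map_cons, Multiset.prod_cons] at h
    have hb := hs b (Multiset.mem_cons_self b s)
    have hw : (-b).im = 0 := by rw [Complex.neg_im, hb, neg_zero]
    have hg : (s.map fun b => X - C b).prod.natDegree ≤ s.card := by
      rw [Polynomial.natDegree_multiset_prod_X_sub_C_eq_card]
    have h1 := apolar_mul_X_sub_C s.card f _ b hg
    rw [h, mul_zero] at h1
    have hdeg := natDegree_polarDeriv hw hd hroot
    -- The zero polynomial would vanish at `0`, which is not in the open lower half-plane.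
    have hne : polarDeriv (s.card + 1) (-b) f ≠ 0 := fun h0 => by
      have : (polarDeriv (s.card + 1) (-b) f).eval 0 = 0 := by rw [h0, Polynomial.eval_zero]
      have := im_root_polarDeriv_neg (Nat.succ_ne_zero _) hw hd hroot this
      simp at this
    exact ih (fun c hc => hs c (Multiset.mem_cons_of_mem hc)) _ hne hdeg
      (fun a ha => im_root_polarDeriv_neg (Nat.succ_ne_zero _) hw hd hroot
        ((Polynomial.mem_roots hne).1 ha)) h1.symm

end Apolar

/-! ### Real-rootedness of the convolution -/

section RealRooted

/-- Brings Grace's theorem to bear: for `z` in the upper half-plane the translate of a real-rooted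
`p` has all its roots in the lower one. The identity follows by expanding the Taylor coefficients
and summing over the triangle in the other order. -/
theorem eval_map_finiteFreeAdd (d : ℕ) {p q : ℝ[X]} (hp : p.natDegree ≤ d) (z : ℂ) :
    ((finiteFreeAdd d p q).map Complex.ofRealHom).eval z =
      apolar d (taylor z (p.map Complex.ofRealHom)) (q.map Complex.ofRealHom) := by
  have h1 : ∀ k, (taylor z (p.map Complex.ofRealHom)).coeff k =
      ∑ j ∈ Finset.range (d + 1), (j.choose k : ℂ) * p.coeff j * z ^ (j - k) := by
    intro k
    rw [Polynomial.taylor_coeff, Polynomial.hasseDeriv_apply, Polynomial.sum_over_range' _ _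
      (d + 1) (Nat.lt_succ_of_le ((Polynomial.natDegree_map_le).trans hp)),
      Polynomial.eval_finsetSum]
    · refine Finset.sum_congr rfl fun j _ => ?_
      rw [Polynomial.eval_monomial, Polynomial.coeff_map]
      rfl
    · intro n
      simp
  have h2 : ((finiteFreeAdd d p q).map Complex.ofRealHom).eval z =
      ∑ m ∈ Finset.range (d + 1), ∑ i ∈ Finset.range (m + 1),
        (fun i k => ((d - i).choose k : ℂ) * p.coeff (d - i) * z ^ (d - i - k) *
          q.coeff (d - k) / (d.choose k : ℂ)) i (m - i) := by
    rw [finiteFreeAdd, Polynomial.map_sum, Polynomial.eval_finsetSum]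
    refine Finset.sum_congr rfl fun m hm => ?_
    have hm' : m ≤ d := Nat.lt_succ_iff.1 (Finset.mem_range.1 hm)
    rw [Polynomial.map_mul, Polynomial.map_C, Polynomial.map_pow, Polynomial.map_X,
      Polynomial.eval_mul, Polynomial.eval_C, Polynomial.eval_pow, Polynomial.eval_X, map_mul,
      map_sum, Finset.mul_sum, Finset.sum_mul]
    refine Finset.sum_congr rfl fun i hi => ?_
    have hi' : i ≤ m := Nat.lt_succ_iff.1 (Finset.mem_range.1 hi)
    have e1 : d - i - (m - i) = d - m := by omega
    have c1 : (d.choose i : ℂ) ≠ 0 := Nat.cast_ne_zero.2 (Nat.choose_pos (by omega)).ne'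
    have c2 : (d.choose (m - i) : ℂ) ≠ 0 := Nat.cast_ne_zero.2 (Nat.choose_pos (by omega)).ne'
    have i1 : (d.choose m : ℂ) * (m.choose i : ℂ) = d.choose i * (d - i).choose (m - i) := by
      exact_mod_cast Nat.choose_mul hi'
    have i2 : ((-1 : ℂ)) ^ m * ((-1) ^ i * (-1) ^ (m - i)) = 1 := by
      rw [← pow_add, Nat.add_sub_cancel' hi', ← mul_pow]
      simp
    simp only [coef, e1, Complex.ofRealHom_eq_coe]
    push_cast
    calc _ = ((-1 : ℂ) ^ m * ((-1) ^ i * (-1) ^ (m - i))) *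
          ((d.choose m : ℂ) * (m.choose i : ℂ)) * p.coeff (d - i) * q.coeff (d - (m - i)) /
          ((d.choose i : ℂ) * (d.choose (m - i) : ℂ)) * z ^ (d - m) := by ring
      _ = _ := by
        rw [i2, i1]
        field_simp
  rw [h2, Finset.sum_range_diag_flip (d + 1) (fun i k => ((d - i).choose k : ℂ) *
    p.coeff (d - i) * z ^ (d - i - k) * q.coeff (d - k) / (d.choose k : ℂ)), apolar]
  have h3 : ∀ k ∈ Finset.range (d + 1), (taylor z (p.map Complex.ofRealHom)).coeff k *
      (q.map Complex.ofRealHom).coeff (d - k) / (d.choose k : ℂ) =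
      ∑ j ∈ Finset.range (d + 1), (j.choose k : ℂ) * p.coeff j * z ^ (j - k) *
          q.coeff (d - k) / (d.choose k : ℂ) := by
    intro k _
    rw [h1, Finset.sum_mul, Finset.sum_div, Polynomial.coeff_map]
    rfl
  rw [Finset.sum_congr rfl h3, Finset.sum_comm]
  symm
  rw [← Finset.sum_range_reflect]
  refine Finset.sum_congr rfl fun i hi => ?_
  have hi' : i ≤ d := Nat.lt_succ_iff.1 (Finset.mem_range.1 hi)
  have : d + 1 - 1 - i = d - i := by omega
  rw [this]
  symm
  refine Finset.sum_subset (fun x hx => ?_) fun k hk hk' => ?_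
  · rw [Finset.mem_range] at hx ⊢
    omega
  · rw [Finset.mem_range] at hk hk'
    rw [Nat.choose_eq_zero_of_lt (by omega)]
    simp

theorem eval_map_finiteFreeAdd_ne_zero {d : ℕ} {p q : ℝ[X]} (hp : p ∈ realRooted d)
    (hq : q ∈ realRooted d) {z : ℂ} (hz : 0 < z.im) :
    ((finiteFreeAdd d p q).map Complex.ofRealHom).eval z ≠ 0 := by
  rw [eval_map_finiteFreeAdd d hp.2.1.le]
  have hqs : q.map Complex.ofRealHom =
      ((q.roots.map Complex.ofRealHom).map fun b => X - C b).prod := by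
    have := hq.2.2.eq_prod_roots_of_monic hq.1
    conv_lhs => rw [this]
    rw [Polynomial.map_multiset_prod, Multiset.map_map, Multiset.map_map]
    congr 1
    refine Multiset.map_congr rfl fun b _ => ?_
    simp
  have hcard : (q.roots.map Complex.ofRealHom).card = d := by
    rw [Multiset.card_map, ← hq.2.1]
    exact hq.2.2.natDegree_eq_card_roots.symm
  have hp0 : p.map Complex.ofRealHom ≠ 0 := (hp.1.map _).ne_zero
  have hne : taylor z (p.map Complex.ofRealHom) ≠ 0 := fun h =>
    hp0 ((Polynomial.taylor_eq_zero z _).1 h)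
  have := apolar_ne_zero (q.roots.map Complex.ofRealHom) (fun b hb => by
    obtain ⟨c, -, rfl⟩ := Multiset.mem_map.1 hb
    simp) (taylor z (p.map Complex.ofRealHom)) hne (by
      rw [Polynomial.natDegree_taylor, hcard, Polynomial.natDegree_map, hp.2.1]) (fun a ha => by
      have h1 := (Polynomial.mem_roots hne).1 ha
      rw [Polynomial.IsRoot, Polynomial.taylor_eval] at h1
      have h2 : a + z ∈ (p.map Complex.ofRealHom).roots := (Polynomial.mem_roots hp0).2 h1
      rw [hp.2.2.roots_map] at h2
      obtain ⟨c, -, hc⟩ := Multiset.mem_map.1 h2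
      have := congrArg Complex.im hc
      rw [Complex.add_im] at this
      simp at this
      linarith)
  rwa [hcard, ← hqs] at this

theorem finiteFreeAdd_mem_realRooted {d : ℕ} {p q : ℝ[X]} (hp : p ∈ realRooted d)
    (hq : q ∈ realRooted d) : finiteFreeAdd d p q ∈ realRooted d := by
  have hle : (finiteFreeAdd d p q).natDegree ≤ d := by
    refine Polynomial.natDegree_sum_le_of_forall_le _ _ fun k _ => ?_
    exact (Polynomial.natDegree_C_mul_X_pow_le _ _).trans (Nat.sub_le _ _)
  have hcoeff : (finiteFreeAdd d p q).coeff d = 1 := by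
    have := coeff_finiteFreeAdd (Nat.zero_le d) p q
    rw [Nat.sub_zero] at this
    rw [this]
    simp [coef_zero hp, coef_zero hq]
  have hdeg : (finiteFreeAdd d p q).natDegree = d :=
    Polynomial.natDegree_eq_of_le_of_coeff_ne_zero hle (by rw [hcoeff]; exact one_ne_zero)
  have hmonic : (finiteFreeAdd d p q).Monic := by
    rw [Polynomial.Monic, Polynomial.leadingCoeff, hdeg, hcoeff]
  refine ⟨hmonic, hdeg, Polynomial.Splits.of_splits_map Complex.ofRealHom
    (IsAlgClosed.splits _) fun z hz => ?_⟩
  have hz' := (Polynomial.mem_roots (hmonic.map _).ne_zero).1 hz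
  have him : z.im = 0 := by
    rcases lt_trichotomy z.im 0 with h | h | h
    · exfalso
      refine eval_map_finiteFreeAdd_ne_zero hp hq (z := (starRingEnd ℂ) z) (by simpa using h) ?_
      have := congrArg (starRingEnd ℂ) hz'
      rw [map_zero, Polynomial.eval_map, Polynomial.hom_eval₂] at this
      rw [Polynomial.eval_map, ← this]
      congr 1
      ext x
      simp
    · exact h
    · exact absurd hz' (eval_map_finiteFreeAdd_ne_zero hp hq h)
  exact ⟨z.re, Complex.ext (by simp) (by simp [him])⟩

end RealRooted

/-! ### Moments of root distributions -/

section RootDistribution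

theorem integrable_sum_dirac (s : Multiset ℝ) (f : ℝ → ℝ) :
    Integrable f (s.map fun x : ℝ => Measure.dirac x).sum ∧
      ∫ t, f t ∂(s.map fun x : ℝ => Measure.dirac x).sum = (s.map f).sum := by
  induction s using Multiset.induction_on with
  | empty => simp
  | cons a s ih =>
    have ha : Integrable f (Measure.dirac a) := integrable_dirac (by simp)
    rw [Multiset.map_cons, Multiset.sum_cons, Multiset.map_cons, Multiset.sum_cons]
    refine ⟨ha.add_measure ih.1, ?_⟩
    rw [integral_add_measure ha ih.1, ih.2, integral_dirac]

theorem sum_dirac_univ (s : Multiset ℝ) :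
    (s.map fun x : ℝ => Measure.dirac x).sum Set.univ = s.card := by
  induction s using Multiset.induction_on with
  | empty => simp
  | cons a s ih =>
    rw [Multiset.map_cons, Multiset.sum_cons, Measure.add_apply, ih, measure_univ,
      Multiset.card_cons]
    push_cast
    rw [add_comm]

theorem isProbabilityMeasure_rootDistribution {d : ℕ} (hd : 1 ≤ d) {p : ℝ[X]}
    (hp : p ∈ realRooted d) : IsProbabilityMeasure (rootDistribution d p) := by
  have hcard : p.roots.card = d := by rw [← hp.2.2.natDegree_eq_card_roots, hp.2.1]
  refine ⟨?_⟩
  rw [rootDistribution, Measure.smul_apply, sum_dirac_univ, hcard, smul_eq_mul]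
  exact ENNReal.inv_mul_cancel (by simpa using (by omega : d ≠ 0)) (ENNReal.natCast_ne_top d)

theorem integrable_pow_rootDistribution {d : ℕ} (hd : 1 ≤ d) (p : ℝ[X]) (n : ℕ) :
    Integrable (fun t : ℝ => t ^ n) (rootDistribution d p) := by
  refine (integrable_sum_dirac p.roots _).1.smul_measure ?_
  simpa using (by omega : d ≠ 0)

theorem moment_rootDistribution (d : ℕ) (p : ℝ[X]) (n : ℕ) :
    moment (rootDistribution d p) n = (d : ℝ)⁻¹ * (p.roots.map fun t => t ^ n).sum := by
  rw [moment, rootDistribution, integral_smul_measure, (integrable_sum_dirac p.roots _).2]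
  simp

end RootDistribution

/-! ### Limits of moment sequences -/

section MomentProblem

theorem isTightMeasureSet_of_moment_two_le {S : Set (ProbabilityMeasure ℝ)} {K : ℝ}
    (hint : ∀ μ ∈ S, Integrable (fun t : ℝ => t ^ 2) (μ : Measure ℝ))
    (hK : ∀ μ ∈ S, moment (μ : Measure ℝ) 2 ≤ K) :
    IsTightMeasureSet {((μ : ProbabilityMeasure ℝ) : Measure ℝ) | μ ∈ S} := by
  rw [isTightMeasureSet_iff_exists_isCompact_measure_compl_le]
  intro ε hε
  have hlim : Tendsto (fun R : ℝ => ENNReal.ofReal (K / R ^ 2)) atTop (𝓝 0) := by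
    have h1 : Tendsto (fun R : ℝ => K / R ^ 2) atTop (𝓝 0) :=
      tendsto_const_nhds.div_atTop (tendsto_pow_atTop two_ne_zero)
    simpa using ENNReal.tendsto_ofReal h1
  obtain ⟨R, hR, hR0⟩ := ((hlim.eventually (ge_mem_nhds hε)).and (eventually_gt_atTop 0)).exists
  refine ⟨Metric.closedBall 0 R, isCompact_closedBall 0 R, ?_⟩
  rintro _ ⟨μ, hμ, rfl⟩
  refine le_trans ?_ hR
  have hsub : (Metric.closedBall (0 : ℝ) R)ᶜ ⊆ {t : ℝ | R ^ 2 ≤ t ^ 2} := by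
    intro t ht
    rw [Set.mem_compl_iff, Metric.mem_closedBall, not_le, Real.dist_eq, sub_zero] at ht
    rw [Set.mem_ofPred_eq, ← sq_abs t]
    exact pow_le_pow_left₀ hR0.le ht.le 2
  refine (measure_mono hsub).trans ?_
  have hm := mul_meas_ge_le_integral_of_nonneg (μ := (μ : Measure ℝ))
    (Eventually.of_forall fun t => sq_nonneg t) (hint μ hμ) (R ^ 2)
  rw [← ofReal_measureReal]
  refine ENNReal.ofReal_le_ofReal ?_
  rw [le_div_iff₀ (by positivity), mul_comm]
  exact hm.trans (hK μ hμ)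

/-- The power function truncated at height `A`. -/
noncomputable def truncPow (n : ℕ) (A : ℝ) (hA : 0 ≤ A) : BoundedContinuousFunction ℝ ℝ :=
  BoundedContinuousFunction.ofNormedAddCommGroup (fun t : ℝ => max (-A) (min A (t ^ n)))
    (by fun_prop) A fun t => by
      rw [Real.norm_eq_abs, abs_le]
      exact ⟨le_max_left _ _, max_le (by linarith) (min_le_left _ _)⟩

theorem truncPow_apply (n : ℕ) {A : ℝ} (hA : 0 ≤ A) (t : ℝ) :
    truncPow n A hA t = max (-A) (min A (t ^ n)) := rfl

/-- The error vanishes where `|tⁿ| ≤ A` and is at most `|tⁿ| ≤ t²ⁿ / A` elsewhere, so moments of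
order `2n` control the truncation uniformly. -/
theorem abs_truncPow_sub_le (n : ℕ) {A : ℝ} (hA : 0 < A) (t : ℝ) :
    |truncPow n A hA.le t - t ^ n| ≤ t ^ (2 * n) / A := by
  rw [truncPow_apply, mul_comm 2 n, pow_mul, le_div_iff₀ hA]
  generalize t ^ n = x
  rcases le_total A x with h | h
  · rw [min_eq_left h, max_eq_right (by linarith), abs_sub_comm, abs_of_nonneg (by linarith)]
    nlinarith
  · rw [min_eq_right h]
    rcases le_total (-A) x with h' | h'
    · rw [max_eq_right h', sub_self, abs_zero, zero_mul]
      positivity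
    · rw [max_eq_left h', abs_of_nonneg (by linarith)]
      nlinarith

theorem abs_integral_truncPow_sub_le {μ : Measure ℝ} [IsProbabilityMeasure μ]
    (hint : ∀ n : ℕ, Integrable (fun t : ℝ => t ^ n) μ) (n : ℕ) {A : ℝ} (hA : 0 < A) :
    |∫ t, truncPow n A hA.le t ∂μ - moment μ n| ≤ moment μ (2 * n) / A := by
  rw [moment, moment, ← integral_sub (BoundedContinuousFunction.integrable μ _) (hint n),
    ← integral_div]
  refine (abs_integral_le_integral_abs).trans (integral_mono ?_ ((hint (2 * n)).div_const A)
    fun t => abs_truncPow_sub_le n hA t)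
  exact ((BoundedContinuousFunction.integrable μ _).sub (hint n)).abs

theorem integrable_even_pow_of_truncPow_le {μ : Measure ℝ} [IsProbabilityMeasure μ] (n : ℕ)
    {K : ℝ} (h : ∀ (A : ℝ) (hA : 0 ≤ A), ∫ t, truncPow (2 * n) A hA t ∂μ ≤ K) :
    Integrable (fun t : ℝ => t ^ (2 * n)) μ := by
  have hnn : ∀ (A : ℝ) (hA : 0 ≤ A) (t : ℝ),
      truncPow (2 * n) A hA t = min A (t ^ (2 * n)) := fun A hA t => by
    have : 0 ≤ t ^ (2 * n) := (even_two_mul n).pow_nonneg t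
    rw [truncPow_apply, max_eq_right]
    exact le_trans (by linarith) (le_min hA this)
  have hlim := lintegral_tendsto_of_tendsto_of_monotone (μ := μ)
    (f := fun (k : ℕ) t => ENNReal.ofReal (truncPow (2 * n) k k.cast_nonneg t))
    (F := fun t => ENNReal.ofReal (t ^ (2 * n)))
    (fun k => (BoundedContinuousFunction.continuous _).measurable.ennreal_ofReal.aemeasurable)
    (Eventually.of_forall fun t i j hij => by
      simp only [hnn]
      exact ENNReal.ofReal_le_ofReal (min_le_min_right _ (Nat.cast_le.2 hij)))
    (Eventually.of_forall fun t => by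
      refine tendsto_const_nhds.congr' ?_
      filter_upwards [eventually_ge_atTop ⌈t ^ (2 * n)⌉₊] with k hk
      rw [hnn, min_eq_right (Nat.ceil_le.1 hk)])
  have hle : ∫⁻ t, ENNReal.ofReal (t ^ (2 * n)) ∂μ ≤ ENNReal.ofReal K := by
    refine le_of_tendsto' hlim fun k => ?_
    rw [← ofReal_integral_eq_lintegral_ofReal (BoundedContinuousFunction.integrable μ _)
      (Eventually.of_forall fun t => ?_)]
    · exact ENNReal.ofReal_le_ofReal (h k k.cast_nonneg)
    · rw [hnn]
      exact le_min k.cast_nonneg ((even_two_mul n).pow_nonneg t)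
  refine (lintegral_ofReal_ne_top_iff_integrable (by fun_prop)
    (Eventually.of_forall fun t => (even_two_mul n).pow_nonneg t)).1 ?_
  exact ne_top_of_le_ne_top ENNReal.ofReal_ne_top hle

theorem integrable_pow_of_even {μ : Measure ℝ} [IsProbabilityMeasure μ]
    (h : ∀ n : ℕ, Integrable (fun t : ℝ => t ^ (2 * n)) μ) (n : ℕ) :
    Integrable (fun t : ℝ => t ^ n) μ := by
  refine ((integrable_const (1 : ℝ)).add (h n)).mono' (by fun_prop)
    (Eventually.of_forall fun t => ?_)
  rw [Real.norm_eq_abs, Pi.add_apply, mul_comm 2 n, pow_mul, ← sq_abs (t ^ n)]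
  nlinarith [sq_nonneg (|t ^ n| - 1), abs_nonneg (t ^ n)]

/-- A pointwise limit of moment sequences of probability measures is a moment sequence. -/
theorem exists_measure_of_tendsto_moment (μ : ℕ → Measure ℝ)
    (hprob : ∀ i, IsProbabilityMeasure (μ i))
    (hint : ∀ i n, Integrable (fun t : ℝ => t ^ n) (μ i)) (m : ℕ → ℝ)
    (hm : ∀ n, Tendsto (fun i => moment (μ i) n) atTop (𝓝 (m n))) :
    ∃ ρ : Measure ℝ, IsProbabilityMeasure ρ ∧ (∀ n : ℕ, Integrable (fun t : ℝ => t ^ n) ρ) ∧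
      ∀ n, moment ρ n = m n := by
  let M : ℕ → ProbabilityMeasure ℝ := fun i => ⟨μ i, hprob i⟩
  obtain ⟨K, hK⟩ := (hm 2).bddAbove_range
  have htight := isTightMeasureSet_of_moment_two_le (S := Set.range M) (K := K)
    (by rintro _ ⟨i, rfl⟩; exact hint i 2) (by rintro _ ⟨i, rfl⟩; exact hK ⟨i, rfl⟩)
  -- Bounded second moments give tightness, and Prokhorov's theorem a weak limit along a free
  -- ultrafilter, which replaces the choice of a subsequence. Determinacy of the moment problem
  -- plays no role.
  obtain ⟨ρ, -, hρ⟩ := (isCompact_closure_of_isTightMeasureSet htight).ultrafilter_le_nhds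
    ((hyperfilter ℕ).map M) (by
      rw [le_principal_iff, Ultrafilter.coe_map, mem_map]
      exact univ_mem' fun i => subset_closure ⟨i, rfl⟩)
  have hm' : ∀ n, Tendsto (fun i => moment (μ i) n) (hyperfilter ℕ) (𝓝 (m n)) := fun n =>
    (hm n).mono_left Nat.hyperfilter_le_atTop
  have hconv : ∀ f : BoundedContinuousFunction ℝ ℝ, Tendsto (fun i => ∫ t, f t ∂(μ i))
      (hyperfilter ℕ) (𝓝 (∫ t, f t ∂(ρ : Measure ℝ))) :=
    ProbabilityMeasure.tendsto_iff_forall_integral_tendsto.1 hρ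
  have hev : ∀ n : ℕ, Integrable (fun t : ℝ => t ^ (2 * n)) (ρ : Measure ℝ) := fun n => by
    refine integrable_even_pow_of_truncPow_le (K := m (2 * n)) n fun A hA => ?_
    refine le_of_tendsto_of_tendsto' (hconv _) (hm' (2 * n)) fun i => ?_
    have := hprob i
    refine integral_mono (BoundedContinuousFunction.integrable _ _) (hint i _) fun t => ?_
    have : 0 ≤ t ^ (2 * n) := (even_two_mul n).pow_nonneg t
    change truncPow (2 * n) A hA t ≤ t ^ (2 * n)
    rw [truncPow_apply]
    exact max_le (by linarith) (min_le_right _ _)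
  have hρint := integrable_pow_of_even hev
  refine ⟨ρ, inferInstance, hρint, fun n => ?_⟩
  -- Truncation at height `A` costs a moment of order `2n` divided by `A`, once along the sequence
  -- and once for the limit; then `A` tends to infinity.
  have hbound : ∀ A : ℝ, 0 < A →
      |moment (ρ : Measure ℝ) n - m n| ≤ (m (2 * n) + moment (ρ : Measure ℝ) (2 * n)) / A := by
    intro A hA
    have h1 : |∫ t, truncPow n A hA.le t ∂(ρ : Measure ℝ) - m n| ≤ m (2 * n) / A :=
      le_of_tendsto_of_tendsto' (((hconv _).sub (hm' n)).abs) ((hm' (2 * n)).div_const A)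
        fun i => by
          have := hprob i
          exact abs_integral_truncPow_sub_le (hint i) n hA
    have h2 := abs_integral_truncPow_sub_le hρint n hA
    rw [abs_sub_comm] at h2
    have h3 := abs_sub_le (moment (ρ : Measure ℝ) n) (∫ t, truncPow n A hA.le t ∂(ρ : Measure ℝ))
      (m n)
    rw [add_div]
    linarith
  have hlim : Tendsto (fun A : ℝ => (m (2 * n) + moment (ρ : Measure ℝ) (2 * n)) / A) atTop
      (𝓝 0) := tendsto_const_nhds.div_atTop tendsto_id
  have h0 : |moment (ρ : Measure ℝ) n - m n| ≤ 0 := by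
    refine ge_of_tendsto hlim ?_
    filter_upwards [eventually_gt_atTop 0] with A hA
    exact hbound A hA
  exact sub_eq_zero.1 (abs_nonpos_iff.1 h0)

end MomentProblem

/-! ### The operator `T` and its symbols -/

section ShiftOperator

theorem coeff_zDeriv_succ (F : PowerSeries ℝ) (n : ℕ) :
    PowerSeries.coeff (n + 1) (zDeriv F) = -((n : ℝ) * PowerSeries.coeff n F) := by
  rw [zDeriv, map_neg, pow_succ, mul_assoc, pow_one, PowerSeries.coeff_succ_X_mul]
  rcases n with _ | n
  · simp
  · rw [PowerSeries.coeff_succ_X_mul, PowerSeries.coeff_derivative]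
    push_cast
    ring

theorem coeff_zero_zDeriv (F : PowerSeries ℝ) : PowerSeries.coeff 0 (zDeriv F) = 0 := by
  simp [zDeriv]

theorem zDeriv_mul (F G : PowerSeries ℝ) : zDeriv (F * G) = F * zDeriv G + G * zDeriv F := by
  rw [zDeriv, zDeriv, zDeriv, Derivation.leibniz, smul_eq_mul, smul_eq_mul]
  ring

theorem zDeriv_pow (F : PowerSeries ℝ) (n : ℕ) :
    zDeriv (F ^ n) = n * F ^ (n - 1) * zDeriv F := by
  rw [zDeriv, zDeriv, Derivation.leibniz_pow, smul_eq_mul, nsmul_eq_mul]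
  ring

/-- The operator `F ↦ X F + c dF/dz`. -/
noncomputable def shiftOp (c : ℝ) (F : PowerSeries ℝ) : PowerSeries ℝ :=
  PowerSeries.X * F + PowerSeries.C c * zDeriv F

/-- For `c = 1/d` the operator is `F ↦ z⁻ᵈ (zᵈ F)' / d`, so its iterates encode repeated
differentiation of `p = zᵈ A`. On coefficients it is a weighted shift. -/
theorem coeff_shiftOp_succ (c : ℝ) (F : PowerSeries ℝ) (n : ℕ) :
    PowerSeries.coeff (n + 1) (shiftOp c F) = (1 - n * c) * PowerSeries.coeff n F := by
  rw [shiftOp, map_add, PowerSeries.coeff_succ_X_mul, PowerSeries.coeff_C_mul, coeff_zDeriv_succ]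
  ring

theorem coeff_shiftOp_zero (c : ℝ) (F : PowerSeries ℝ) :
    PowerSeries.coeff 0 (shiftOp c F) = 0 := by
  rw [shiftOp, map_add, PowerSeries.coeff_zero_X_mul, PowerSeries.coeff_C_mul, coeff_zero_zDeriv]
  ring

theorem coeff_iterate_shiftOp_of_lt (c : ℝ) (F : PowerSeries ℝ) (n : ℕ) :
    ∀ k < n, PowerSeries.coeff k ((shiftOp c)^[n] F) = 0 := by
  induction n with
  | zero => intro k hk; omega
  | succ n ih =>
    intro k hk
    rw [Function.iterate_succ_apply']
    rcases k with _ | k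
    · exact coeff_shiftOp_zero c _
    · rw [coeff_shiftOp_succ, ih k (by omega), mul_zero]

theorem coeff_iterate_shiftOp (c : ℝ) (F : PowerSeries ℝ) (n k : ℕ) :
    PowerSeries.coeff (k + n) ((shiftOp c)^[n] F) =
      (∏ i ∈ Finset.range n, (1 - ((k + i : ℕ) : ℝ) * c)) * PowerSeries.coeff k F := by
  induction n with
  | zero => simp
  | succ n ih =>
    rw [Function.iterate_succ_apply', ← add_assoc, coeff_shiftOp_succ, ih,
      Finset.prod_range_succ]
    ring

/-- The series `Q_n` with `T ^ n A = Q_n A` whenever `T A = G A`, for the operator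
`T F = X F + c dF/dz`. -/
noncomputable def shiftSymbol (c : ℝ) (G : PowerSeries ℝ) : ℕ → PowerSeries ℝ
  | 0 => 1
  | n + 1 => G * shiftSymbol c G n + PowerSeries.C c * zDeriv (shiftSymbol c G n)

/-- By Leibniz `T (Q A) = Q (T A) + c Q' A = (G Q + c Q') A`, which is the recursion of the symbols.
-/
theorem iterate_shiftOp_eq_shiftSymbol_mul {c : ℝ} {A G : PowerSeries ℝ}
    (h : shiftOp c A = G * A) (n : ℕ) : (shiftOp c)^[n] A = shiftSymbol c G n * A := by
  induction n with
  | zero => simp [shiftSymbol]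
  | succ n ih =>
    rw [Function.iterate_succ_apply', ih, shiftSymbol, shiftOp, zDeriv_mul]
    rw [shiftOp] at h
    linear_combination shiftSymbol c G n * h

theorem coeff_shiftSymbol_of_lt {c : ℝ} {G : PowerSeries ℝ}
    (hG : PowerSeries.coeff 0 G = 0) (n : ℕ) :
    ∀ k < n, PowerSeries.coeff k (shiftSymbol c G n) = 0 := by
  induction n with
  | zero => intro k hk; omega
  | succ n ih =>
    intro k hk
    rw [shiftSymbol, map_add, PowerSeries.coeff_mul, PowerSeries.coeff_C_mul]
    rw [Finset.sum_eq_zero, zero_add]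
    · rcases k with _ | k
      · rw [coeff_zero_zDeriv, mul_zero]
      · rw [coeff_zDeriv_succ, ih k (by omega)]
        ring
    · rintro ⟨i, j⟩ hij
      rw [Finset.HasAntidiagonal.mem_antidiagonal] at hij
      simp only at hij ⊢
      rcases i with _ | i
      · rw [hG, zero_mul]
      · rw [ih j (by omega), mul_zero]

end ShiftOperator

/-! ### Newton's identities -/

section Newton

/-- The series `∏ (1 - r X)` over the elements `r` of a multiset. -/
noncomputable def reverseSeries (s : Multiset ℝ) : PowerSeries ℝ :=
  (s.map fun r => 1 - PowerSeries.C r * PowerSeries.X).prod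

theorem one_sub_mul_mk_pow (r : ℝ) :
    (1 - PowerSeries.C r * PowerSeries.X) * PowerSeries.mk (fun n => r ^ n) = 1 := by
  ext n
  rw [sub_mul, one_mul, mul_assoc, map_sub, PowerSeries.coeff_C_mul, PowerSeries.coeff_mk]
  rcases n with _ | n
  · simp
  · rw [PowerSeries.coeff_succ_X_mul, PowerSeries.coeff_mk, PowerSeries.coeff_one,
      if_neg (Nat.succ_ne_zero n)]
    ring

/-- Newton's identities. -/
theorem X_mul_derivative_reverseSeries (s : Multiset ℝ) :
    PowerSeries.X * PowerSeries.derivative ℝ (reverseSeries s) = reverseSeries s *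
      (PowerSeries.C (s.card : ℝ) - PowerSeries.mk fun n => (s.map fun r => r ^ n).sum) := by
  induction s using Multiset.induction_on with
  | empty =>
    have : (PowerSeries.mk fun _ : ℕ => (0 : ℝ)) = 0 := by ext; simp
    simp [reverseSeries, this]
  | cons r s ih =>
    have h1 : reverseSeries (r ::ₘ s) =
        (1 - PowerSeries.C r * PowerSeries.X) * reverseSeries s := by
      rw [reverseSeries, Multiset.map_cons, Multiset.prod_cons]; rfl
    have h2 : (PowerSeries.mk fun n => ((r ::ₘ s).map fun r => r ^ n).sum) =
        PowerSeries.mk (fun n => r ^ n) + PowerSeries.mk fun n => (s.map fun r => r ^ n).sum := by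
      ext n
      simp
    have h3 : PowerSeries.C ((r ::ₘ s).card : ℝ) = PowerSeries.C (s.card : ℝ) + 1 := by
      simp
    have h4 : PowerSeries.derivative ℝ (1 - PowerSeries.C r * PowerSeries.X) =
        -PowerSeries.C r := by
      rw [map_sub, Derivation.leibniz, PowerSeries.derivative_C, PowerSeries.derivative_X]
      simp
    rw [h1, h2, h3, Derivation.leibniz, h4, smul_eq_mul, smul_eq_mul]
    linear_combination (1 - PowerSeries.C r * PowerSeries.X) * ih +
      reverseSeries s * one_sub_mul_mk_pow r

theorem coeff_reverseSeries {d k : ℕ} (hk : k ≤ d) {p : ℝ[X]} (hp : p ∈ realRooted d) :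
    PowerSeries.coeff k (reverseSeries p.roots) = (-1) ^ k * (d.choose k : ℝ) * coef d k p := by
  have h1 : ∀ s : Multiset ℝ, ((s.map fun r => X - C r).prod.reverse : PowerSeries ℝ) =
      reverseSeries s := by
    intro s
    induction s using Multiset.induction_on with
    | empty =>
      have : (1 : ℝ[X]).reverse = 1 := by
        rw [← Polynomial.C_1, Polynomial.reverse_C]
      simp [reverseSeries, this]
    | cons r s ih =>
      have h2 : (X - C r : ℝ[X]).reverse = 1 - C r * X := by
        ext n
        rw [Polynomial.coeff_reverse, Polynomial.natDegree_X_sub_C]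
        rcases n with _ | _ | n
        · rw [Polynomial.revAt_le (by omega)]
          simp
        · rw [Polynomial.revAt_le (by omega)]
          simp [Polynomial.coeff_one]
        · rw [Polynomial.revAt_eq_self_of_lt (by omega)]
          simp [Polynomial.coeff_X, Polynomial.coeff_one]
      rw [Multiset.map_cons, Multiset.prod_cons, Polynomial.reverse_mul_of_domain,
        Polynomial.coe_mul, ih, h2, reverseSeries, reverseSeries, Multiset.map_cons,
        Multiset.prod_cons]
      simp
  rw [← h1, ← hp.2.2.eq_prod_roots_of_monic hp.1, Polynomial.coeff_coe,
    Polynomial.coeff_reverse, hp.2.1, Polynomial.revAt_le hk, coef]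
  have c1 : (d.choose k : ℝ) ≠ 0 := Nat.cast_ne_zero.2 (Nat.choose_pos hk).ne'
  have c2 : ((-1 : ℝ)) ^ k * (-1) ^ k = 1 := by rw [← mul_pow]; simp
  field_simp
  linear_combination -p.coeff (d - k) * c2

theorem constantCoeff_reverseSeries (s : Multiset ℝ) :
    PowerSeries.constantCoeff (reverseSeries s) = 1 := by
  rw [reverseSeries, map_multiset_prod, Multiset.map_map]
  simp

end Newton

/-! ### The finite moment-cumulant formula -/

section FiniteMomentCumulant

theorem mk_moment_rootDistribution {d : ℕ} (p : ℝ[X]) :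
    (PowerSeries.mk fun n => moment (rootDistribution d p) n) =
      PowerSeries.C (d : ℝ)⁻¹ * PowerSeries.mk fun n => (p.roots.map fun r => r ^ n).sum := by
  ext n
  rw [PowerSeries.coeff_mk, moment_rootDistribution, PowerSeries.coeff_C_mul,
    PowerSeries.coeff_mk]

theorem X_mul_derivative_reverseSeries_roots {d : ℕ} (hd : 1 ≤ d) {p : ℝ[X]}
    (hp : p ∈ realRooted d) :
    PowerSeries.C (d : ℝ)⁻¹ *
      (PowerSeries.X * PowerSeries.derivative ℝ (reverseSeries p.roots)) =
    reverseSeries p.roots *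
      (1 - PowerSeries.mk fun n => moment (rootDistribution d p) n) := by
  have hcard : p.roots.card = d := by rw [← hp.2.2.natDegree_eq_card_roots, hp.2.1]
  have hd0 : (d : ℝ) ≠ 0 := Nat.cast_ne_zero.2 (by omega)
  have h1 : PowerSeries.C (d : ℝ)⁻¹ * PowerSeries.C (d : ℝ) = 1 := by
    rw [← map_mul, inv_mul_cancel₀ hd0, map_one]
  rw [X_mul_derivative_reverseSeries, mk_moment_rootDistribution, hcard]
  linear_combination reverseSeries p.roots * h1

/-- Both sides are `z⁻ᵈ p'(z) / d`; as formal series this is Newton's identities multiplied by `X`.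
-/
theorem shiftOp_reverseSeries {d : ℕ} (hd : 1 ≤ d) {p : ℝ[X]} (hp : p ∈ realRooted d) :
    shiftOp (d : ℝ)⁻¹ (reverseSeries p.roots) =
      cauchySeries (rootDistribution d p) * reverseSeries p.roots := by
  have h := X_mul_derivative_reverseSeries_roots hd hp
  rw [shiftOp, zDeriv, cauchySeries]
  linear_combination -PowerSeries.X * h

theorem prod_one_sub_eq_descFactorial {d : ℕ} (hd : 1 ≤ d) (k n : ℕ) (h : k + n ≤ d) :
    ∏ i ∈ Finset.range n, (1 - ((k + i : ℕ) : ℝ) * (d : ℝ)⁻¹) =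
      ((d - k).descFactorial n : ℝ) / (d : ℝ) ^ n := by
  have hd0 : (d : ℝ) ≠ 0 := Nat.cast_ne_zero.2 (by omega)
  rw [Nat.descFactorial_eq_prod_range, Nat.cast_prod, ← Finset.card_range n,
    ← Finset.prod_const, Finset.card_range, ← Finset.prod_div_distrib]
  refine Finset.prod_congr rfl fun i hi => ?_
  have := Finset.mem_range.1 hi
  rw [Nat.sub_sub, Nat.cast_sub (by omega)]
  field_simp

/-- The logarithmic recursion for `e_{m+1}`, rewritten through `T`: the iterate `Tⁿ⁺¹` carries the
coefficient of `X^{m-n}` to that of `X^{m+1}` with a falling factorial of `d - (m - n)`, which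
matches the binomial normalization of the `e_k`. On the right stands the coefficient of `-d⁻¹ X
dA/dX`. -/
theorem coeff_sum_finiteCumulant_mul_iterate {d : ℕ} (hd : 1 ≤ d) {p : ℝ[X]}
    (hp : p ∈ realRooted d) {m : ℕ} (hm : m + 1 ≤ d) :
    ∑ n ∈ Finset.range (m + 1), finiteCumulant d (n + 1) p *
      PowerSeries.coeff (m + 1) ((shiftOp (d : ℝ)⁻¹)^[n + 1] (reverseSeries p.roots)) =
      -((m + 1 : ℝ) * (d : ℝ)⁻¹) * PowerSeries.coeff (m + 1) (reverseSeries p.roots) := by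
  have hd0 : (d : ℝ) ≠ 0 := Nat.cast_ne_zero.2 (by omega)
  rw [coeff_reverseSeries hm hp,
    sum_choose_mul_blockSum (fun k => coef d k p) (coef_zero hp) m, Finset.mul_sum,
    Finset.mul_sum]
  refine Finset.sum_congr rfl fun n hn => ?_
  have hn' : n ≤ m := Nat.lt_succ_iff.1 (Finset.mem_range.1 hn)
  have e1 : m + 1 = (m - n) + (n + 1) := by omega
  rw [finiteCumulant_eq_blockSum d (n + 1) p (fun _ _ => rfl)]
  conv_lhs => rw [e1, coeff_iterate_shiftOp, prod_one_sub_eq_descFactorial hd _ _ (by omega),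
    coeff_reverseSeries (by omega) hp, Nat.descFactorial_eq_factorial_mul_choose]
  -- Disjoint subsets of sizes `m - n` and `n + 1` are counted through their union.
  have i1 : (d.choose (m - n) : ℝ) * ((d - (m - n)).choose (n + 1) : ℝ) =
      (d.choose (m + 1) : ℝ) * ((m + 1).choose (n + 1) : ℝ) := by
    have := Nat.choose_mul (n := d) (k := m + 1) (s := m - n) (by omega)
    have e2 : m + 1 - (m - n) = n + 1 := by omega
    rw [e2] at this
    have e3 : (m + 1).choose (m - n) = (m + 1).choose (n + 1) := by
      rw [← Nat.choose_symm (by omega : n + 1 ≤ m + 1)]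
      congr 1
      omega
    rw [e3] at this
    exact_mod_cast this.symm
  have i2 : ((m + 1).choose (n + 1) : ℝ) * ((n : ℝ) + 1) = ((m : ℝ) + 1) * (m.choose n : ℝ) := by
    exact_mod_cast (Nat.add_one_mul_choose_eq m n).symm
  have i3 : ((n + 1).factorial : ℝ) = ((n : ℝ) + 1) * n.factorial := by
    rw [Nat.factorial_succ]; push_cast; rfl
  have i4 : (-1 : ℝ) ^ (m + 1) = -((-1) ^ n * (-1) ^ (m - n)) := by
    rw [← pow_add, Nat.add_sub_cancel' hn', pow_succ]
    ring
  have hf : (n.factorial : ℝ) ≠ 0 := Nat.cast_ne_zero.2 n.factorial_ne_zero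
  have i5 : (-(d : ℝ)) ^ n = (-1) ^ n * (d : ℝ) ^ n := by rw [neg_pow]
  rw [Nat.add_sub_cancel, i4, i5]
  push_cast
  rw [i3]
  calc _ = (-1 : ℝ) ^ n * (-1) ^ (m - n) * blockSum (fun k => coef d k p) (n + 1) logCoeff *
        coef d (m - n) p * ((d : ℝ) ^ n / (d : ℝ) ^ (n + 1)) *
        ((n.factorial : ℝ) / n.factorial) * ((n : ℝ) + 1) *
        ((d.choose (m - n) : ℝ) * ((d - (m - n)).choose (n + 1) : ℝ)) := by
        ring
    _ = (-1 : ℝ) ^ n * (-1) ^ (m - n) * blockSum (fun k => coef d k p) (n + 1) logCoeff *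
        coef d (m - n) p * (d : ℝ)⁻¹ * (d.choose (m + 1) : ℝ) *
        (((m + 1).choose (n + 1) : ℝ) * ((n : ℝ) + 1)) := by
        rw [i1, div_self hf, pow_succ, div_mul_eq_div_div, div_self (pow_ne_zero n hd0)]
        ring
    _ = _ := by
        rw [i2]
        ring

theorem coeff_eq_of_coeff_mul_eq {A F G : PowerSeries ℝ}
    (hA : PowerSeries.constantCoeff A ≠ 0) {d : ℕ}
    (h : ∀ k ≤ d, PowerSeries.coeff k (F * A) = PowerSeries.coeff k (G * A)) :
    ∀ k ≤ d, PowerSeries.coeff k F = PowerSeries.coeff k G := by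
  intro k hk
  have e : ∀ F : PowerSeries ℝ, F = F * A * A⁻¹ := fun F => by
    rw [mul_assoc, PowerSeries.mul_inv_cancel _ hA, mul_one]
  rw [e F, e G, PowerSeries.coeff_mul, PowerSeries.coeff_mul]
  refine Finset.sum_congr rfl fun ij hij => ?_
  have := Finset.HasAntidiagonal.mem_antidiagonal.1 hij
  rw [h ij.1 (by omega)]

/-- The finite moment-cumulant formula. -/
theorem moment_rootDistribution_eq_sum {d : ℕ} {p : ℝ[X]} (hp : p ∈ realRooted d) {k : ℕ}
    (hk : k + 1 ≤ d) : moment (rootDistribution d p) (k + 1) =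
      ∑ n ∈ Finset.range (k + 1), finiteCumulant d (n + 1) p * PowerSeries.coeff (k + 1)
        (shiftSymbol (d : ℝ)⁻¹ (cauchySeries (rootDistribution d p)) (n + 1)) := by
  have hd : 1 ≤ d := by omega
  have hT := iterate_shiftOp_eq_shiftSymbol_mul (shiftOp_reverseSeries hd hp)
  have hnewton := X_mul_derivative_reverseSeries_roots hd hp
  set A := reverseSeries p.roots with hA
  set Q := shiftSymbol (d : ℝ)⁻¹ (cauchySeries (rootDistribution d p)) with hQ
  set M := PowerSeries.mk fun n => moment (rootDistribution d p) n with hM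
  have hvanish : ∀ j n, j < n → PowerSeries.coeff j (Q n) = 0 := fun j n h =>
    coeff_shiftSymbol_of_lt (by rw [cauchySeries, PowerSeries.coeff_zero_X_mul]) n j h
  -- The comparison is made after multiplication by `A` and only up to order `d`, the range of the
  -- recursion. As `A` has constant term one, it cancels to the same order.
  have key : ∀ j ≤ d, PowerSeries.coeff j
      ((∑ n ∈ Finset.range d, PowerSeries.C (finiteCumulant d (n + 1) p) * Q (n + 1)) * A) =
      PowerSeries.coeff j ((M - 1) * A) := by
    intro j hj
    have e1 : (M - 1) * A =
        -(PowerSeries.C (d : ℝ)⁻¹ * (PowerSeries.X * PowerSeries.derivative ℝ A)) := by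
      rw [hnewton]; ring
    rw [e1, Finset.sum_mul, map_sum, map_neg, PowerSeries.coeff_C_mul]
    have e2 : ∀ n ∈ Finset.range d, PowerSeries.coeff j
        (PowerSeries.C (finiteCumulant d (n + 1) p) * Q (n + 1) * A) =
        finiteCumulant d (n + 1) p *
          PowerSeries.coeff j ((shiftOp (d : ℝ)⁻¹)^[n + 1] A) := fun n _ => by
      rw [hT, mul_assoc, PowerSeries.coeff_C_mul]
    rw [Finset.sum_congr rfl e2]
    rcases j with _ | m
    · rw [PowerSeries.coeff_zero_X_mul, mul_zero, neg_zero]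
      refine Finset.sum_eq_zero fun n _ => ?_
      rw [coeff_iterate_shiftOp_of_lt _ _ _ _ (Nat.succ_pos n), mul_zero]
    · rw [PowerSeries.coeff_succ_X_mul, PowerSeries.coeff_derivative]
      have := coeff_sum_finiteCumulant_mul_iterate hd hp hj
      rw [← hA] at this
      rw [← Finset.sum_subset (Finset.range_subset_range.2 hj), this]
      · ring
      · intro n _ hn
        rw [Finset.mem_range, not_lt] at hn
        rw [coeff_iterate_shiftOp_of_lt _ _ _ _ (by omega), mul_zero]
  have hk' := coeff_eq_of_coeff_mul_eq (by
    rw [hA, constantCoeff_reverseSeries]; exact one_ne_zero) key (k + 1) hk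
  rw [map_sub, PowerSeries.coeff_one, if_neg (Nat.succ_ne_zero k), sub_zero, hM,
    PowerSeries.coeff_mk, map_sum] at hk'
  rw [← hk', ← Finset.sum_subset (Finset.range_subset_range.2 hk)]
  · exact Finset.sum_congr rfl fun n _ => PowerSeries.coeff_C_mul _ _ _
  · intro n _ hn
    rw [Finset.mem_range, not_lt] at hn
    rw [PowerSeries.coeff_C_mul, hvanish _ _ (by omega), mul_zero]

theorem moment_rootDistribution_eq_sum_range {d : ℕ} {p : ℝ[X]} (hp : p ∈ realRooted d) {k N : ℕ}
    (hk : k + 1 ≤ d) (hN : k + 1 ≤ N) : moment (rootDistribution d p) (k + 1) =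
      ∑ n ∈ Finset.range N, finiteCumulant d (n + 1) p * PowerSeries.coeff (k + 1)
        (shiftSymbol (d : ℝ)⁻¹ (cauchySeries (rootDistribution d p)) (n + 1)) := by
  rw [moment_rootDistribution_eq_sum hp hk]
  refine Finset.sum_subset (Finset.range_subset_range.2 hN) fun n _ hn => ?_
  rw [Finset.mem_range, not_lt] at hn
  rw [coeff_shiftSymbol_of_lt (by rw [cauchySeries, PowerSeries.coeff_zero_X_mul]) _ _ (by omega),
    mul_zero]

end FiniteMomentCumulant

/-! ### First-order expansions in `1/d` -/

section Expansion

/-- The expansion `a d = a₀ + a₁ / d + o(1 / d)`. -/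
def HasExpansion (a : ℕ → ℝ) (a₀ a₁ : ℝ) : Prop :=
  Tendsto (fun d : ℕ => (d : ℝ) * (a d - a₀)) atTop (𝓝 a₁)

namespace HasExpansion

variable {a b : ℕ → ℝ} {a₀ a₁ b₀ b₁ : ℝ}

theorem congr' (h : HasExpansion a a₀ a₁) (hab : ∀ᶠ d in atTop, a d = b d) :
    HasExpansion b a₀ a₁ := by
  refine Tendsto.congr' ?_ h
  filter_upwards [hab] with d hd
  rw [hd]

theorem tendsto (h : HasExpansion a a₀ a₁) : Tendsto a atTop (𝓝 a₀) := by
  have h1 := (Tendsto.mul h (tendsto_inv_atTop_nhds_zero_nat (𝕜 := ℝ))).add_const a₀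
  rw [mul_zero, zero_add] at h1
  refine h1.congr' ?_
  filter_upwards [eventually_ge_atTop 1] with d hd
  have : (d : ℝ) ≠ 0 := Nat.cast_ne_zero.2 (by omega)
  field_simp
  ring

theorem unique (h : HasExpansion a a₀ a₁) (h' : HasExpansion a b₀ b₁) : a₀ = b₀ ∧ a₁ = b₁ := by
  have h0 := tendsto_nhds_unique h.tendsto h'.tendsto
  subst h0
  exact ⟨rfl, tendsto_nhds_unique h h'⟩

theorem const (c : ℝ) : HasExpansion (fun _ => c) c 0 := by
  simp [HasExpansion]

theorem natCast_inv : HasExpansion (fun d => (d : ℝ)⁻¹) 0 1 := by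
  refine tendsto_const_nhds.congr' ?_
  filter_upwards [eventually_ge_atTop 1] with d hd
  have : (d : ℝ) ≠ 0 := Nat.cast_ne_zero.2 (by omega)
  field_simp
  ring

theorem add (ha : HasExpansion a a₀ a₁) (hb : HasExpansion b b₀ b₁) :
    HasExpansion (fun d => a d + b d) (a₀ + b₀) (a₁ + b₁) := by
  refine (Tendsto.add ha hb).congr fun d => ?_
  ring

theorem mul (ha : HasExpansion a a₀ a₁) (hb : HasExpansion b b₀ b₁) :
    HasExpansion (fun d => a d * b d) (a₀ * b₀) (a₁ * b₀ + a₀ * b₁) := by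
  have h1 := (Tendsto.mul ha hb.tendsto).add (Tendsto.const_mul a₀ hb)
  refine h1.congr fun d => ?_
  ring

theorem const_mul (c : ℝ) (ha : HasExpansion a a₀ a₁) :
    HasExpansion (fun d => c * a d) (c * a₀) (c * a₁) := by
  simpa using (const c).mul ha

theorem sub (ha : HasExpansion a a₀ a₁) (hb : HasExpansion b b₀ b₁) :
    HasExpansion (fun d => a d - b d) (a₀ - b₀) (a₁ - b₁) := by
  refine (Tendsto.sub ha hb).congr fun d => ?_
  ring

theorem sum {ι : Type} (s : Finset ι) {a : ι → ℕ → ℝ} {a₀ a₁ : ι → ℝ}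
    (h : ∀ i ∈ s, HasExpansion (a i) (a₀ i) (a₁ i)) :
    HasExpansion (fun d => ∑ i ∈ s, a i d) (∑ i ∈ s, a₀ i) (∑ i ∈ s, a₁ i) := by
  refine (tendsto_finsetSum s h).congr fun d => ?_
  rw [← Finset.mul_sum, Finset.sum_sub_distrib]

theorem inv (ha : HasExpansion a a₀ a₁) (h0 : a₀ ≠ 0) :
    HasExpansion (fun d => (a d)⁻¹) a₀⁻¹ (-a₁ * (a₀⁻¹ * a₀⁻¹)) := by
  have h1 := (Tendsto.neg ha).mul ((ha.tendsto.inv₀ h0).mul_const a₀⁻¹)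
  refine h1.congr' ?_
  filter_upwards [ha.tendsto.eventually_ne h0] with d hd
  field_simp
  ring

theorem of_mul_right (hab : HasExpansion (fun d => a d * b d) a₀ a₁)
    (hb : HasExpansion b b₀ b₁) (h0 : b₀ ≠ 0) : ∃ c₀ c₁, HasExpansion a c₀ c₁ := by
  refine ⟨_, _, (hab.mul (hb.inv h0)).congr' ?_⟩
  filter_upwards [hb.tendsto.eventually_ne h0] with d hd
  rw [mul_assoc, mul_inv_cancel₀ hd, mul_one]

end HasExpansion

/-- The first-order term in the expansion of `shiftSymbol`. -/
noncomputable def symbolCorrection (y g : PowerSeries ℝ) (n : ℕ) : PowerSeries ℝ :=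
  n * (y ^ (n - 1) * g) + (n.choose 2 : PowerSeries ℝ) * (y ^ (n - 2) * zDeriv y)

/-- The recursion of the symbols at order `1/d`. The new derivative hits one of `n` factors `y`, in
accordance with `(n + 1 choose 2) = n + (n choose 2)`. -/
theorem symbolCorrection_succ (y g : PowerSeries ℝ) (n : ℕ) : symbolCorrection y g (n + 1) =
    g * y ^ n + y * symbolCorrection y g n + zDeriv (y ^ n) := by
  rw [zDeriv_pow, symbolCorrection, symbolCorrection]
  rcases n with _ | _ | n
  · simp
  · simp
    ring
  · have h : (n + 2 + 1).choose 2 = (n + 2) + (n + 2).choose 2 := by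
      rw [Nat.choose_succ_succ, Nat.choose_one_right]
    rw [show n + 1 + 1 = n + 2 from rfl, h, show n + 2 + 1 - 1 = n + 2 by omega,
      show n + 2 + 1 - 2 = n + 1 by omega, show n + 2 - 1 = n + 1 by omega,
      show n + 2 - 2 = n by omega]
    push_cast
    ring

theorem hasExpansion_coeff_shiftSymbol {G : ℕ → PowerSeries ℝ} {y g : PowerSeries ℝ} {K : ℕ}
    (h : ∀ j ≤ K, HasExpansion (fun d => PowerSeries.coeff j (G d)) (PowerSeries.coeff j y)
      (PowerSeries.coeff j g)) (n : ℕ) :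
    ∀ j ≤ K, HasExpansion (fun d => PowerSeries.coeff j (shiftSymbol (d : ℝ)⁻¹ (G d) n))
      (PowerSeries.coeff j (y ^ n)) (PowerSeries.coeff j (symbolCorrection y g n)) := by
  induction n with
  | zero =>
    intro j _
    have : symbolCorrection y g 0 = 0 := by simp [symbolCorrection]
    simpa [shiftSymbol, this] using HasExpansion.const (PowerSeries.coeff j 1)
  | succ n ih =>
    intro j hj
    have h1 : HasExpansion (fun d => PowerSeries.coeff j (G d * shiftSymbol (d : ℝ)⁻¹ (G d) n))
        (PowerSeries.coeff j (y * y ^ n))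
        (PowerSeries.coeff j (g * y ^ n + y * symbolCorrection y g n)) := by
      simp only [map_add, PowerSeries.coeff_mul]
      rw [← Finset.sum_add_distrib]
      refine HasExpansion.sum _ fun x hx => ?_
      have := Finset.HasAntidiagonal.mem_antidiagonal.1 hx
      exact (h x.1 (by omega)).mul (ih x.2 (by omega))
    -- This term is multiplied by `1/d`, so only its limit matters and `z₁` may be left unspecified.
    have h2 : ∃ z₁, HasExpansion
        (fun d => PowerSeries.coeff j (zDeriv (shiftSymbol (d : ℝ)⁻¹ (G d) n)))
        (PowerSeries.coeff j (zDeriv (y ^ n))) z₁ := by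
      rcases j with _ | j
      · simp only [coeff_zero_zDeriv]
        exact ⟨0, HasExpansion.const 0⟩
      · simp only [coeff_zDeriv_succ, ← neg_mul]
        exact ⟨_, (ih j (by omega)).const_mul _⟩
    obtain ⟨z₁, h2⟩ := h2
    have h3 := h1.add (HasExpansion.natCast_inv.mul h2)
    rw [symbolCorrection_succ, map_add, pow_succ']
    simpa only [shiftSymbol, map_add, PowerSeries.coeff_C_mul, zero_mul, add_zero, one_mul]
      using h3

end Expansion

/-! ### Transfer of expansions between moments and cumulants -/

section MomentsAndCumulants

variable {p : ℕ → ℝ[X]}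

theorem moment_zero_rootDistribution (hp : ∀ d : ℕ, 1 ≤ d → p d ∈ realRooted d) :
    ∀ᶠ d in atTop, moment (rootDistribution d (p d)) 0 = 1 := by
  filter_upwards [eventually_ge_atTop 1] with d hd
  have := isProbabilityMeasure_rootDistribution hd (hp d hd)
  simp [moment]

theorem hasExpansion_coeff_cauchySeries {m₀ m₁ : ℕ → ℝ} {K : ℕ}
    (h : ∀ j < K, HasExpansion (fun d => moment (rootDistribution d (p d)) j) (m₀ j) (m₁ j)) :
    ∀ j ≤ K, HasExpansion
      (fun d => PowerSeries.coeff j (cauchySeries (rootDistribution d (p d))))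
      (PowerSeries.coeff j (PowerSeries.X * PowerSeries.mk m₀))
      (PowerSeries.coeff j (PowerSeries.X * PowerSeries.mk m₁)) := by
  intro j hj
  rcases j with _ | j
  · simp only [cauchySeries, PowerSeries.coeff_zero_X_mul]
    exact HasExpansion.const 0
  · simp only [cauchySeries, PowerSeries.coeff_succ_X_mul, PowerSeries.coeff_mk]
    exact h j (by omega)

/-- The moment-cumulant formula is solved for its last cumulant, whose factor, the coefficient of
`Xⁿ⁺¹` in the symbol of index `n + 1`, tends to `m₀ 0 ^ (n + 1) = 1`. -/
theorem exists_hasExpansion_finiteCumulant (hp : ∀ d : ℕ, 1 ≤ d → p d ∈ realRooted d)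
    {m₀ m₁ : ℕ → ℝ}
    (h : ∀ k, HasExpansion (fun d => moment (rootDistribution d (p d)) k) (m₀ k) (m₁ k)) (n : ℕ) :
    ∃ r₀ r₁, HasExpansion (fun d => finiteCumulant d (n + 1) (p d)) r₀ r₁ := by
  induction n using Nat.strong_induction_on with
  | _ n ih =>
    have hm0 : m₀ 0 = 1 := (((h 0).congr' (moment_zero_rootDistribution hp)).unique
      (HasExpansion.const 1)).1
    have hQ := fun i => hasExpansion_coeff_shiftSymbol
      (hasExpansion_coeff_cauchySeries (K := n + 1) fun j _ => h j) (i + 1) (n + 1) le_rfl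
    choose! r₀ r₁ hr using ih
    have hsum := HasExpansion.sum (Finset.range n) fun i hi =>
      (hr i (Finset.mem_range.1 hi)).mul (hQ i)
    have hdiff := (h (n + 1)).sub hsum
    have hlead := hdiff.congr' (b := fun d => finiteCumulant d (n + 1) (p d) *
        PowerSeries.coeff (n + 1) (shiftSymbol (d : ℝ)⁻¹
          (cauchySeries (rootDistribution d (p d))) (n + 1))) (by
      filter_upwards [eventually_ge_atTop (n + 1)] with d hd
      rw [moment_rootDistribution_eq_sum (hp d (by omega)) hd, Finset.sum_range_succ]
      ring)
    refine hlead.of_mul_right (hQ n) ?_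
    rw [coeff_self_X_mul_pow, ← PowerSeries.coeff_zero_eq_constantCoeff_apply,
      PowerSeries.coeff_mk, hm0, one_pow]
    exact one_ne_zero

/-- The Cauchy series carries a factor `X`, so the symbols up to order `k + 1` involve only moments
of order at most `k`. -/
theorem exists_hasExpansion_moment (hp : ∀ d : ℕ, 1 ≤ d → p d ∈ realRooted d) {r₀ r₁ : ℕ → ℝ}
    (h : ∀ n, 1 ≤ n → HasExpansion (fun d => finiteCumulant d n (p d)) (r₀ n) (r₁ n)) (k : ℕ) :
    ∃ m₀ m₁, HasExpansion (fun d => moment (rootDistribution d (p d)) k) m₀ m₁ := by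
  induction k using Nat.strong_induction_on with
  | _ k ih =>
    rcases k with _ | k
    · refine ⟨1, 0, (HasExpansion.const 1).congr' ?_⟩
      filter_upwards [moment_zero_rootDistribution hp] with d hd
      exact hd.symm
    · choose! m₀ m₁ hm using ih
      have hQ := fun i => hasExpansion_coeff_shiftSymbol
        (hasExpansion_coeff_cauchySeries hm) (i + 1) (k + 1) le_rfl
      refine ⟨_, _, (HasExpansion.sum (Finset.range (k + 1)) fun i _ =>
        (h (i + 1) (by omega)).mul (hQ i)).congr' ?_⟩
      filter_upwards [eventually_ge_atTop (k + 1)] with d hd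
      rw [moment_rootDistribution_eq_sum (hp d (by omega)) hd]

theorem expansion_eq_sum (hp : ∀ d : ℕ, 1 ≤ d → p d ∈ realRooted d) {m₀ m₁ r₀ r₁ : ℕ → ℝ}
    (hm : ∀ k, HasExpansion (fun d => moment (rootDistribution d (p d)) k) (m₀ k) (m₁ k))
    (hr : ∀ n, 1 ≤ n → HasExpansion (fun d => finiteCumulant d n (p d)) (r₀ n) (r₁ n))
    {k N : ℕ} (hN : k + 1 ≤ N) :
    m₀ (k + 1) = ∑ n ∈ Finset.range N, r₀ (n + 1) *
        PowerSeries.coeff (k + 1) ((PowerSeries.X * PowerSeries.mk m₀) ^ (n + 1)) ∧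
    m₁ (k + 1) = ∑ n ∈ Finset.range N, (r₁ (n + 1) *
        PowerSeries.coeff (k + 1) ((PowerSeries.X * PowerSeries.mk m₀) ^ (n + 1)) +
      r₀ (n + 1) * PowerSeries.coeff (k + 1) (symbolCorrection
        (PowerSeries.X * PowerSeries.mk m₀) (PowerSeries.X * PowerSeries.mk m₁) (n + 1))) := by
  refine (hm (k + 1)).unique ((HasExpansion.sum (Finset.range N) fun i _ =>
    (hr (i + 1) (by omega)).mul (hasExpansion_coeff_shiftSymbol
      (hasExpansion_coeff_cauchySeries (K := k + 1) fun j _ => hm j) (i + 1) (k + 1)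
        le_rfl)).congr' ?_)
  filter_upwards [eventually_ge_atTop (k + 1)] with d hd
  rw [moment_rootDistribution_eq_sum_range (hp d (by omega)) hd hN]

theorem expansion_zero (hp : ∀ d : ℕ, 1 ≤ d → p d ∈ realRooted d) {m₀ m₁ : ℕ → ℝ}
    (hm : ∀ k, HasExpansion (fun d => moment (rootDistribution d (p d)) k) (m₀ k) (m₁ k)) :
    m₀ 0 = 1 ∧ m₁ 0 = 0 :=
  ((hm 0).congr' (moment_zero_rootDistribution hp)).unique (HasExpansion.const 1)

theorem mk_eq_one_add_subst (hp : ∀ d : ℕ, 1 ≤ d → p d ∈ realRooted d) {m₀ m₁ r₀ r₁ : ℕ → ℝ}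
    (hm : ∀ k, HasExpansion (fun d => moment (rootDistribution d (p d)) k) (m₀ k) (m₁ k))
    (hr : ∀ n, 1 ≤ n → HasExpansion (fun d => finiteCumulant d n (p d)) (r₀ n) (r₁ n)) :
    PowerSeries.mk m₀ =
      1 + (cumulantSeries r₀ 0).subst (PowerSeries.X * PowerSeries.mk m₀) := by
  have hy : PowerSeries.constantCoeff (PowerSeries.X * PowerSeries.mk m₀) = 0 := by simp
  ext k
  rw [map_add, PowerSeries.coeff_mk]
  rcases k with _ | k
  · rw [coeff_subst_eq_sum hy _ zero_lt_one, (expansion_zero hp hm).1]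
    simp [cumulantSeries]
  · rw [coeff_subst_eq_sum hy _ (Nat.lt_succ_self (k + 1)), Finset.sum_range_succ',
      (expansion_eq_sum hp hm hr le_rfl).1, PowerSeries.coeff_one, if_neg (Nat.succ_ne_zero k),
      zero_add]
    simp [cumulantSeries]

/-- Order `1/d` of the moment-cumulant formula: the terms `n r_n yⁿ⁻¹ g` sum to `S'(y) g` and the
terms `(n choose 2) r_n yⁿ⁻² y'` to `½ S''(y) y'`. -/
theorem mk_correction_eq (hp : ∀ d : ℕ, 1 ≤ d → p d ∈ realRooted d) {m₀ m₁ r₀ r₁ : ℕ → ℝ}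
    (hm : ∀ k, HasExpansion (fun d => moment (rootDistribution d (p d)) k) (m₀ k) (m₁ k))
    (hr : ∀ n, 1 ≤ n → HasExpansion (fun d => finiteCumulant d n (p d)) (r₀ n) (r₁ n))
    {y g : PowerSeries ℝ} (hy : y = PowerSeries.X * PowerSeries.mk m₀)
    (hg : g = PowerSeries.X * PowerSeries.mk m₁) :
    2 * PowerSeries.mk m₁ = 2 * ((fluctuationSeries r₁).subst y * y +
      (PowerSeries.derivative ℝ (cumulantSeries r₀ 0)).subst y * g) +
      (PowerSeries.derivative ℝ (PowerSeries.derivative ℝ (cumulantSeries r₀ 0))).subst y *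
        zDeriv y := by
  have hy0 : PowerSeries.constantCoeff y = 0 := by simp [hy]
  have hg0 : PowerSeries.constantCoeff g = 0 := by simp [hg]
  have h2 : (2 : PowerSeries ℝ) = PowerSeries.C 2 := (map_ofNat PowerSeries.C 2).symm
  ext k
  rw [map_add, h2, PowerSeries.coeff_C_mul, PowerSeries.coeff_C_mul, PowerSeries.coeff_mk]
  rcases k with _ | k
  · have : PowerSeries.constantCoeff (zDeriv y) = 0 := by simp [zDeriv]
    rw [(expansion_zero hp hm).2]
    simp [hy0, hg0, this]
  · rw [map_add, coeff_subst_mul_eq_sum hy0 _ _ (show k + 1 < k + 3 by omega),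
      coeff_subst_mul_eq_sum hy0 _ _ (show k + 1 < k + 3 by omega),
      coeff_subst_mul_eq_sum hy0 _ _ (show k + 1 < k + 2 by omega),
      (expansion_eq_sum hp hm hr (show k + 1 ≤ k + 3 by omega)).2, ← hy, ← hg,
      Finset.sum_add_distrib, mul_add, mul_add, add_assoc]
    congr 1
    · congr 1
      refine Finset.sum_congr rfl fun n _ => ?_
      rw [fluctuationSeries, PowerSeries.coeff_mk, pow_succ]
    · have e : ∀ n, r₀ (n + 1) * PowerSeries.coeff (k + 1) (symbolCorrection y g (n + 1)) =
          r₀ (n + 1) * (((n : ℝ) + 1) * PowerSeries.coeff (k + 1) (y ^ n * g)) +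
          r₀ (n + 1) * (((n + 1).choose 2 : ℝ) *
            PowerSeries.coeff (k + 1) (y ^ (n - 1) * zDeriv y)) := by
        intro n
        have c1 : ((n + 1 : ℕ) : PowerSeries ℝ) = PowerSeries.C ((n : ℝ) + 1) := by
          rw [← map_natCast PowerSeries.C]; push_cast; rfl
        have c2 : (((n + 1).choose 2 : ℕ) : PowerSeries ℝ) =
            PowerSeries.C (((n + 1).choose 2 : ℕ) : ℝ) := (map_natCast PowerSeries.C _).symm
        rw [symbolCorrection, map_add, c1, c2, PowerSeries.coeff_C_mul, PowerSeries.coeff_C_mul,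
          Nat.add_sub_cancel, show n + 1 - 2 = n - 1 by omega, mul_add]
      rw [Finset.sum_congr rfl fun n _ => e n, Finset.sum_add_distrib, mul_add]
      congr 1
      · congr 1
        refine Finset.sum_congr rfl fun n _ => ?_
        rw [PowerSeries.coeff_derivative, cumulantSeries, PowerSeries.coeff_mk,
          if_neg (Nat.succ_ne_zero n), add_zero, mul_assoc]
      -- The first cumulant does not enter `S''`; dropping its term shifts the index and shortens
      -- the range from `k + 3` to `k + 2`.
      · rw [Finset.sum_range_succ', Nat.choose_eq_zero_of_lt (show 0 + 1 < 2 by omega),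
          Nat.cast_zero, zero_mul, mul_zero, add_zero, Finset.mul_sum]
        refine Finset.sum_congr rfl fun n _ => ?_
        have c : ((n + 1 + 1).choose 2 : ℝ) * 2 = ((n : ℝ) + 1 + 1) * ((n : ℝ) + 1) := by
          rw [Nat.cast_choose_two]
          push_cast
          ring
        rw [PowerSeries.coeff_derivative, PowerSeries.coeff_derivative, cumulantSeries,
          PowerSeries.coeff_mk, if_neg (Nat.succ_ne_zero _), add_zero, Nat.add_sub_cancel]
        push_cast
        linear_combination r₀ (n + 1 + 1) *
          PowerSeries.coeff (k + 1) (y ^ n * zDeriv y) * c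

end MomentsAndCumulants

/-! ### The infinitesimal Cauchy transform -/

section InfinitesimalDistribution

theorem moment_zero_eq_one (μ : Measure ℝ) [IsProbabilityMeasure μ] : moment μ 0 = 1 := by
  simp [moment]

theorem mk_moment_eq_one_add_subst (μ : Measure ℝ) [IsProbabilityMeasure μ] :
    PowerSeries.mk (moment μ) =
      1 + (cumulantSeries (freeCumulant μ) 0).subst (PowerSeries.X * PowerSeries.mk (moment μ)) := by
  have h := mk_eq_discSeries_freeCumulantSeq (moment_zero_eq_one μ)
  have h2 := discSeries_zero_eq (freeCumulant μ)
  rw [h]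
  exact h2

theorem cauchySeries_eq_discCauchy (μ : Measure ℝ) [IsProbabilityMeasure μ] :
    cauchySeries μ = discCauchy (freeCumulant μ) := by
  rw [cauchySeries, discCauchy]
  congr 1
  exact mk_eq_discSeries_freeCumulantSeq (moment_zero_eq_one μ)

theorem hSeries_eq (μ : Measure ℝ) :
    hSeries μ = PowerSeries.X * annulusSeries (freeCumulant μ) 0 := by
  rw [hSeries, annulusSeries]
  congr 2
  ext n
  exact hCoeff_eq μ n

/-- The functional equation `y = X (1 + S(y))`, differentiated in `X` and multiplied by `-X² =
dX/dz`. -/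
theorem one_sub_mul_zDeriv_cauchySeries (μ : Measure ℝ) [IsProbabilityMeasure μ] :
    (1 - PowerSeries.X * (PowerSeries.derivative ℝ
      (cumulantSeries (freeCumulant μ) 0)).subst (cauchySeries μ)) * zDeriv (cauchySeries μ) =
      -(PowerSeries.X * cauchySeries μ) := by
  have h1 : cauchySeries μ = PowerSeries.X *
      (1 + (cumulantSeries (freeCumulant μ) 0).subst (cauchySeries μ)) := by
    conv_lhs => rw [cauchySeries, mk_moment_eq_one_add_subst]
    rfl
  have h2 := congrArg (PowerSeries.derivative ℝ) h1
  rw [Derivation.leibniz, map_add, PowerSeries.derivative_subst (hasSubst_cauchySeries μ),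
    Derivation.map_one_eq_zero, PowerSeries.derivative_X, smul_eq_mul, smul_eq_mul, zero_add,
    mul_one] at h2
  rw [zDeriv]
  linear_combination PowerSeries.X * h1 - PowerSeries.X ^ 2 * h2

/-- After multiplication by `2 (1 - X S'(y))`, which is not a zero divisor, the claim is a linear
combination of the order-one equation, the differentiated functional equation and the equation of
the annular series. -/
theorem infinitesimal_cauchySeries_eq (μ : Measure ℝ) [IsProbabilityMeasure μ]
    {R M g : PowerSeries ℝ} (hg : g = PowerSeries.X * M)
    (h : 2 * M = 2 * (R.subst (cauchySeries μ) * cauchySeries μ +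
      (PowerSeries.derivative ℝ (cumulantSeries (freeCumulant μ) 0)).subst (cauchySeries μ) * g) +
      (PowerSeries.derivative ℝ (PowerSeries.derivative ℝ
        (cumulantSeries (freeCumulant μ) 0))).subst (cauchySeries μ) * zDeriv (cauchySeries μ)) :
    g = -(R.subst (cauchySeries μ) * zDeriv (cauchySeries μ)) - hSeries μ := by
  have h1 := annulusSeries_zero (freeCumulant μ)
  rw [← cauchySeries_eq_discCauchy] at h1
  have h2 := one_sub_mul_zDeriv_cauchySeries μ
  rw [hSeries_eq]
  set y := cauchySeries μ
  set S' := (PowerSeries.derivative ℝ (cumulantSeries (freeCumulant μ) 0)).subst y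
  set S'' := (PowerSeries.derivative ℝ (PowerSeries.derivative ℝ
    (cumulantSeries (freeCumulant μ) 0))).subst y
  have hne : 2 * (1 - PowerSeries.X * S') ≠ 0 := fun h0 => by
    have := congrArg PowerSeries.constantCoeff h0
    simp [map_ofNat] at this
  have hz : PowerSeries.X ^ 2 * PowerSeries.derivative ℝ y = -zDeriv y := by
    rw [zDeriv, neg_neg]
  rw [hz] at h1
  refine mul_left_cancel₀ hne ?_
  linear_combination 2 * hg + PowerSeries.X * h + 2 * R.subst y * h2 + PowerSeries.X * h1

theorem HasInfinitesimalDistribution.exists_hasCumulantFluctuations {p : ℕ → ℝ[X]}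
    {μ : Measure ℝ} {μ' : ℝ[X] →ₗ[ℝ] ℝ} (h : HasInfinitesimalDistribution p μ μ') :
    ∃ rhat : ℕ → ℝ, HasCumulantFluctuations p μ rhat := by
  have hm : ∀ k, HasExpansion (fun d => moment (rootDistribution d (p d)) k) (moment μ k)
      (μ' (X ^ k)) := h.tendsto_infinitesimal
  choose r₀ r₁ hr using exists_hasExpansion_finiteCumulant h.mem_realRooted hm
  have hr' : ∀ n, 1 ≤ n → HasExpansion (fun d => finiteCumulant d n (p d)) (r₀ (n - 1))
      (r₁ (n - 1)) := fun n hn => by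
    have := hr (n - 1)
    rwa [Nat.sub_add_cancel hn] at this
  refine ⟨fun n => r₁ (n - 1), fun n hn => ?_⟩
  have e : freeCumulant μ n = r₀ (n - 1) :=
    freeCumulantSeq_eq_of_functional_eq (r := fun n => r₀ (n - 1))
      (expansion_zero h.mem_realRooted hm).1 (mk_eq_one_add_subst h.mem_realRooted hm hr') hn
  rw [e]
  exact hr' n hn

theorem exists_measure_of_hasExpansion {p : ℕ → ℝ[X]}
    (hp : ∀ d : ℕ, 1 ≤ d → p d ∈ realRooted d) {m₀ m₁ : ℕ → ℝ}
    (hm : ∀ k, HasExpansion (fun d => moment (rootDistribution d (p d)) k) (m₀ k) (m₁ k)) :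
    ∃ ρ : Measure ℝ, IsProbabilityMeasure ρ ∧ (∀ n : ℕ, Integrable (fun t : ℝ => t ^ n) ρ) ∧
      ∀ n, moment ρ n = m₀ n :=
  -- The index is shifted because nothing is known about the polynomial at `d = 0`.
  exists_measure_of_tendsto_moment (fun i => rootDistribution (i + 1) (p (i + 1)))
    (fun i => isProbabilityMeasure_rootDistribution (by omega) (hp _ (by omega)))
    (fun i n => integrable_pow_rootDistribution (by omega) _ n) m₀
    fun n => (hm n).tendsto.comp (tendsto_add_atTop_nat 1)

theorem exists_linearMap_apply_X_pow (m : ℕ → ℝ) :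
    ∃ φ : ℝ[X] →ₗ[ℝ] ℝ, ∀ n, φ (X ^ n) = m n := by
  refine ⟨(Polynomial.basisMonomials ℝ).constr ℝ m, fun n => ?_⟩
  have := (Polynomial.basisMonomials ℝ).constr_basis ℝ m n
  simpa only [Polynomial.coe_basisMonomials, Polynomial.monomial_one_right_eq_X_pow] using this

end InfinitesimalDistribution

end FiniteFree

/-! ### The theorem -/

theorem mainTheorem7 (p q : ℕ → ℝ[X]) (μ ν : Measure ℝ) (μ' ν' : ℝ[X] →ₗ[ℝ] ℝ)
    (hp : HasInfinitesimalDistribution p μ μ') (hq : HasInfinitesimalDistribution q ν ν') :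
    (∃ ρ : Measure ℝ, IsFreeAddConvolution μ ν ρ) ∧
    ∃ rp rq : ℕ → ℝ, HasCumulantFluctuations p μ rp ∧ HasCumulantFluctuations q ν rq ∧
      ∀ ρ : Measure ℝ, IsFreeAddConvolution μ ν ρ →
        ∃ (ρ' : ℝ[X] →ₗ[ℝ] ℝ) (rpq : ℕ → ℝ),
          HasInfinitesimalDistribution (fun d => finiteFreeAdd d (p d) (q d)) ρ ρ' ∧
          HasCumulantFluctuations (fun d => finiteFreeAdd d (p d) (q d)) ρ rpq ∧
          fluctuationSeries rpq = fluctuationSeries rp + fluctuationSeries rq ∧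
          infCauchySeries ρ' =
            -(compCauchy (fluctuationSeries rp) ρ * zDeriv (cauchySeries ρ))
            - compCauchy (fluctuationSeries rq) ρ * zDeriv (cauchySeries ρ)
            - hSeries ρ := by
  obtain ⟨rp, hrp⟩ := hp.exists_hasCumulantFluctuations
  obtain ⟨rq, hrq⟩ := hq.exists_hasCumulantFluctuations
  have hreal : ∀ d : ℕ, 1 ≤ d → finiteFreeAdd d (p d) (q d) ∈ realRooted d := fun d hd =>
    finiteFreeAdd_mem_realRooted (hp.mem_realRooted d hd) (hq.mem_realRooted d hd)
  have hr : ∀ n, 1 ≤ n → HasExpansion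
      (fun d => finiteCumulant d n (finiteFreeAdd d (p d) (q d)))
      (freeCumulant μ n + freeCumulant ν n) (rp n + rq n) := fun n hn => by
    refine (HasExpansion.add (hrp n hn) (hrq n hn)).congr' ?_
    filter_upwards [eventually_ge_atTop n] with d hd
    exact (finiteCumulant_finiteFreeAdd hn hd (hp.mem_realRooted d (by omega))
      (hq.mem_realRooted d (by omega))).symm
  -- Additivity of cumulants alone gives convergence of the moments, before any limit measure is
  -- available.
  choose m₀ m₁ hm using exists_hasExpansion_moment hreal hr
  have hfun := mk_eq_one_add_subst hreal hm hr
  refine ⟨?_, rp, rq, hrp, hrq, fun ρ hρ => ?_⟩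
  · obtain ⟨ρ, hprob, hint, hmom⟩ := exists_measure_of_hasExpansion hreal hm
    refine ⟨ρ, hprob, hint, fun n hn => ?_⟩
    rw [freeCumulant, funext hmom]
    exact freeCumulantSeq_eq_of_functional_eq (expansion_zero hreal hm).1 hfun hn
  · have := hρ.isProbability
    -- The functional equation determines the moments of every free additive convolution, even if
    -- the measure itself is not unique.
    have hmom : moment ρ = m₀ := by
      have h1 := mk_moment_eq_one_add_subst ρ
      rw [cumulantSeries_congr hρ.freeCumulant_eq] at h1
      have h2 := eq_of_functional_eq _ _ _ h1 hfun
      ext n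
      simpa using congrArg (PowerSeries.coeff n) h2
    subst hmom
    have hr' : ∀ n, 1 ≤ n → HasExpansion
        (fun d => finiteCumulant d n (finiteFreeAdd d (p d) (q d)))
        (freeCumulant ρ n) (rp n + rq n) := fun n hn => by
      rw [hρ.freeCumulant_eq n hn]
      exact hr n hn
    obtain ⟨ρ', hρ'⟩ := exists_linearMap_apply_X_pow m₁
    have hm' : ∀ k, HasExpansion
        (fun d => moment (rootDistribution d (finiteFreeAdd d (p d) (q d))) k) (moment ρ k)
        (ρ' (X ^ k)) := fun k => by
      rw [hρ']
      exact hm k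
    have hfluct : fluctuationSeries (fun n => rp n + rq n) =
        fluctuationSeries rp + fluctuationSeries rq := by
      ext n
      simp [fluctuationSeries]
    refine ⟨ρ', fun n => rp n + rq n,
      ⟨⟨hreal, hρ.isProbability, hρ.integrable_pow, fun n => (hm' n).tendsto⟩, hm'⟩, hr', hfluct,
      ?_⟩
    have key := infinitesimal_cauchySeries_eq ρ (g := infCauchySeries ρ') rfl
      (mk_correction_eq hreal hm' hr' rfl rfl)
    rw [key, hfluct, compCauchy, compCauchy, PowerSeries.subst_add (hasSubst_cauchySeries ρ)]
    ring
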